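/- **Definitions.** Circuits are Boolean circuits with $\wedge,\vee,\neg$ and constants; the size of a circuit is its number of gates. Probabilities are uniform over $\{0,1\}^\ell$. *Exponentially hard one-way permutation.* A polynomial-time computable, length-preserving permutation $h$ of $\{0,1\}^*$ is $\epsilon(\ell)$ one-way with security parameter $t(\ell)$ if for all $\ell$ and all circuits $D$ with $\ell$ inputs and $\ell$ outputs, of size at most $t(\ell)$, $\mathrm{Prob}_{v\in\{0,1\}^\ell}[D(h(v))=v]\le\epsilon(\ell)$. It is exponentially hard if it is $2^{-\ell^{\Omega(1)}}$ one-way with security parameter $2^{\ell^{\Omega(1)}}$ (that is, for some $\eta>0$ and all sufficiently large $\ell$, $\epsilon(\ell)\le 2^{-\ell^{\eta}}$ and $t(\ell)\ge 2^{\ell^{\eta}}$). *$\mathrm{NP}\cap\mathrm{coNP}$ functions.* A function $f:\{0,1\}^*\to\{0,1\}$ is an $\mathrm{NP}\cap\mathrm{coNP}$ function with unique witnesses if there are polynomial-time relations $F_0,F_1$ and a constant $c$ such that $f(u)=a$ iff $\exists y\,(|y|\le|u|^c\wedge F_a(u,y))$ for $a=0,1$, and for each $u$ there is exactly one $y$ with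 $|y|\le|u|^c$ and $F_{f(u)}(u,y)$. Its Nisan–Wigderson hardness $H_f(\ell)$ is the largest $S\ge 1$ such that every circuit $C$ with $\ell$ inputs and of size at most $S$ satisfies $\mathrm{Prob}_{u\in\{0,1\}^\ell}[C(u)=f(u)]<\frac12+\frac1{2S}$ (and $0$ if there is no such $S$). *Nisan–Wigderson generator.* Let $0<\delta\le 1/3$. For $n\ge 1$ put $\ell=\lfloor n^{1/3}\rfloor$, $d=\lfloor n^{\delta}\rfloor$ and $m(n)=2^{d}$. Let $A_n=\{J_i\subseteq[n]\}_{i\in[m(n)]}$ be set systems with $|J_i|=\ell$ for all $i$ and $|J_i\cap J_j|\le d$ for $i\ne j$, such that $J_i$ is computable from $i$ (written with $d$ bits) and $1^{(n)}$ in polynomial time; call such a family uniform designs for $\delta$. The generator $NW_{A,f}:\{0,1\}^n\to\{0,1\}^{m(n)}$ has as $i$-th bit of $NW_{A,f}(w)$ the value $f(w(J_i))$, where $w(J)$ is the subsequence of $w$ indexed by $J$. $Rng(NW_{A,f})$ is the set of its values over all $n\ge 1$. *Conjecture 2.1.* For every $\mathrm{NP}\cap\mathrm{coNP}$ function $f$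 with unique witnesses and hardness $H_f(\ell)\ge 2^{\ell^{\Omega(1)}}$ (that is, for some $\eta>0$, $H_f(\ell)\ge 2^{\ell^\eta}$ for all sufficiently large $\ell$) there are $\delta$ with $0<\delta\le1/3$ and uniform designs $A$ for $\delta$ such that $Rng(NW_{A,f})\cap R\ne\emptyset$ for every $\mathrm{NP}$ set $R$ that has infinitely many elements whose lengths are of the form $m(n)$, $n\ge1$. *The task $\mathbf{Cert}(c)$*, for a constant $c\ge1$. Propositional formulas (De Morgan language) are coded by binary strings in Polish notation, with variable indices in unary; the size of a formula is the length of its code. Input: $1^{(k)}$ and a circuit $D(x,y)$ of size at most $k^{c^2}$ in $k$ variables $x$ and $k^c$ variables $y$. Required output: either a size $k$ falsifiable formula $\varphi$ such that $D(\varphi,y)$ is satisfiable, or a size $k$ tautology $\tau$ such that $D(\tau,y)$ is unsatisfiable. **Corollary.** Assume that Conjecture 2.1 holds and that an exponentially hard one-way permutation exists. Then for some $c\ge1$ the task $\mathbf{Cert}(c)$ is only partially defined for infinitely many lengths $k\ge1$: for infinitely many $k\ge 1$ there is an input of $\mathbf{Cert}(c)$ with length parameter $k$ which has no solution. -/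

import Mathlib

open Filter

noncomputable section

namespace HardTaut

/-! ### Boolean circuits

Circuits over the De Morgan basis with fan-in at most two, presented as straight-line programs.
A wire is an input variable or the output of an earlier gate; the size is the number of gates. -/

/-- A gate reading from `w` available wires. -/
inductive Gate (w : ℕ) : Type
  | const (b : Bool)
  | not (i : Fin w)
  | and (i j : Fin w)
  | or (i j : Fin w)

/-- The value of a gate when the available wires carry the values `v`. -/
def Gate.eval {w : ℕ} (v : Fin w → Bool) : Gate w → Bool
  | .const b => b
  | .not i => !(v i)
  | .and i j => v i && v j
  | .or i j => v i || v j

/-- `GateSeq n s`: a sequence of `s` gates over `n` inputs, where each gate reads input variables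
and outputs of earlier gates. -/
inductive GateSeq (n : ℕ) : ℕ → Type
  | nil : GateSeq n 0
  | snoc {s : ℕ} (G : GateSeq n s) (g : Gate (n + s)) : GateSeq n (s + 1)

/-- The values of all wires: first the `n` inputs, then the gates in order. -/
def GateSeq.wires {n : ℕ} (x : Fin n → Bool) : {s : ℕ} → GateSeq n s → Fin (n + s) → Bool
  | _, .nil => x
  | _, .snoc G g => Fin.snoc (α := fun _ => Bool) (G.wires x) (g.eval (G.wires x))

/-- A Boolean circuit with `n` inputs and `m` outputs. -/
structure Circuit (n m : ℕ) : Type where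
  size : ℕ
  gates : GateSeq n size
  out : Fin m → Fin (n + size)

/-- The function computed by a circuit. -/
def Circuit.eval {n m : ℕ} (C : Circuit n m) (x : Fin n → Bool) : Fin m → Bool :=
  fun i => C.gates.wires x (C.out i)

/-- The probability of the event `E` for a uniformly random element of `{0,1}^ℓ`. -/
def uniformProb {ℓ : ℕ} (E : (Fin ℓ → Bool) → Prop) : ℝ :=
  (Nat.card {v : Fin ℓ → Bool // E v} : ℝ) / 2 ^ ℓ

/-! ### Polynomial time, NP, and NP ∩ coNP functions

Polynomial time is Mathlib's multi-stack Turing machine notion. -/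

/-- A pair of binary strings, written with a separator symbol `none` between its components. -/
def encodePair (p : List Bool × List Bool) : List (Option Bool) :=
  p.1.map some ++ none :: p.2.map some

/-- `h : {0,1}* → {0,1}*` is computable in polynomial time. -/
def PolyTimeFun (h : List Bool → List Bool) : Prop :=
  Nonempty (Turing.TM2ComputableInPolyTime (id : List Bool → List Bool) id h)

/-- A string-valued function of two strings is computable in polynomial time. -/
def PolyTimeFun₂ (g : List Bool → List Bool → List Bool) : Prop :=
  Nonempty (Turing.TM2ComputableInPolyTime encodePair (id : List Bool → List Bool)
    (fun p => g p.1 p.2))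

/-- A binary relation on strings is decidable in polynomial time. -/
def PolyTimeRel (F : List Bool → List Bool → Bool) : Prop :=
  Nonempty (Turing.TM2ComputableInPolyTime encodePair Computability.encodeBool
    (fun p => F p.1 p.2))

/-- `R` is an NP set of binary strings. -/
def InNP (R : Set (List Bool)) : Prop :=
  ∃ (V : List Bool → List Bool → Bool) (d : ℕ), PolyTimeRel V ∧
    ∀ z, z ∈ R ↔ ∃ v : List Bool, v.length ≤ z.length ^ d ∧ V z v = true

/-- `f` is an NP ∩ coNP function with unique witnesses: for polynomial-time relations
`F false`, `F true` and a constant `c`, one has `f u = a` iff some `y` with `|y| ≤ |u|^c` satisfies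
`F a u y`, and for each `u` there is exactly one witness for the value `f u`. -/
def IsNPcoNPUnique (f : List Bool → Bool) : Prop :=
  ∃ (F : Bool → List Bool → List Bool → Bool) (c : ℕ), (∀ a, PolyTimeRel (F a)) ∧
    (∀ u a, f u = a ↔ ∃ y : List Bool, y.length ≤ u.length ^ c ∧ F a u y = true) ∧
    ∀ u, ∃! y : List Bool, y.length ≤ u.length ^ c ∧ F (f u) u y = true

/-! ### Hardness -/

/-- `f` is `(ε, S)`-hard on inputs of length `ℓ`. -/
def IsHardAt (f : List Bool → Bool) (ℓ : ℕ) (ε : ℝ) (S : ℕ) : Prop :=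
  ∀ C : Circuit ℓ 1, C.size ≤ S →
    uniformProb (fun u : Fin ℓ → Bool => C.eval u 0 = f (List.ofFn u)) < 1 / 2 + ε / 2

/-- The Nisan–Wigderson hardness `H_f(ℓ)`: the largest `S ≥ 1` such that `f` is `(1/S, S)`-hard on
inputs of length `ℓ` (and `0` if there is none). -/
def nwHardness (f : List Bool → Bool) (ℓ : ℕ) : ℕ∞ :=
  ⨆ S ∈ {S : ℕ | 1 ≤ S ∧ IsHardAt f ℓ (1 / (S : ℝ)) S}, (S : ℕ∞)

/-- `H_f(ℓ) = 2^{ℓ^{Ω(1)}}`. -/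
def HasExpHardness (f : List Bool → Bool) : Prop :=
  ∃ η : ℝ, 0 < η ∧ ∀ᶠ ℓ : ℕ in atTop, (⌈(2 : ℝ) ^ ((ℓ : ℝ) ^ η)⌉₊ : ℕ∞) ≤ nwHardness f ℓ

/-- A polynomial-time, length-preserving permutation of `{0,1}*`. -/
structure IsPolyTimePerm (h : List Bool → List Bool) : Prop where
  polyTime : PolyTimeFun h
  bijective : Function.Bijective h
  length_eq : ∀ v, (h v).length = v.length

/-- `h` is `ε(ℓ)` one-way with security parameter `t(ℓ)`. The `ℓ` inputs of the circuit receive the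
`ℓ` bits of the string `h v`. -/
def IsOneWay (h : List Bool → List Bool) (ε t : ℕ → ℝ) : Prop :=
  ∀ (ℓ : ℕ) (D : Circuit ℓ ℓ), (D.size : ℝ) ≤ t ℓ →
    uniformProb (fun v : Fin ℓ → Bool =>
      D.eval (fun j => (h (List.ofFn v)).getD j false) = v) ≤ ε ℓ

/-- `h` is an exponentially hard one-way permutation: it is `2^{-ℓ^{Ω(1)}}` one-way with security
parameter `2^{ℓ^{Ω(1)}}`. -/
def IsExpHardOWP (h : List Bool → List Bool) : Prop :=
  IsPolyTimePerm h ∧ ∃ ε t : ℕ → ℝ, IsOneWay h ε t ∧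
    ∃ η : ℝ, 0 < η ∧ ∀ᶠ ℓ : ℕ in atTop,
      ε ℓ ≤ (2 : ℝ) ^ (-((ℓ : ℝ) ^ η)) ∧ (2 : ℝ) ^ ((ℓ : ℝ) ^ η) ≤ t ℓ

/-! ### The Nisan–Wigderson generator

The parameters are `ℓ = n^{1/3}`, `m = 2^{n^δ}` and `d = log m = n^δ`, with the powers
`n^{1/3}` and `n^δ` rounded down to integers. -/

/-- `log m(n) = n^δ`. -/
def logM (δ : ℝ) (n : ℕ) : ℕ := ⌊(n : ℝ) ^ δ⌋₊

/-- `ℓ(n) = n^{1/3}`. -/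
def seedLen (n : ℕ) : ℕ := ⌊(n : ℝ) ^ (1 / 3 : ℝ)⌋₊

/-- Set systems `A_n = {J_i}` indexed by `i ∈ [m(n)]`, with `J_i ⊆ [n]`. -/
abbrev SetSystems (δ : ℝ) : Type := (n : ℕ) → Fin (2 ^ logM δ n) → Finset (Fin n)

/-- The index `i ∈ [2^k]` written as a binary string of length `k`, least significant bit first. -/
def indexBits (k i : ℕ) : List Bool := List.ofFn (fun j : Fin k => i.testBit j)

/-- The `A_n` are `(d, ℓ)`-designs of the required parameters, and `J_i` (given by its
characteristic string) is computable in polynomial time from `1^n` and `i`. -/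
structure IsUniformDesign (δ : ℝ) (A : SetSystems δ) : Prop where
  card_eq : ∀ n, 1 ≤ n → ∀ i, (A n i).card = seedLen n
  card_inter_le : ∀ n, 1 ≤ n → ∀ i j, i ≠ j → (A n i ∩ A n j).card ≤ logM δ n
  polyTime : ∃ g : List Bool → List Bool → List Bool, PolyTimeFun₂ g ∧
    ∀ n, 1 ≤ n → ∀ i : Fin (2 ^ logM δ n),
      g (List.replicate n true) (indexBits (logM δ n) i) =
        List.ofFn (fun j : Fin n => decide (j ∈ A n i))

/-- `w(J) = w_{j_1} … w_{j_ℓ}` where `J = {j_1 < … < j_ℓ}`. -/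
def restrictTo {n : ℕ} (w : Fin n → Bool) (J : Finset (Fin n)) : List Bool :=
  ((List.finRange n).filter (fun j => decide (j ∈ J))).map w

/-- The Nisan–Wigderson generator `NW_{A,f} : {0,1}^n → {0,1}^m`. -/
def NW {δ : ℝ} (A : SetSystems δ) (f : List Bool → Bool) (n : ℕ) (w : Fin n → Bool) : List Bool :=
  List.ofFn (fun i : Fin (2 ^ logM δ n) => f (restrictTo w (A n i)))

/-- The range of the generator, over all seed lengths `n ≥ 1`. -/
def rngNW {δ : ℝ} (A : SetSystems δ) (f : List Bool → Bool) : Set (List Bool) :=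
  {z | ∃ n, 1 ≤ n ∧ ∃ w : Fin n → Bool, NW A f n w = z}

/-- The conjecture on the Nisan–Wigderson generator: for every NP ∩ coNP function `f` with unique
witnesses and exponential hardness there is `δ > 0` such that the range of the generator (for some
uniform designs with the parameters above) meets every NP set that has infinitely many elements
of lengths `m(n)`, `n ≥ 1`. -/
def NWConjecture : Prop :=
  ∀ f : List Bool → Bool, IsNPcoNPUnique f → HasExpHardness f →
    ∃ δ : ℝ, 0 < δ ∧ δ ≤ 1 / 3 ∧ ∃ A : SetSystems δ, IsUniformDesign δ A ∧
      ∀ R : Set (List Bool), InNP R →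
        {z ∈ R | ∃ n, 1 ≤ n ∧ z.length = 2 ^ logM δ n}.Infinite →
        (rngNW A f ∩ R).Nonempty

/-! ### Propositional formulas and the task Cert -/

/-- Propositional formulas in the De Morgan language. -/
inductive PropFormula : Type
  | falsum
  | verum
  | var (i : ℕ)
  | neg (φ : PropFormula)
  | and (φ ψ : PropFormula)
  | or (φ ψ : PropFormula)

/-- The truth value of a formula under an assignment. -/
def PropFormula.eval (α : ℕ → Bool) : PropFormula → Bool
  | falsum => false
  | verum => true
  | var i => α i
  | neg φ => !(φ.eval α)
  | and φ ψ => φ.eval α && ψ.eval α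
  | or φ ψ => φ.eval α || ψ.eval α

/-- Formulas as binary strings: Polish notation with a prefix-free code of the symbols, where the
variable symbol is followed by its index in unary. The size of a formula is the length of its
code. -/
def PropFormula.encode : PropFormula → List Bool
  | falsum => [false, false, false]
  | verum => [false, false, true]
  | var i => [false, true, false] ++ List.replicate i true ++ [false]
  | neg φ => [false, true, true] ++ φ.encode
  | and φ ψ => [true, false] ++ φ.encode ++ ψ.encode
  | or φ ψ => [true, true] ++ φ.encode ++ ψ.encode

/-- The formula is true under all assignments. -/
def PropFormula.Tautology (φ : PropFormula) : Prop := ∀ α, φ.eval α = true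

/-- The formula is false under some assignment. -/
def PropFormula.Falsifiable (φ : PropFormula) : Prop := ∃ α, φ.eval α = false

/-- The circuit `D(x, y)`, with `k` variables `x` and `ℓ` variables `y`, outputs `1`. -/
def Circuit.Accepts {k ℓ : ℕ} (D : Circuit (k + ℓ) 1) (x : Fin k → Bool) (y : Fin ℓ → Bool) :
    Prop :=
  D.eval (Fin.append x y) 0 = true

/-- An input of `Cert(c)` of length parameter `k`: a circuit `D(x, y)` of size at most `k^{c^2}` in
`k` variables `x` and `k^c` variables `y`. -/
def IsCertInput (c k : ℕ) (D : Circuit (k + k ^ c) 1) : Prop := D.size ≤ k ^ (c ^ 2)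

/-- `x ∈ {0,1}^k` is a solution of `Cert(c)` on the input `D`: it is either a falsifiable formula
for which `D(x, y)` is satisfiable, or a tautology for which `D(x, y)` is unsatisfiable. -/
def IsCertSolution (c k : ℕ) (D : Circuit (k + k ^ c) 1) (x : Fin k → Bool) : Prop :=
  ∃ φ : PropFormula, φ.encode = List.ofFn x ∧
    ((φ.Falsifiable ∧ ∃ y, D.Accepts x y) ∨ (φ.Tautology ∧ ¬ ∃ y, D.Accepts x y))

end HardTaut

end

namespace HardTaut

/-! ### Computing sets of Boolean functions by gate sequences -/

/-! The conjecture is applied to the Goldreich–Levin bit of the one-way permutation `h`: an input is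
split into `r` and `v`, and the value is the inner product of `r` with `h⁻¹(v)`. The string `h⁻¹(v)`
is the only possible witness for either value, and `h` is computable in polynomial time, so this is
an NP ∩ coNP function with unique witnesses (`isNPcoNPUnique_hardCoreBit`). A small circuit
predicting the bit is a noisy oracle for the linear form of `h⁻¹(v)`; decoding it by majority votes
over pairwise independent points inverts `h` too well, so the bit is exponentially hard
(`hasExpHardness_hardCoreBit`).

The NP set to be hit consists of the truth tables of TAUT, restricted to strings of length `k`, for
all large `k`. Such a table has `2 ^ k` entries, so brute force over all strings and all assignments
is polynomial in its length (`inNP_tautTable`). There is a table of each length `m(n)`, so the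
conjecture gives a seed `w` whose image under the generator is the table for some `k = log m(n)`.

Now `x` codes a tautology iff the hard-core bit of `w(J_x)` is `1`, iff some `y` satisfies `h y = v`
and `⟨y, r⟩ = 1`, where `r`, `v` are read off `w(J_x)`. With `w` hard-wired, this condition on `x`,
`y` is a circuit `D` of size polynomial in `n` (`exists_verifier`), hence in `k`, because `n ≤ k ^
O(1/δ)`. So `D(x, ·)` is satisfiable exactly when `x` codes a tautology, and neither kind of
solution of `Cert` exists (`exists_certInput`). Discarding short tables makes `k` arbitrarily large.

Two translations concerning stack machines support this: polynomial-time machines are unrolled into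
circuits (`derives_of_polyTime`), and the two concrete verifiers are written in a small structured
language compiled to machines (`Prog.polyTime_of_run`). -/

theorem GateSeq.wires_snoc_castSucc {n s : ℕ} (G : GateSeq n s) (g : Gate (n + s))
    (x : Fin n → Bool) (j : Fin (n + s)) : (G.snoc g).wires x j.castSucc = G.wires x j := by
  simp [GateSeq.wires]

theorem GateSeq.wires_snoc_last {n s : ℕ} (G : GateSeq n s) (g : Gate (n + s))
    (x : Fin n → Bool) : (G.snoc g).wires x (Fin.last (n + s)) = g.eval (G.wires x) := by
  simp [GateSeq.wires]

/-- Some sequence of at most `s` gates has every function of `𝓕` among its wires. -/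
def Computes {n : ℕ} (s : ℕ) (𝓕 : Set ((Fin n → Bool) → Bool)) : Prop :=
  ∃ s' ≤ s, ∃ G : GateSeq n s', ∀ f ∈ 𝓕, ∃ j, ∀ x, G.wires x j = f x

theorem Computes.mono {n s s' : ℕ} {𝓕 𝓖 : Set ((Fin n → Bool) → Bool)} (h : Computes s 𝓕)
    (hs : s ≤ s') (h𝓖 : 𝓖 ⊆ 𝓕) : Computes s' 𝓖 := by
  obtain ⟨t, ht, G, hG⟩ := h
  exact ⟨t, ht.trans hs, G, fun f hf => hG f (h𝓖 hf)⟩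

theorem computes_inputs (n : ℕ) :
    Computes 0 (Set.range fun (i : Fin n) (x : Fin n → Bool) => x i) :=
  ⟨0, le_rfl, .nil, by rintro _ ⟨i, rfl⟩; exact ⟨i, fun x => rfl⟩⟩

/-- The positions of the wires, and even the length of the sequence, are hidden by existential
quantifiers. The new gate must therefore be found for every sequence that carries `𝓕`. -/
theorem Computes.snoc {n s : ℕ} {𝓕 : Set ((Fin n → Bool) → Bool)} (h : Computes s 𝓕)
    {f : (Fin n → Bool) → Bool}
    (hf : ∀ {s' : ℕ} (G : GateSeq n s'), (∀ f ∈ 𝓕, ∃ j, ∀ x, G.wires x j = f x) →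
      ∃ g : Gate (n + s'), ∀ x, g.eval (G.wires x) = f x) :
    Computes (s + 1) (insert f 𝓕) := by
  obtain ⟨t, ht, G, hG⟩ := h
  obtain ⟨g, hg⟩ := hf G hG
  refine ⟨t + 1, by omega, G.snoc g, ?_⟩
  rintro f' (rfl | hf')
  · exact ⟨Fin.last (n + t), fun x => (GateSeq.wires_snoc_last G g x).trans (hg x)⟩
  · obtain ⟨j, hj⟩ := hG f' hf'
    exact ⟨j.castSucc, fun x => (GateSeq.wires_snoc_castSucc G g x j).trans (hj x)⟩

theorem Computes.exists_circuit {n m s : ℕ} {𝓕 : Set ((Fin n → Bool) → Bool)} (h : Computes s 𝓕)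
    (f : Fin m → (Fin n → Bool) → Bool) (hf : ∀ i, f i ∈ 𝓕) :
    ∃ C : Circuit n m, C.size ≤ s ∧ ∀ x i, C.eval x i = f i x := by
  obtain ⟨t, ht, G, hG⟩ := h
  choose j hj using fun i => hG (f i) (hf i)
  exact ⟨⟨t, G, j⟩, ht, fun x i => hj i x⟩

/-- The functions `𝓣` can be computed with `c` further gates once the functions `𝓕` are
available. -/
def Derives {n : ℕ} (c : ℕ) (𝓕 𝓣 : Set ((Fin n → Bool) → Bool)) : Prop :=
  ∀ s 𝓖, 𝓕 ⊆ 𝓖 → Computes s 𝓖 → Computes (s + c) (𝓖 ∪ 𝓣)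

namespace Derives

variable {n c c₁ c₂ : ℕ} {𝓕 𝓕' 𝓣 𝓣' : Set ((Fin n → Bool) → Bool)} {f g : (Fin n → Bool) → Bool}

theorem mono (h : Derives c₁ 𝓕 𝓣) (hc : c₁ ≤ c₂) (h𝓕 : 𝓕 ⊆ 𝓕') (h𝓣 : 𝓣' ⊆ 𝓣) :
    Derives c₂ 𝓕' 𝓣' := fun s 𝓖 h𝓖 hs =>
  (h s 𝓖 (h𝓕.trans h𝓖) hs).mono (by omega) (Set.union_subset_union_right _ h𝓣)

theorem mono_cost (h : Derives c₁ 𝓕 𝓣) (hc : c₁ ≤ c₂) : Derives c₂ 𝓕 𝓣 :=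
  h.mono hc subset_rfl subset_rfl

theorem of_subset (h : 𝓣 ⊆ 𝓕) : Derives 0 𝓕 𝓣 := fun _ _ h𝓖 hs =>
  hs.mono le_rfl (Set.union_subset subset_rfl (h.trans h𝓖))

theorem of_mem (h : f ∈ 𝓕) : Derives 0 𝓕 {f} := of_subset (by simpa using h)

/-- Costs add because `Derives` starts from an arbitrary computed superset of `𝓕` and keeps all of
it: the second derivation continues on the wires left by the first. -/
theorem trans (h₁ : Derives c₁ 𝓕 𝓣) (h₂ : Derives c₂ (𝓕 ∪ 𝓣) 𝓣') :
    Derives (c₁ + c₂) 𝓕 (𝓣 ∪ 𝓣') := fun s 𝓖 h𝓖 hs => by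
  have := h₂ _ _ (Set.union_subset_union_left 𝓣 h𝓖) (h₁ s 𝓖 h𝓖 hs)
  exact this.mono (by omega) (by rw [Set.union_assoc])

theorem trans_right (h₁ : Derives c₁ 𝓕 𝓣) (h₂ : Derives c₂ (𝓕 ∪ 𝓣) 𝓣') :
    Derives (c₁ + c₂) 𝓕 𝓣' :=
  (h₁.trans h₂).mono le_rfl subset_rfl Set.subset_union_right

theorem trans_of_right (h₁ : Derives c₁ 𝓕 𝓣) (h₂ : Derives c₂ 𝓣 𝓣') :
    Derives (c₁ + c₂) 𝓕 𝓣' :=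
  h₁.trans_right (h₂.mono le_rfl Set.subset_union_right subset_rfl)

theorem union (h₁ : Derives c₁ 𝓕 𝓣) (h₂ : Derives c₂ 𝓕 𝓣') : Derives (c₁ + c₂) 𝓕 (𝓣 ∪ 𝓣') :=
  h₁.trans (h₂.mono le_rfl Set.subset_union_left subset_rfl)

theorem finset_biUnion {κ : Type*} (K : Finset κ) {T : κ → Set ((Fin n → Bool) → Bool)}
    (h : ∀ j ∈ K, Derives c 𝓕 (T j)) : Derives (K.card * c) 𝓕 (⋃ j ∈ K, T j) := by
  classical
  induction K using Finset.induction_on with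
  | empty => simpa using of_subset (Set.empty_subset _)
  | insert a s ha ih =>
    rw [Finset.card_insert_of_notMem ha, Finset.set_biUnion_insert]
    exact ((h a (by simp)).union (ih fun j hj => h j (by simp [hj]))).mono_cost (by ring_nf; rfl)

theorem range {κ : Type*} [Fintype κ] {T : κ → (Fin n → Bool) → Bool}
    (h : ∀ j, Derives c 𝓕 {T j}) : Derives (Fintype.card κ * c) 𝓕 (Set.range T) :=
  (finset_biUnion Finset.univ fun j _ => h j).mono le_rfl subset_rfl
    (by rintro _ ⟨j, rfl⟩; simp)

theorem singleton_of_gate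
    (hf : ∀ {s' : ℕ} (G : GateSeq n s'), (∀ f ∈ 𝓕, ∃ j, ∀ x, G.wires x j = f x) →
      ∃ g : Gate (n + s'), ∀ x, g.eval (G.wires x) = f x) :
    Derives 1 𝓕 {f} := fun s 𝓖 h𝓖 hs => by
  rw [Set.union_singleton]
  exact hs.snoc fun G hG => hf G fun f hf => hG f (h𝓖 hf)

theorem const (b : Bool) : Derives 1 𝓕 {fun _ => b} :=
  singleton_of_gate fun _ _ => ⟨.const b, fun _ => rfl⟩

theorem not (hf : Derives c 𝓕 {f}) : Derives (c + 1) 𝓕 {fun x => !f x} :=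
  hf.trans_right <| singleton_of_gate fun G hG => by
    obtain ⟨j, hj⟩ := hG f (by simp)
    exact ⟨.not j, fun x => by simp [Gate.eval, hj]⟩

theorem and (hf : Derives c₁ 𝓕 {f}) (hg : Derives c₂ 𝓕 {g}) :
    Derives (c₁ + c₂ + 1) 𝓕 {fun x => f x && g x} :=
  (hf.union hg).trans_right <| singleton_of_gate fun G hG => by
    obtain ⟨j, hj⟩ := hG f (by simp)
    obtain ⟨j', hj'⟩ := hG g (by simp)
    exact ⟨.and j j', fun x => by simp [Gate.eval, hj, hj']⟩

theorem or (hf : Derives c₁ 𝓕 {f}) (hg : Derives c₂ 𝓕 {g}) :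
    Derives (c₁ + c₂ + 1) 𝓕 {fun x => f x || g x} :=
  (hf.union hg).trans_right <| singleton_of_gate fun G hG => by
    obtain ⟨j, hj⟩ := hG f (by simp)
    obtain ⟨j', hj'⟩ := hG g (by simp)
    exact ⟨.or j j', fun x => by simp [Gate.eval, hj, hj']⟩

theorem congr (hf : Derives c 𝓕 {f}) (h : ∀ x, g x = f x) : Derives c 𝓕 {g} := by
  rwa [show g = f from funext h]

/-- Every function of the value of `l.length` available functions can be derived, at a cost that
depends only on the number of these functions. -/
def lookupCost : ℕ → ℕ
  | 0 => 1
  | m + 1 => 2 * lookupCost m + 4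

theorem lookupCost_mono : Monotone lookupCost :=
  monotone_nat_of_le_succ fun m => by simp only [lookupCost]; omega

/-- Shannon expansion along the first function `f` of the list: `T` is selected by `f` from two
functions that depend on the tail only. The exponential cost is harmless, as the lists used have a
length depending on the machine alone. -/
theorem of_depends (l : List ((Fin n → Bool) → Bool)) (hl : ∀ f ∈ l, f ∈ 𝓕)
    (T : (Fin n → Bool) → Bool) (hT : ∀ x x', (∀ f ∈ l, f x = f x') → T x = T x') :
    Derives (lookupCost l.length) 𝓕 {T} := by
  classical
  induction l generalizing T with
  | nil =>
    exact (const (T fun _ => false)).congr fun x => hT _ _ (by simp)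
  | cons f l ih =>
    -- The restriction of `T` to `f = b` is a function of the tail only after extension to tail
    -- values not attained there; the existential quantifier extends it by `false`.
    let R (b : Bool) (x : Fin n → Bool) : Bool :=
      decide (∃ x', f x' = b ∧ (∀ g ∈ l, g x = g x') ∧ T x' = true)
    have hR (b : Bool) : Derives (lookupCost l.length) 𝓕 {R b} := by
      refine ih (fun g hg => hl g (by simp [hg])) (R b) fun x x' h => ?_
      simp only [R]
      congr 1
      refine propext (exists_congr fun y => and_congr_right fun _ => and_congr_left fun _ => ?_)
      exact forall₂_congr fun g hg => by rw [h g hg]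
    have hf : Derives 0 𝓕 {f} := of_mem (hl f (by simp))
    have key (x : Fin n → Bool) : T x = R (f x) x := by
      rw [Bool.eq_iff_iff, decide_eq_true_iff]
      refine ⟨fun h => ⟨x, rfl, fun _ _ => rfl, h⟩, fun ⟨x', h1, h2, h3⟩ => ?_⟩
      rw [hT x x', h3]
      simpa [h1] using h2
    refine (((hf.and (hR true)).or (hf.not.and (hR false))).mono_cost ?_).congr fun x => ?_
    · simp only [List.length_cons, lookupCost]; omega
    · rw [key]; cases f x <;> simp

/-- The available functions can be fed into a circuit. -/
theorem circuit {m k : ℕ} (C : Circuit m k) (f : Fin m → (Fin n → Bool) → Bool)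
    (hf : ∀ i, f i ∈ 𝓕) :
    Derives C.size 𝓕 (Set.range fun i x => C.eval (fun j => f j x) i) := by
  have key {s : ℕ} (G : GateSeq m s) :
      Derives s 𝓕 (Set.range fun j x => G.wires (fun i => f i x) j) := by
    induction G with
    | nil => exact of_subset (by rintro _ ⟨i, rfl⟩; exact hf i)
    | @snoc s G g ih =>
      refine (ih.trans (c₂ := 1)
        (𝓣' := {fun x => g.eval (G.wires fun i => f i x)}) ?_).mono le_rfl subset_rfl ?_
      · have hw (j : Fin (m + s)) :
            Derives 0 (𝓕 ∪ Set.range fun j x => G.wires (fun i => f i x) j)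
              {fun x => G.wires (fun i => f i x) j} := of_mem (Or.inr ⟨j, rfl⟩)
        cases g with
        | const b => exact const b
        | not i => exact (hw i).not
        | and i j => exact (hw i).and (hw j)
        | or i j => exact (hw i).or (hw j)
      · rintro _ ⟨j, rfl⟩
        induction j using Fin.lastCases with
        | last => exact Or.inr (funext fun x => GateSeq.wires_snoc_last G g _)
        | cast j => exact Or.inl ⟨j, funext fun x => (GateSeq.wires_snoc_castSucc G g _ j).symm⟩
  refine (key C.gates).mono le_rfl subset_rfl ?_
  rintro _ ⟨i, rfl⟩
  exact ⟨C.out i, rfl⟩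

theorem xor (hf : Derives c₁ 𝓕 {f}) (hg : Derives c₂ 𝓕 {g}) :
    Derives (c₁ + c₂ + 5) 𝓕 {fun x => f x ^^ g x} := by
  -- Both functions become wires first, so each is paid for once although it is used twice.
  refine ((hf.union hg).trans_right (c₂ := 5) ?_).mono_cost (by omega)
  have hf' : Derives 0 (𝓕 ∪ ({f} ∪ {g})) {f} := of_mem (by simp)
  have hg' : Derives 0 (𝓕 ∪ ({f} ∪ {g})) {g} := of_mem (by simp)
  exact ((hf'.and hg'.not).or (hf'.not.and hg')).congr fun x => by cases f x <;> cases g x <;> rfl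

theorem cond {h : (Fin n → Bool) → Bool} {c₃ : ℕ} (hh : Derives c₃ 𝓕 {h}) (hf : Derives c₁ 𝓕 {f})
    (hg : Derives c₂ 𝓕 {g}) :
    Derives (c₃ + c₁ + c₂ + 4) 𝓕 {fun x => bif h x then f x else g x} := by
  refine (((hh.union hf).union hg).trans_right (c₂ := 4) ?_).mono_cost (by omega)
  have hh' : Derives 0 (𝓕 ∪ ({h} ∪ {f} ∪ {g})) {h} := of_mem (by simp)
  have hf' : Derives 0 (𝓕 ∪ ({h} ∪ {f} ∪ {g})) {f} := of_mem (by simp)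
  have hg' : Derives 0 (𝓕 ∪ ({h} ∪ {f} ∪ {g})) {g} := of_mem (by simp)
  exact ((hh'.and hf').or (hh'.not.and hg')).congr fun x => by
    cases h x <;> cases f x <;> cases g x <;> rfl

/-- Conjunctions over a finite index type. -/
theorem list_all {κ : Type*} (l : List κ) {T : κ → (Fin n → Bool) → Bool}
    (h : ∀ j ∈ l, Derives c 𝓕 {T j}) :
    Derives (l.length * (c + 1) + 1) 𝓕 {fun x => l.all fun j => T j x} := by
  induction l with
  | nil => exact (const true).mono_cost (by simp)
  | cons a l ih =>
    have := (h a (by simp)).and (ih fun j hj => h j (by simp [hj]))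
    refine (this.mono_cost ?_).congr fun x => List.all_cons
    simp only [List.length_cons]
    ring_nf
    omega

end Derives

end HardTaut

namespace HardTaut

open Turing

/-! ### Stack machines as circuits -/

section StackMachine

variable {K : Type} {Γ : K → Type} {Λ σ : Type}

/-- The symbols that a statement can push. -/
def pushSymbols : TM2.Stmt Γ Λ σ → Set (Σ k, Γ k)
  | .push k f q => (Set.range fun v => ⟨k, f v⟩) ∪ pushSymbols q
  | .peek _ _ q | .pop _ _ q | .load _ q => pushSymbols q
  | .branch _ q₁ q₂ => pushSymbols q₁ ∪ pushSymbols q₂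
  | .goto _ | .halt => ∅

/-- Only the input stack of a machine is required to have a finite alphabet. The internal state
ranges over a finite set, so a statement pushes finitely many symbols, and configurations can be
described by finitely many kinds of bits. -/
theorem finite_pushSymbols [Finite σ] (q : TM2.Stmt Γ Λ σ) : (pushSymbols q).Finite := by
  induction q with
  | push k f q ih => exact (Set.finite_range _).union ih
  | peek _ _ _ ih | pop _ _ _ ih | load _ _ ih => exact ih
  | branch _ _ _ ih₁ ih₂ => exact ih₁.union ih₂
  | goto | halt => exact Set.finite_empty

/-- A bound for the number of stack accesses of a statement. -/
def stmtDepth : TM2.Stmt Γ Λ σ → ℕ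
  | .push _ _ q | .peek _ _ q | .pop _ _ q => stmtDepth q + 1
  | .load _ q => stmtDepth q
  | .branch _ q₁ q₂ => max (stmtDepth q₁) (stmtDepth q₂)
  | .goto _ | .halt => 0

variable [DecidableEq K]

theorem stepAux_symbols {𝒜 : Set (Σ k, Γ k)} (q : TM2.Stmt Γ Λ σ) (hq : pushSymbols q ⊆ 𝒜)
    (v : σ) (S : ∀ k, List (Γ k)) (hS : ∀ k, ∀ γ ∈ S k, ⟨k, γ⟩ ∈ 𝒜) :
    ∀ k, ∀ γ ∈ (TM2.stepAux q v S).stk k, (⟨k, γ⟩ : Σ k, Γ k) ∈ 𝒜 := by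
  induction q generalizing v S with
  | push k f q ih =>
    refine ih (fun a ha => hq (Or.inr ha)) _ _ fun k' γ hγ => ?_
    rcases eq_or_ne k' k with rfl | hk
    · simp only [Function.update_self, List.mem_cons] at hγ
      rcases hγ with rfl | hγ
      · exact hq (Or.inl ⟨v, rfl⟩)
      · exact hS _ _ hγ
    · rw [Function.update_of_ne hk] at hγ
      exact hS _ _ hγ
  | peek _ _ _ ih => exact ih hq _ _ hS
  | pop k f q ih =>
    refine ih hq _ _ fun k' γ hγ => ?_
    rcases eq_or_ne k' k with rfl | hk
    · simp only [Function.update_self] at hγ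
      exact hS _ _ (List.mem_of_mem_tail hγ)
    · rw [Function.update_of_ne hk] at hγ
      exact hS _ _ hγ
  | load _ _ ih => exact ih hq _ _ hS
  | branch f q₁ q₂ ih₁ ih₂ =>
    simp only [TM2.stepAux]
    cases f v
    · exact ih₂ (fun a ha => hq (Or.inr ha)) _ _ hS
    · exact ih₁ (fun a ha => hq (Or.inl ha)) _ _ hS
  | goto | halt => exact hS

theorem stepAux_length_le {N : ℕ} (q : TM2.Stmt Γ Λ σ) (v : σ) (S : ∀ k, List (Γ k))
    (hS : ∀ k, (S k).length ≤ N) (k : K) :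
    ((TM2.stepAux q v S).stk k).length ≤ N + stmtDepth q := by
  induction q generalizing v S N with
  | push k' f q ih =>
    refine (ih (N := N + 1) _ _ fun k => ?_).trans (by simp only [stmtDepth]; omega)
    rcases eq_or_ne k k' with rfl | hk
    · simpa using hS k
    · simpa [Function.update_of_ne hk] using (hS k).trans (Nat.le_succ N)
  | peek _ _ _ ih => exact (ih _ _ hS).trans (by simp only [stmtDepth]; omega)
  | pop k' f q ih =>
    refine (ih (N := N) _ _ fun k => ?_).trans (by simp only [stmtDepth]; omega)
    rcases eq_or_ne k k' with rfl | hk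
    · simpa using (hS k).trans (Nat.le_succ N)
    · simpa [Function.update_of_ne hk] using hS k
  | load _ _ ih => exact ih _ _ hS
  | branch f q₁ q₂ ih₁ ih₂ =>
    simp only [TM2.stepAux, stmtDepth]
    cases f v
    · exact (ih₂ _ _ hS).trans (by omega)
    · exact (ih₁ _ _ hS).trans (by omega)
  | goto | halt => exact (hS k).trans (by omega)

/-- The next state and the `j`-th cell of stack `k` depend only on the topmost cells and on
the cells near position `j` of stack `k`. -/
theorem stepAux_local (q : TM2.Stmt Γ Λ σ) {d j : ℕ} {k : K} (hd : stmtDepth q ≤ d) (v : σ)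
    (S S' : ∀ k, List (Γ k)) (htop : ∀ k', ∀ i < d, (S k')[i]? = (S' k')[i]?)
    (hnear : ∀ i, i ≤ j + d → j ≤ i + d → (S k)[i]? = (S' k)[i]?) :
    (TM2.stepAux q v S).l = (TM2.stepAux q v S').l ∧
      (TM2.stepAux q v S).var = (TM2.stepAux q v S').var ∧
      ((TM2.stepAux q v S).stk k)[j]? = ((TM2.stepAux q v S').stk k)[j]? := by
  induction q generalizing v S S' d with
  | push k' f q ih =>
    simp only [stmtDepth] at hd
    obtain ⟨d, rfl⟩ : ∃ e, d = e + 1 := ⟨d - 1, by omega⟩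
    refine ih (d := d) (by omega) _ _ _ (fun k'' i hi => ?_) fun i hi hi' => ?_
    · rcases eq_or_ne k'' k' with rfl | hk
      · rcases i with _ | i
        · simp
        · simpa using htop k'' i (by omega)
      · simpa [Function.update_of_ne hk] using htop k'' i (by omega)
    · rcases eq_or_ne k k' with rfl | hk
      · rcases i with _ | i
        · simp
        · simpa using hnear i (by omega) (by omega)
      · simpa [Function.update_of_ne hk] using hnear i (by omega) (by omega)
  | peek k' f q ih =>
    simp only [stmtDepth] at hd
    simp only [TM2.stepAux, List.head?_eq_getElem?]
    rw [htop k' 0 (by omega)]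
    exact ih (by omega) _ _ _ htop hnear
  | pop k' f q ih =>
    simp only [stmtDepth] at hd
    obtain ⟨d, rfl⟩ : ∃ e, d = e + 1 := ⟨d - 1, by omega⟩
    simp only [TM2.stepAux, List.head?_eq_getElem?]
    rw [htop k' 0 (by omega)]
    refine ih (d := d) (by omega) _ _ _ (fun k'' i hi => ?_) fun i hi hi' => ?_
    · rcases eq_or_ne k'' k' with rfl | hk
      · simpa using htop k'' (i + 1) (by omega)
      · simpa [Function.update_of_ne hk] using htop k'' i (by omega)
    · rcases eq_or_ne k k' with rfl | hk
      · simpa using hnear (i + 1) (by omega) (by omega)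
      · simpa [Function.update_of_ne hk] using hnear i (by omega) (by omega)
  | load _ _ ih => exact ih hd _ _ _ htop hnear
  | branch f q₁ q₂ ih₁ ih₂ =>
    simp only [stmtDepth] at hd
    simp only [TM2.stepAux]
    cases f v
    · exact ih₂ (by omega) _ _ _ htop hnear
    · exact ih₁ (by omega) _ _ _ htop hnear
  | goto | halt => exact ⟨rfl, rfl, hnear j (by omega) (by omega)⟩

variable (M : Λ → TM2.Stmt Γ Λ σ)

/-- The step function of a stack machine, with halted configurations kept fixed. -/
def stepTotal (c : TM2.Cfg Γ Λ σ) : TM2.Cfg Γ Λ σ := (TM2.step M c).getD c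

/-- The halting time varies with the input, whereas a circuit simulates a fixed number of steps.
Freezing halted configurations makes any later time equally good. -/
theorem stepTotal_iterate_of_halts {c c' : TM2.Cfg Γ Λ σ} {s t : ℕ} (hst : s ≤ t)
    (h : (flip Bind.bind (TM2.step M))^[s] (some c) = some c') (hc' : c'.l = none) :
    (stepTotal M)^[t] c = c' := by
  have hfix (r : ℕ) : (stepTotal M)^[r] c' = c' := by
    refine Function.iterate_fixed ?_ r
    obtain ⟨l, v, S⟩ := c'
    obtain rfl : l = none := hc'
    rfl
  have hnone (r : ℕ) : (flip Bind.bind (TM2.step M))^[r] none = none :=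
    Function.iterate_fixed rfl r
  obtain ⟨r, rfl⟩ := Nat.exists_eq_add_of_le' hst
  rw [Function.iterate_add_apply]
  suffices (stepTotal M)^[s] c = c' by rw [this, hfix]
  clear hst hfix hc'
  induction s generalizing c with
  | zero => simpa using h
  | succ s ih =>
    rw [Function.iterate_succ_apply] at h ⊢
    rcases hc : TM2.step M c with _ | c₁
    · have : flip Bind.bind (TM2.step M) (some c) = none := hc
      rw [this, hnone] at h
      cases h
    · have h1 : flip Bind.bind (TM2.step M) (some c) = some c₁ := hc
      have h2 : stepTotal M c = c₁ := by simp [stepTotal, hc]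
      rw [h1] at h
      rw [h2, ih h]

end StackMachine

/-! ### Circuits for the steps of a stack machine -/

section Bits

open scoped Classical

variable {n : ℕ}

theorem Derives.of_depends_finset {𝓕 : Set ((Fin n → Bool) → Bool)} {B : ℕ}
    (s : Finset ((Fin n → Bool) → Bool)) (hs : ↑s ⊆ 𝓕) (hB : s.card ≤ B)
    (T : (Fin n → Bool) → Bool) (hT : ∀ x x', (∀ f ∈ s, f x = f x') → T x = T x') :
    Derives (lookupCost B) 𝓕 {T} :=
  (of_depends s.toList (fun f hf => hs (by simpa using hf)) T fun x x' h =>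
    hT x x' fun f hf => h f (by simpa using hf)).mono_cost (lookupCost_mono (by simpa using hB))

variable {K : Type} {Γ : K → Type} {Λ σ : Type}

/-- The bits that describe a configuration depending on `x`, with stacks truncated at height `H`
and symbols in `𝒜`. -/
def cfgBits (𝒜 : Finset (Σ k, Γ k)) (H : ℕ) (C : (Fin n → Bool) → TM2.Cfg Γ Λ σ) :
    Set ((Fin n → Bool) → Bool) :=
  ((Set.range fun (l : Option Λ) x => decide ((C x).l = l)) ∪
    Set.range fun (v : σ) x => decide ((C x).var = v)) ∪
    Set.range fun (p : 𝒜 × Fin H) x => decide (((C x).stk p.1.1.1)[(p.2 : ℕ)]? = some p.1.1.2)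

variable [Fintype Λ] [Fintype σ] [DecidableEq K] (M : Λ → TM2.Stmt Γ Λ σ)

/-- Locality: each new bit is determined by the label, the state, the top `d` cells of the stacks
and the cells within distance `d` of its position. These are boundedly many old bits, so one lookup
of constant cost per bit suffices, and the number of bits is linear in `H`. -/
theorem derives_cfgBits_step [Nonempty K] (𝒜 : Finset (Σ k, Γ k)) (d : ℕ)
    (hd : ∀ l, stmtDepth (M l) ≤ d) {H : ℕ} (C : (Fin n → Bool) → TM2.Cfg Γ Λ σ)
    (hC : ∀ x k, ((C x).stk k).length ≤ H) (hC' : ∀ x k, ∀ γ ∈ (C x).stk k, ⟨k, γ⟩ ∈ 𝒜) :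
    Derives ((Fintype.card (Option Λ) + Fintype.card σ + 𝒜.card * H) *
        Derives.lookupCost (Fintype.card (Option Λ) + Fintype.card σ + 𝒜.card * (d + (2 * d + 1))))
      (cfgBits 𝒜 H C) (cfgBits 𝒜 H fun x => stepTotal M (C x)) := by
  let s (j : ℕ) : Finset ((Fin n → Bool) → Bool) :=
    ((Finset.univ.image fun (l : Option Λ) x => decide ((C x).l = l)) ∪
      Finset.univ.image fun (v : σ) x => decide ((C x).var = v)) ∪
      (𝒜 ×ˢ ((Finset.range d ∪ Finset.Icc (j - d) (j + d)).filter (· < H))).image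
        fun p x => decide (((C x).stk p.1.1)[p.2]? = some p.1.2)
  have hsub (j : ℕ) : ↑(s j) ⊆ cfgBits 𝒜 H C := by
    intro f hf
    simp only [s, Finset.coe_union, Finset.coe_image, Finset.coe_univ, Set.image_univ] at hf
    rcases hf with hf | ⟨⟨a, i⟩, hai, rfl⟩
    · exact Or.inl hf
    · simp only [Finset.coe_product, Set.mem_prod, Finset.mem_coe, Finset.mem_filter] at hai
      exact Or.inr ⟨(⟨a, hai.1⟩, ⟨i, hai.2.2⟩), rfl⟩
  have hcard (j : ℕ) : (s j).card ≤
      Fintype.card (Option Λ) + Fintype.card σ + 𝒜.card * (d + (2 * d + 1)) := by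
    refine (Finset.card_union_le _ _).trans (add_le_add ((Finset.card_union_le _ _).trans
      (add_le_add Finset.card_image_le Finset.card_image_le)) (Finset.card_image_le.trans ?_))
    rw [Finset.card_product]
    refine Nat.mul_le_mul_left _ ((Finset.card_filter_le _ _).trans
      ((Finset.card_union_le _ _).trans ?_))
    simp only [Finset.card_range, Nat.card_Icc]
    omega
  -- At height `H` and above both cells are empty; below, the bits for `𝒜` determine the cell
  -- because no other symbol occurs.
  have hcell (x x' : Fin n → Bool) (k : K) (i : ℕ)
      (h : i < H → ∀ γ, ⟨k, γ⟩ ∈ 𝒜 →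
        (((C x).stk k)[i]? = some γ ↔ ((C x').stk k)[i]? = some γ)) :
      ((C x).stk k)[i]? = ((C x').stk k)[i]? := by
    by_cases hi : i < H
    · refine Option.ext fun γ => ⟨fun hγ => ?_, fun hγ => ?_⟩
      · exact (h hi γ (hC' x k γ (List.mem_of_getElem? hγ))).1 hγ
      · exact (h hi γ (hC' x' k γ (List.mem_of_getElem? hγ))).2 hγ
    · rw [List.getElem?_eq_none (by have := hC x k; omega),
        List.getElem?_eq_none (by have := hC x' k; omega)]
  have hdep (j : ℕ) (k : K) (x x' : Fin n → Bool) (h : ∀ f ∈ s j, f x = f x') :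
      (stepTotal M (C x)).l = (stepTotal M (C x')).l ∧
      (stepTotal M (C x)).var = (stepTotal M (C x')).var ∧
      ((stepTotal M (C x)).stk k)[j]? = ((stepTotal M (C x')).stk k)[j]? := by
    have hl : (C x).l = (C x').l := by
      have := h (fun y => decide ((C y).l = (C x').l)) (by simp [s])
      simpa using this
    have hv : (C x).var = (C x').var := by
      have := h (fun y => decide ((C y).var = (C x').var)) (by simp [s])
      simpa using this
    have hwin (k' : K) (i : ℕ) (hi : i < d ∨ (j ≤ i + d ∧ i ≤ j + d)) :
        ((C x).stk k')[i]? = ((C x').stk k')[i]? := by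
      refine hcell x x' k' i fun hiH γ hγ => ?_
      have := h (fun y => decide (((C y).stk k')[i]? = some γ)) (by
        refine Finset.mem_union_right _ (Finset.mem_image.2 ⟨(⟨k', γ⟩, i), ?_, rfl⟩)
        simp only [Finset.mem_product, Finset.mem_filter, Finset.mem_union, Finset.mem_range,
          Finset.mem_Icc]
        exact ⟨hγ, by omega, hiH⟩)
      simpa using this
    rcases hx : C x with ⟨l, v, S⟩
    rcases hx' : C x' with ⟨l', v', S'⟩
    simp only [hx, hx'] at hl hv hwin
    subst hl hv
    cases l with
    | none => exact ⟨rfl, rfl, hwin k j (by omega)⟩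
    | some l =>
      exact stepAux_local (M l) (hd l) v S S' (fun k' i hi => hwin k' i (Or.inl hi))
        fun i hi hi' => hwin k i (Or.inr ⟨hi', hi⟩)
  obtain ⟨k₀⟩ := ‹Nonempty K›
  let W := Derives.lookupCost
    (Fintype.card (Option Λ) + Fintype.card σ + 𝒜.card * (d + (2 * d + 1)))
  refine (((Derives.range (c := W) fun l => ?_).union (Derives.range (c := W) fun v => ?_)).union
    (Derives.range (c := W) fun p => ?_)).mono_cost ?_
  · exact Derives.of_depends_finset (s 0) (hsub 0) (hcard 0) _ fun x x' h => by
      rw [(hdep 0 k₀ x x' h).1]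
  · exact Derives.of_depends_finset (s 0) (hsub 0) (hcard 0) _ fun x x' h => by
      rw [(hdep 0 k₀ x x' h).2.1]
  · exact Derives.of_depends_finset (s p.2) (hsub _) (hcard _) _ fun x x' h => by
      rw [(hdep p.2 p.1.1.1 x x' h).2.2]
  · simp only [Fintype.card_prod, Fintype.card_coe, Fintype.card_fin, W]
    exact (by ring : _ = _).le

/-- The height bound and the alphabet are invariants needed by the single step. A step raises a
stack by at most `d`, so with `N + t * d ≤ H` truncation at height `H` loses nothing. -/
theorem derives_cfgBits_iterate [Nonempty K] (𝒜 : Finset (Σ k, Γ k)) (d : ℕ)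
    (hd : ∀ l, stmtDepth (M l) ≤ d) (h𝒜 : ∀ l, pushSymbols (M l) ⊆ 𝒜) {N : ℕ}
    (C : (Fin n → Bool) → TM2.Cfg Γ Λ σ)
    (hC : ∀ x k, ((C x).stk k).length ≤ N) (hC' : ∀ x k, ∀ γ ∈ (C x).stk k, ⟨k, γ⟩ ∈ 𝒜)
    {H : ℕ} (t : ℕ) (hH : N + t * d ≤ H) :
    Derives (t * ((Fintype.card (Option Λ) + Fintype.card σ + 𝒜.card * H) *
        Derives.lookupCost (Fintype.card (Option Λ) + Fintype.card σ + 𝒜.card * (d + (2 * d + 1)))))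
      (cfgBits 𝒜 H C) (cfgBits 𝒜 H fun x => (stepTotal M)^[t] (C x)) ∧
    (∀ x k, (((stepTotal M)^[t] (C x)).stk k).length ≤ N + t * d) ∧
    ∀ x k, ∀ γ ∈ ((stepTotal M)^[t] (C x)).stk k, ⟨k, γ⟩ ∈ 𝒜 := by
  induction t with
  | zero =>
    simp only [zero_mul, Function.iterate_zero, id_eq, add_zero]
    exact ⟨Derives.of_subset subset_rfl, hC, hC'⟩
  | succ t ih =>
    have hle : N + t * d ≤ N + (t + 1) * d := by ring_nf; omega
    obtain ⟨h1, h2, h3⟩ := ih (hle.trans hH)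
    simp only [Function.iterate_succ_apply']
    refine ⟨?_, fun x k => ?_, fun x k => ?_⟩
    · exact (h1.trans_of_right (derives_cfgBits_step M 𝒜 d hd _
        (fun x k => (h2 x k).trans (hle.trans hH)) h3)).mono_cost (Nat.succ_mul _ _).ge
    · have h2' := h2 x
      rcases hx : (stepTotal M)^[t] (C x) with ⟨l, v, S⟩
      rw [hx] at h2'
      cases l with
      | none => exact (h2' k).trans hle
      | some l =>
        refine (stepAux_length_le (M l) v S h2' k).trans ?_
        have := hd l
        ring_nf
        omega
    · have h3' := h3 x
      rcases hx : (stepTotal M)^[t] (C x) with ⟨l, v, S⟩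
      rw [hx] at h3'
      cases l with
      | none => exact h3' k
      | some l => exact stepAux_symbols (M l) (h𝒜 l) v S h3' k

end Bits

/-- A single constant serves as factor and as exponent. The base `m + 1` is positive, so enlarging
`E` only weakens the bound. -/
theorem polynomial_eval_le (p : Polynomial ℕ) : ∃ E, ∀ m, p.eval m ≤ E * (m + 1) ^ E := by
  induction p using Polynomial.induction_on' with
  | add p q hp hq =>
    obtain ⟨E, hE⟩ := hp
    obtain ⟨E', hE'⟩ := hq
    refine ⟨E + E', fun m => ?_⟩
    rw [Polynomial.eval_add, add_mul]
    exact add_le_add ((hE m).trans (Nat.mul_le_mul_left _ (Nat.pow_le_pow_right (by omega) (by omega))))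
      ((hE' m).trans (Nat.mul_le_mul_left _ (Nat.pow_le_pow_right (by omega) (by omega))))
  | monomial k a =>
    refine ⟨a + k, fun m => ?_⟩
    rw [Polynomial.eval_monomial]
    exact Nat.mul_le_mul (by omega)
      ((Nat.pow_le_pow_left (by omega) k).trans (Nat.pow_le_pow_right (by omega) (by omega)))

/-! ### Polynomial-size circuits for polynomial-time functions -/

section PolyTime

open scoped Classical

variable {α β αΓ βΓ : Type} {ea : α → List αΓ} {eb : β → List βΓ} {f : α → β}

theorem initList_stk_length (tm : FinTM2) (s : List (tm.Γ tm.k₀)) (k : tm.K) :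
    ((initList tm s).stk k).length ≤ s.length := by
  by_cases h : k = tm.k₀
  · subst h; simp [initList]
  · simp [initList, h]

theorem initList_stk_self (tm : FinTM2) (s : List (tm.Γ tm.k₀)) :
    (initList tm s).stk tm.k₀ = s := by
  simp [initList]

theorem initList_stk_of_ne (tm : FinTM2) (s : List (tm.Γ tm.k₀)) {k : tm.K} (h : k ≠ tm.k₀) :
    (initList tm s).stk k = [] := by
  simp [initList, h]

theorem haltList_stk_self (tm : FinTM2) (s : List (tm.Γ tm.k₁)) :
    (haltList tm s).stk tm.k₁ = s := by
  simp [haltList]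

/-- Polynomial-time functions have circuits of polynomial size. -/
theorem derives_of_polyTime (c : TM2ComputableInPolyTime ea eb f) :
    ∃ E : ℕ, ∀ (n : ℕ) (𝓕 : Set ((Fin n → Bool) → Bool)) (N : ℕ) (a : (Fin n → Bool) → α),
      (∀ x, (ea (a x)).length = N) →
      (∀ (i : ℕ) γ, Derives 1 𝓕 {fun x => decide ((ea (a x))[i]? = some γ)}) →
      Derives (E * (N + 1) ^ E) 𝓕
        (Set.range fun (p : ℕ × βΓ) x => decide ((eb (f (a x)))[p.1]? = some p.2)) := by
  let tm := c.tm
  have : Fintype tm.Λ := tm.ΛFin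
  have : Fintype tm.σ := tm.σFin
  have : Fintype (tm.Γ tm.k₀) := tm.Γk₀Fin
  have : Nonempty tm.K := ⟨tm.k₀⟩
  let 𝒜 : Finset (Σ k, tm.Γ k) :=
    (Finset.univ.biUnion fun l => (finite_pushSymbols (tm.m l)).toFinset) ∪
      Finset.univ.image fun γ => ⟨tm.k₀, γ⟩
  have h𝒜 (l : tm.Λ) : pushSymbols (tm.m l) ⊆ 𝒜 := fun a ha => by
    simp only [𝒜, Finset.coe_union, Finset.coe_biUnion]
    exact Or.inl (Set.mem_biUnion (Finset.mem_coe.2 (Finset.mem_univ l)) (by simpa using ha))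
  let d : ℕ := Finset.univ.sup fun l => stmtDepth (tm.m l)
  have hd (l : tm.Λ) : stmtDepth (tm.m l) ≤ d :=
    Finset.le_sup (f := fun l => stmtDepth (tm.m l)) (Finset.mem_univ l)
  obtain ⟨E, hE⟩ := polynomial_eval_le c.time
  let q : ℕ := Fintype.card (Option tm.Λ) + Fintype.card tm.σ
  let B : ℕ := Derives.lookupCost (q + 𝒜.card * (d + (2 * d + 1)))
  let H (N : ℕ) : ℕ := N + E * (N + 1) ^ E * d
  -- The summands pay for the initial configuration, for the simulated steps, and for one constant
  -- gate; everything except `N` depends on the machine alone.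
  have hbound : ∃ E' : ℕ, ∀ N, (q + 𝒜.card * H N) +
      (E * (N + 1) ^ E) * ((q + 𝒜.card * H N) * B) + 1 ≤ E' * (N + 1) ^ E' := by
    obtain ⟨E', hE'⟩ := polynomial_eval_le
      ((.C q + .C 𝒜.card * (.X + .C E * (.X + 1) ^ E * .C d)) + (.C E * (.X + 1) ^ E) *
        ((.C q + .C 𝒜.card * (.X + .C E * (.X + 1) ^ E * .C d)) * .C B) + 1 : Polynomial ℕ)
    refine ⟨E', fun N => ?_⟩
    have := hE' N
    simp only [Polynomial.eval_add, Polynomial.eval_mul, Polynomial.eval_pow, Polynomial.eval_C,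
      Polynomial.eval_X, Polynomial.eval_one] at this
    exact this
  obtain ⟨E', hE'⟩ := hbound
  refine ⟨E', fun n 𝓕 N a hN ha => Derives.mono_cost ?_ (hE' N)⟩
  let C (x : Fin n → Bool) : TM2.Cfg tm.Γ tm.Λ tm.σ :=
    initList tm ((ea (a x)).map c.inputAlphabet.invFun)
  have hC (x : Fin n → Bool) (k : tm.K) : ((C x).stk k).length ≤ N :=
    (initList_stk_length tm _ k).trans (by simp [hN])
  have hC' (x : Fin n → Bool) (k : tm.K) : ∀ γ ∈ (C x).stk k, ⟨k, γ⟩ ∈ 𝒜 := fun γ hγ => by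
    by_cases h : k = tm.k₀
    · subst h
      exact Finset.mem_union_right _ (Finset.mem_image_of_mem _ (Finset.mem_univ γ))
    · rw [initList_stk_of_ne tm _ h] at hγ
      simp at hγ
  have hinit : Derives (q + 𝒜.card * H N) 𝓕 (cfgBits 𝒜 (H N) C) := by
    refine (((Derives.range (c := 1) fun l => ?_).union (Derives.range (c := 1) fun v => ?_)).union
      (Derives.range (c := 1) fun p => ?_)).mono_cost ?_
    · exact (Derives.const (decide (some tm.main = l))).congr fun x => rfl
    · exact (Derives.const (decide (tm.initialState = v))).congr fun x => rfl
    · obtain ⟨⟨⟨k, γ⟩, hp⟩, j⟩ := p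
      by_cases h : k = tm.k₀
      · subst h
        refine (ha j (c.inputAlphabet γ)).congr fun x => ?_
        simp only [C, initList_stk_self, List.getElem?_map, Option.map_eq_some_iff]
        congr 1
        refine propext ⟨?_, fun h => ⟨_, h, by simp⟩⟩
        rintro ⟨b, hb, rfl⟩
        simpa using hb
      · refine (Derives.const false).congr fun x => ?_
        simp only [C, initList_stk_of_ne tm _ h]
        simp
    · simp only [Fintype.card_prod, Fintype.card_coe, Fintype.card_fin, q]
      exact (by ring : _ = _).le
  obtain ⟨h1, -, -⟩ := derives_cfgBits_iterate tm.m 𝒜 d hd h𝒜 C hC hC' (H := H N)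
    (E * (N + 1) ^ E) le_rfl
  -- The constant `false` stands for output positions at or above height `H` and for output symbols
  -- outside `𝒜`, which never occur.
  have h2 := (hinit.trans_of_right h1).trans
    (Derives.const (n := n) false)
  obtain ⟨-, h4, h5⟩ := derives_cfgBits_iterate tm.m 𝒜 d hd h𝒜 C hC hC' (H := H N)
    (E * (N + 1) ^ E) le_rfl
  have hout (x : Fin n → Bool) : ((stepTotal tm.m)^[E * (N + 1) ^ E] (C x)).stk tm.k₁ =
      (eb (f (a x))).map c.outputAlphabet.invFun := by
    have := c.outputsFun (a x)
    rw [stepTotal_iterate_of_halts tm.m (s := this.steps) (c' := haltList tm _) _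
      this.evals_in_steps rfl, haltList_stk_self]
    exact this.steps_le_m.trans (by rw [hN]; exact hE N)
  refine h2.mono le_rfl subset_rfl ?_
  rintro _ ⟨⟨j, b⟩, rfl⟩
  have hbit (x : Fin n → Bool) : (eb (f (a x)))[j]? = some b ↔
      (((stepTotal tm.m)^[E * (N + 1) ^ E] (C x)).stk tm.k₁)[j]? =
        some (c.outputAlphabet.symm b) := by
    rw [hout]
    simp [List.getElem?_map, Option.map_eq_some_iff]
  by_cases hj : j < H N ∧ ⟨tm.k₁, c.outputAlphabet.symm b⟩ ∈ 𝒜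
  · refine Or.inl (Or.inr ⟨(⟨_, hj.2⟩, ⟨j, hj.1⟩), funext fun x => ?_⟩)
    exact decide_eq_decide.2 (hbit x).symm
  · refine Or.inr (funext fun x => decide_eq_false fun h => hj ?_)
    have h' := (hbit x).1 h
    have hmem := h5 x tm.k₁ _ (List.mem_of_getElem? h')
    refine ⟨lt_of_lt_of_le ?_ (h4 x tm.k₁), hmem⟩
    by_contra hlt
    rw [List.getElem?_eq_none (by omega)] at h'
    cases h'

end PolyTime

end HardTaut

namespace HardTaut

open Turing

/-! ### A structured programming language for stack machines -/

/-- The alphabets of the stacks `Γ₁` and of the stacks of a machine `M`. -/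
abbrev Alph {K₁ : Type} (Γ₁ : K₁ → Type) (M : FinTM2) (k : K₁ ⊕ M.K) : Type :=
  match k with
  | .inl k => Γ₁ k
  | .inr k => M.Γ k

/-- Programs working on the stacks `Γ₁` and on the stacks of a machine `M`, which they can run as a
subroutine. The only loop pops the symbols of a stack one after the other. -/
inductive Prog {K₁ : Type} (Γ₁ : K₁ → Type) (M : FinTM2) (σ : Type) : Type
  | push (k : K₁ ⊕ M.K) (f : σ → Alph Γ₁ M k)
  | pop (k : K₁ ⊕ M.K) (f : σ → Option (Alph Γ₁ M k) → σ)
  | load (f : σ → σ)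
  | seq (p q : Prog Γ₁ M σ)
  | ite (c : σ → Bool) (p q : Prog Γ₁ M σ)
  | forPop (k : K₁ ⊕ M.K) (f : σ → Alph Γ₁ M k → σ) (p : Prog Γ₁ M σ)
  | call

namespace Prog

variable {K₁ : Type} {Γ₁ : K₁ → Type} {M : FinTM2} {σ : Type}

/-- The contents of all stacks. -/
abbrev Stacks (Γ₁ : K₁ → Type) (M : FinTM2) : Type := ∀ k, List (Alph Γ₁ M k)

/-- The stacks of the calling machine and of the subroutine together. -/
abbrev joinStacks (S : ∀ k, List (Γ₁ k)) (S' : ∀ k, List (M.Γ k)) : Stacks Γ₁ M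
  | .inl k => S k
  | .inr k => S' k

/-- `Reaches m c c' t`: the machine `m` gets from `c` to `c'` in at most `t` steps. -/
def Reaches {K : Type} [DecidableEq K] {Γ : K → Type} {Λ σ : Type} (m : Λ → TM2.Stmt Γ Λ σ)
    (c c' : TM2.Cfg Γ Λ σ) (t : ℕ) : Prop :=
  ∃ s ≤ t, (flip Bind.bind (TM2.step m))^[s] (some c) = some c'

section Reaches

variable {K : Type} [DecidableEq K] {Γ : K → Type} {Λ σ : Type} {m : Λ → TM2.Stmt Γ Λ σ}
  {c c' c'' : TM2.Cfg Γ Λ σ} {t t' : ℕ}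

theorem Reaches.mono (h : Reaches m c c' t) (ht : t ≤ t') : Reaches m c c' t' := by
  obtain ⟨s, hs, h⟩ := h
  exact ⟨s, hs.trans ht, h⟩

theorem Reaches.refl (c : TM2.Cfg Γ Λ σ) : Reaches m c c 0 := ⟨0, le_rfl, rfl⟩

theorem Reaches.trans (h : Reaches m c c' t) (h' : Reaches m c' c'' t') :
    Reaches m c c'' (t + t') := by
  obtain ⟨s, hs, h⟩ := h
  obtain ⟨s', hs', h'⟩ := h'
  refine ⟨s' + s, by omega, ?_⟩
  rw [Function.iterate_add_apply, h, h']

theorem Reaches.single {l : Λ} {v : σ} {S : ∀ k, List (Γ k)}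
    (h : TM2.stepAux (m l) v S = c') : Reaches m ⟨some l, v, S⟩ c' 1 :=
  ⟨1, le_rfl, congrArg some h⟩

end Reaches

section Run

variable [DecidableEq K₁]

/-- `Run p c c' t`: the program `p` leads from `c` to `c'` in time at most `t`. -/
inductive Run : Prog Γ₁ M σ → σ × Stacks Γ₁ M → σ × Stacks Γ₁ M → ℕ → Prop
  | push {k f s S} : Run (.push k f) (s, S) (s, Function.update S k (f s :: S k)) 1
  | pop {k f s S} :
      Run (.pop k f) (s, S) (f s (S k).head?, Function.update S k (S k).tail) 1
  | load {f s S} : Run (.load f) (s, S) (f s, S) 1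
  | seq {p q c c' c'' t t'} : Run p c c' t → Run q c' c'' t' → Run (.seq p q) c c'' (t + t')
  | ite_true {b p q c c' t} : b c.1 = true → Run p c c' t → Run (.ite b p q) c c' (t + 1)
  | ite_false {b p q c c' t} : b c.1 = false → Run q c c' t → Run (.ite b p q) c c' (t + 1)
  | forPop_nil {k f p s S} : S k = [] → Run (.forPop k f p) (s, S) (s, S) 1
  | forPop_cons {k f p s S γ l c c' t t'} : S k = γ :: l →
      Run p (f s γ, Function.update S k l) c t → Run (.forPop k f p) c c' t' →
      Run (.forPop k f p) (s, S) c' (t + t' + 1)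
  | call {s S S' t} :
      Reaches M.m ⟨some M.main, M.initialState, fun k => S (.inr k)⟩
        ⟨none, M.initialState, S'⟩ t →
      Run .call (s, S) (s, joinStacks (fun k => S (.inl k)) S') t
  | mono {p c c' t t'} : Run p c c' t → t ≤ t' → Run p c c' t'

theorem Run.congr {p : Prog Γ₁ M σ} {c c' c'' : σ × Stacks Γ₁ M} {t t' : ℕ} (h : Run p c c' t)
    (hc : c' = c'') (ht : t ≤ t') : Run p c c'' t' :=
  hc ▸ h.mono ht

end Run

/-- The labels of the compiled program. -/
def Lbl : Prog Γ₁ M σ → Type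
  | push _ _ | pop _ _ | load _ => Unit
  | seq p q => p.Lbl ⊕ q.Lbl
  | ite _ p q => Option (p.Lbl ⊕ q.Lbl)
  | forPop _ _ p => Option p.Lbl
  | call => M.Λ

theorem finite_lbl : ∀ p : Prog Γ₁ M σ, Finite p.Lbl
  | push _ _ | pop _ _ | load _ => inferInstanceAs (Finite Unit)
  | seq p q => by
    have := p.finite_lbl
    have := q.finite_lbl
    exact inferInstanceAs (Finite (p.Lbl ⊕ q.Lbl))
  | ite _ p q => by
    have := p.finite_lbl
    have := q.finite_lbl
    exact inferInstanceAs (Finite (Option (p.Lbl ⊕ q.Lbl)))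
  | forPop _ _ p => by
    have := p.finite_lbl
    exact inferInstanceAs (Finite (Option p.Lbl))
  | call => by
    have := M.ΛFin
    exact inferInstanceAs (Finite M.Λ)

/-- The label at which the compiled program starts. -/
def entry : ∀ p : Prog Γ₁ M σ, p.Lbl
  | push _ _ | pop _ _ | load _ => ()
  | seq p _ => Sum.inl p.entry
  | ite _ _ _ | forPop _ _ _ => none
  | call => M.main

/-- A statement of the subroutine as a statement of the calling machine. -/
def liftStmt {Λ' : Type} (emb : M.Λ → Λ') (exit : Λ') :
    TM2.Stmt M.Γ M.Λ M.σ → TM2.Stmt (Alph Γ₁ M) Λ' (σ × M.σ × Bool)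
  | .push k f q => .push (.inr k) (fun v => f v.2.1) (liftStmt emb exit q)
  | .peek k f q => .peek (.inr k) (fun v o => (v.1, f v.2.1 o, v.2.2)) (liftStmt emb exit q)
  | .pop k f q => .pop (.inr k) (fun v o => (v.1, f v.2.1 o, v.2.2)) (liftStmt emb exit q)
  | .load f q => .load (fun v => (v.1, f v.2.1, v.2.2)) (liftStmt emb exit q)
  | .branch f q₁ q₂ => .branch (fun v => f v.2.1) (liftStmt emb exit q₁) (liftStmt emb exit q₂)
  | .goto f => .goto fun v => emb (f v.2.1)
  | .halt => .goto fun _ => exit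

/-- The statements of the compiled program. -/
def code : ∀ (p : Prog Γ₁ M σ) {Λ' : Type} (_ : p.Lbl → Λ') (_ : Λ'), p.Lbl →
    TM2.Stmt (Alph Γ₁ M) Λ' (σ × M.σ × Bool)
  | push k f, _, _, exit, _ => .push k (fun v => f v.1) (.goto fun _ => exit)
  | pop k f, _, _, exit, _ => .pop k (fun v o => (f v.1 o, v.2)) (.goto fun _ => exit)
  | load f, _, _, exit, _ => .load (fun v => (f v.1, v.2)) (.goto fun _ => exit)
  | seq p q, _, emb, _, .inl l =>
      p.code (fun l => emb (.inl l)) (emb (.inr q.entry)) l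
  | seq _ q, _, emb, exit, .inr l => q.code (fun l => emb (.inr l)) exit l
  | ite b p q, _, emb, _, none =>
      .branch (fun v => b v.1) (.goto fun _ => emb (some (.inl p.entry)))
        (.goto fun _ => emb (some (.inr q.entry)))
  | ite _ p _, _, emb, exit, some (.inl l) => p.code (fun l => emb (some (.inl l))) exit l
  | ite _ _ q, _, emb, exit, some (.inr l) => q.code (fun l => emb (some (.inr l))) exit l
  | forPop k f p, _, emb, exit, none =>
      .pop k (fun v o => o.elim (v.1, v.2.1, false) fun γ => (f v.1 γ, v.2.1, true))
        (.branch (fun v => v.2.2) (.goto fun _ => emb (some p.entry)) (.goto fun _ => exit))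
  | forPop _ _ p, _, emb, _, some l => p.code (fun l => emb (some l)) (emb none) l
  | call, _, emb, exit, l => liftStmt emb exit (M.m l)

variable [DecidableEq K₁]

theorem joinStacks_update_inr (S : ∀ k, List (Γ₁ k)) (S' : ∀ k, List (M.Γ k)) (k : M.K)
    (l : List (M.Γ k)) : Function.update (joinStacks S S') (.inr k) l =
      joinStacks S (Function.update S' k l) := by
  funext k'
  rcases k' with k' | k'
  · simp
  · rcases eq_or_ne k' k with rfl | h
    · simp
    · rw [Function.update_of_ne (by simpa using h)]
      simp [Function.update_of_ne h]

theorem stepAux_liftStmt {Λ' : Type} (emb : M.Λ → Λ') (exit : Λ') (q : TM2.Stmt M.Γ M.Λ M.σ)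
    (s : σ) (v : M.σ) (b : Bool) (S : ∀ k, List (Γ₁ k)) (S' : ∀ k, List (M.Γ k)) :
    TM2.stepAux (liftStmt emb exit q) (s, v, b) (joinStacks S S') =
      ⟨some ((TM2.stepAux q v S').l.elim exit emb), (s, (TM2.stepAux q v S').var, b),
        joinStacks S (TM2.stepAux q v S').stk⟩ := by
  induction q generalizing v S' with
  | push k f q ih =>
    simp only [liftStmt, TM2.stepAux]
    rw [joinStacks_update_inr, ih]
  | peek k f q ih =>
    simp only [liftStmt, TM2.stepAux]
    rw [ih]
  | pop k f q ih =>
    simp only [liftStmt, TM2.stepAux]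
    rw [joinStacks_update_inr, ih]
  | load f q ih =>
    simp only [liftStmt, TM2.stepAux]
    rw [ih]
  | branch f q₁ q₂ ih₁ ih₂ =>
    simp only [liftStmt, TM2.stepAux]
    cases f v
    · exact ih₂ _ _
    · exact ih₁ _ _
  | goto f => rfl
  | halt => rfl

/-- Every step of the subroutine is mirrored by one step of the caller. Halting becomes a jump, so a
halted configuration of the subroutine corresponds to the caller standing at `exit`. -/
theorem reaches_call {Λ' : Type} {m : Λ' → TM2.Stmt (Alph Γ₁ M) Λ' (σ × M.σ × Bool)}
    {emb : M.Λ → Λ'} {exit : Λ'} (hm : ∀ l, m (emb l) = liftStmt emb exit (M.m l))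
    (s : σ) (b : Bool) (S : ∀ k, List (Γ₁ k)) {c c' : TM2.Cfg M.Γ M.Λ M.σ} {t : ℕ}
    (h : Reaches M.m c c' t) :
    Reaches m ⟨some (c.l.elim exit emb), (s, c.var, b), joinStacks S c.stk⟩
      ⟨some (c'.l.elim exit emb), (s, c'.var, b), joinStacks S c'.stk⟩ t := by
  obtain ⟨r, hr, h⟩ := h
  refine Reaches.mono ?_ hr
  clear hr
  induction r generalizing c with
  | zero =>
    obtain rfl : c = c' := by simpa using h
    exact Reaches.refl _
  | succ r ih =>
    rw [Function.iterate_succ_apply] at h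
    rcases c with ⟨_ | l, v, S'⟩
    · have : (flip Bind.bind (TM2.step M.m))^[r] none = none := Function.iterate_fixed rfl r
      rw [show flip Bind.bind (TM2.step M.m) (some ⟨none, v, S'⟩) = none from rfl, this] at h
      cases h
    · rw [show flip Bind.bind (TM2.step M.m) (some ⟨some l, v, S'⟩) =
        some (TM2.stepAux (M.m l) v S') from rfl] at h
      rw [add_comm]
      refine (Reaches.single ?_).trans (ih h)
      simp only [Option.elim_some]
      rw [hm, stepAux_liftStmt]

/-- The Boolean component of the state is scratch memory in which a loop notes whether its pop found
a symbol. Its final value is irrelevant, hence the existential `b'`. The state of the subroutine is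
`M.initialState` between calls, so that each call starts afresh. -/
theorem reaches_of_run {p : Prog Γ₁ M σ} {c c' : σ × Stacks Γ₁ M} {t : ℕ} (h : Run p c c' t)
    {Λ' : Type} {m : Λ' → TM2.Stmt (Alph Γ₁ M) Λ' (σ × M.σ × Bool)} {emb : p.Lbl → Λ'}
    {exit : Λ'} (hm : ∀ l, m (emb l) = p.code emb exit l) (b : Bool) :
    ∃ b', Reaches m ⟨some (emb p.entry), (c.1, M.initialState, b), c.2⟩
      ⟨some exit, (c'.1, M.initialState, b'), c'.2⟩ t := by
  induction h generalizing Λ' b exit with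
  | push | pop | load =>
    exact ⟨b, Reaches.single (by rw [hm]; rfl)⟩
  | @seq p q c c' c'' t t' _ _ ih₁ ih₂ =>
    obtain ⟨b₁, h₁⟩ := ih₁ (emb := fun l => emb (.inl l)) (exit := emb (.inr q.entry))
      (fun l => hm (.inl l)) b
    obtain ⟨b₂, h₂⟩ := ih₂ (emb := fun l => emb (.inr l)) (exit := exit) (fun l => hm (.inr l)) b₁
    exact ⟨b₂, h₁.trans h₂⟩
  | @ite_true d p q c c' t hd _ ih =>
    obtain ⟨b₁, h₁⟩ := ih (emb := fun l => emb (some (.inl l))) (exit := exit)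
      (fun l => hm (some (.inl l))) b
    refine ⟨b₁, ((Reaches.single ?_).trans h₁).mono (by omega)⟩
    rw [hm]
    simp [code, entry, hd]
  | @ite_false d p q c c' t hd _ ih =>
    obtain ⟨b₁, h₁⟩ := ih (emb := fun l => emb (some (.inr l))) (exit := exit)
      (fun l => hm (some (.inr l))) b
    refine ⟨b₁, ((Reaches.single ?_).trans h₁).mono (by omega)⟩
    rw [hm]
    simp [code, entry, hd]
  | @forPop_nil k f p s S hS =>
    refine ⟨false, Reaches.single ?_⟩
    rw [hm]
    simp only [code, entry, TM2.stepAux, hS, List.head?_nil, Option.elim_none, cond_false,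
      List.tail_nil]
    rw [← hS, Function.update_eq_self]
  | @forPop_cons k f p s S γ l c c' t t' hS _ _ ih₁ ih₂ =>
    obtain ⟨b₁, h₁⟩ := ih₁ (emb := fun l => emb (some l)) (exit := emb none)
      (fun l => hm (some l)) true
    obtain ⟨b₂, h₂⟩ := ih₂ hm b₁
    refine ⟨b₂, ((Reaches.single ?_).trans (h₁.trans h₂)).mono (by omega)⟩
    rw [hm]
    simp [code, entry, TM2.stepAux, hS]
  | @call s S S' t h =>
    refine ⟨b, ?_⟩
    have := reaches_call (exit := exit) (m := m) (emb := emb) hm s b (fun k => S (.inl k)) h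
    have hS : joinStacks (fun k => S (.inl k)) (fun k => S (.inr k)) = S := by
      funext k; cases k <;> rfl
    simp only [hS] at this
    exact this
  | mono _ ht ih =>
    obtain ⟨b', h'⟩ := ih hm b
    exact ⟨b', h'.mono ht⟩

/-- The stacks that are empty except for stack `k`. -/
def single (M : FinTM2) (k : K₁) (l : List (Γ₁ k)) : Stacks Γ₁ M :=
  Function.update (fun _ => []) (.inl k) l

/-- A program that runs in polynomial time computes a polynomial-time function. -/
theorem polyTime_of_run [Finite K₁] [Finite σ] {α β αΓ βΓ : Type} [Finite αΓ] {ea : α → List αΓ}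
    {eb : β → List βΓ} {f : α → β} (p : Prog Γ₁ M σ) (s₀ : σ) (k₀ k₁ : K₁) (e₀ : Γ₁ k₀ ≃ αΓ)
    (e₁ : Γ₁ k₁ ≃ βΓ) (T : Polynomial ℕ)
    (h : ∀ a, ∃ s, Run p (s₀, single M k₀ ((ea a).map e₀.symm))
      (s, single M k₁ ((eb (f a)).map e₁.symm)) (T.eval (ea a).length)) :
    Nonempty (TM2ComputableInPolyTime ea eb f) := by
  classical
  have := p.finite_lbl
  have := M.kFin
  have := M.σFin
  have : Finite (Γ₁ k₀) := Finite.of_equiv _ e₀.symm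
  have := Fintype.ofFinite K₁
  let tm : FinTM2 :=
    { K := K₁ ⊕ M.K
      k₀ := .inl k₀
      k₁ := .inl k₁
      Γ := Alph Γ₁ M
      Λ := Option p.Lbl
      main := some p.entry
      ΛFin := Fintype.ofFinite _
      σ := σ × M.σ × Bool
      initialState := (s₀, M.initialState, false)
      σFin := Fintype.ofFinite _
      Γk₀Fin := (Fintype.ofFinite (Γ₁ k₀) :)
      -- A halting configuration must carry the initial state, so the exit label resets the memory
      -- before halting. This is the extra step in the time bound `T + 1`.
      m := fun l => l.elim (.load (fun _ => (s₀, M.initialState, false)) .halt)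
        (p.code some none) }
  have hinit (k : K₁) (l : List (Γ₁ k)) (k' : K₁ ⊕ M.K) :
      @dite (List (Alph Γ₁ M k')) (k' = .inl k) (tm.kDecidableEq k' (.inl k))
        (fun h => by rw [h]; exact l) (fun _ => []) = single M k l k' := by
    by_cases hk : k' = .inl k
    · subst hk
      simp [single]
    · simp [single, hk]
  refine ⟨⟨⟨tm, e₀, e₁⟩, T + 1, fun a => Classical.choice ?_⟩⟩
  obtain ⟨s, hs⟩ := h a
  obtain ⟨b, hb⟩ := reaches_of_run hs (m := tm.m) (emb := some) (exit := none) (fun l => rfl) false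
  obtain ⟨r, hr, hr'⟩ := hb.trans (Reaches.single (m := tm.m) rfl)
  refine ⟨⟨⟨r, ?_⟩, by simpa using hr⟩⟩
  have h₀ : initList tm ((ea a).map e₀.invFun) =
      ⟨some (some p.entry), (s₀, M.initialState, false),
        single M k₀ ((ea a).map e₀.symm)⟩ := by
    simp only [initList]
    congr 1
    funext k
    exact hinit k₀ _ k
  have h₁ : haltList tm ((eb (f a)).map e₁.invFun) =
      ⟨none, (s₀, M.initialState, false), single M k₁ ((eb (f a)).map e₁.symm)⟩ := by
    simp only [haltList]
    congr 1
    funext k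
    exact hinit k₁ _ k
  have h₂ : (flip Bind.bind tm.step)^[r] (some (initList tm ((ea a).map e₀.invFun))) =
      some (haltList tm ((eb (f a)).map e₁.invFun)) := by
    rw [h₀, h₁]
    exact hr'
  exact h₂

end Prog

end HardTaut

namespace HardTaut

open Turing

/-! ### Reasoning about loops, and the stacks exchanged with a subroutine -/

namespace Prog

variable {K₁ : Type} {Γ₁ : K₁ → Type} {M : FinTM2} {σ : Type} [DecidableEq K₁]

/-- Loop rule: `C g l` is the configuration with the symbols `l` left on the loop stack, and `next`
is the effect of one iteration on the remaining data `g`. -/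
theorem run_forPop {G : Type*} {k : K₁ ⊕ M.K} {f : σ → Alph Γ₁ M k → σ} {p : Prog Γ₁ M σ}
    (C : G → List (Alph Γ₁ M k) → σ × Stacks Γ₁ M) (next : G → Alph Γ₁ M k → G)
    (P : G → Prop) (T : ℕ) (hk : ∀ g l, (C g l).2 k = l) (hP : ∀ g γ, P g → P (next g γ))
    (hbody : ∀ g γ l, P g → Run p (f (C g (γ :: l)).1 γ, Function.update (C g (γ :: l)).2 k l)
      (C (next g γ) l) T) (g : G) (hg : P g) (l : List (Alph Γ₁ M k)) :
    Run (.forPop k f p) (C g l) (C (l.foldl next g) []) (l.length * (T + 1) + 1) := by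
  induction l generalizing g with
  | nil => exact (Run.forPop_nil (s := (C g []).1) (S := (C g []).2) (hk g [])).mono (by simp)
  | cons γ l ih =>
    refine (Run.forPop_cons (s := (C g (γ :: l)).1) (S := (C g (γ :: l)).2) (hk g (γ :: l))
      (hbody g γ l hg) (ih (next g γ) (hP g γ hg))).mono ?_
    simp only [List.length_cons]
    ring_nf
    omega

theorem Run.cast {p : Prog Γ₁ M σ} {c c' d d' : σ × Stacks Γ₁ M} {t : ℕ} (h : Run p c c' t)
    (hc : d = c) (hc' : c' = d') : Run p d d' t := by
  subst hc hc'
  exact h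

end Prog

section Machine

variable (M : FinTM2)

theorem update_initList_stk (l l' : List (M.Γ M.k₀)) :
    Function.update (initList M l).stk M.k₀ l' = (initList M l').stk := by
  funext k
  rcases eq_or_ne k M.k₀ with rfl | h
  · rw [Function.update_self, initList_stk_self]
  · rw [Function.update_of_ne h, initList_stk_of_ne M _ h, initList_stk_of_ne M _ h]

theorem initList_nil_stk : (initList M []).stk = fun _ => [] := by
  funext k
  rcases eq_or_ne k M.k₀ with rfl | h
  · rw [initList_stk_self]
  · rw [initList_stk_of_ne M _ h]

theorem update_haltList_stk (l l' : List (M.Γ M.k₁)) :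
    Function.update (haltList M l).stk M.k₁ l' = (haltList M l').stk := by
  funext k
  rcases eq_or_ne k M.k₁ with rfl | h
  · rw [Function.update_self, haltList_stk_self]
  · rw [Function.update_of_ne h]
    simp [haltList, h]

theorem haltList_nil_stk : (haltList M []).stk = fun _ => [] := by
  funext k
  rcases eq_or_ne k M.k₁ with rfl | h
  · rw [haltList_stk_self]
  · simp [haltList, h]

end Machine

/-! ### The Goldreich–Levin predicate of a permutation -/

/-- The inner product modulo two of two bit strings, truncated to the shorter one. -/
def dot : List Bool → List Bool → Bool
  | a :: l, b :: l' => (a && b) ^^ dot l l'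
  | _, _ => false

/-- The bits at even and the bits at odd positions. -/
def deinterleave : List Bool → List Bool × List Bool
  | a :: b :: l => (a :: (deinterleave l).1, b :: (deinterleave l).2)
  | [a] => ([a], [])
  | [] => ([], [])

theorem length_deinterleave_snd : ∀ u : List Bool, (deinterleave u).2.length = u.length / 2
  | a :: b :: l => by
    simp only [deinterleave, List.length_cons, length_deinterleave_snd l]
    omega
  | [_] => by simp [deinterleave]
  | [] => rfl

/-- The hard-core bit: on input an interleaving of `r` and `v`, the inner product of `r` with the
preimage of `v` under `h`. -/
noncomputable def hardCoreBit (h : List Bool → List Bool) (u : List Bool) : Bool :=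
  dot (Function.invFun h (deinterleave u).2) (deinterleave u).1

/-- The relation `h y = v ∧ ⟨y, r⟩ = a`. -/
def hardCoreRel (h : List Bool → List Bool) (a : Bool) (u y : List Bool) : Bool :=
  h y == (deinterleave u).2 && dot y (deinterleave u).1 == a

/-! ### The machine deciding the Goldreich–Levin relation -/

namespace HardCoreMachine

open Prog

/-- The stacks of the machine that decides `hardCoreRel`. -/
inductive Stk
  | inp | r | v | y | r' | v' | y' | out
  deriving DecidableEq

instance : Finite Stk :=
  (⟨{.inp, .r, .v, .y, .r', .v', .y', .out}, fun k => by cases k <;> simp⟩ : Fintype Stk).finite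

/-- The alphabets of the machine that decides `hardCoreRel`. -/
abbrev Sym : Stk → Type
  | .inp => Option Bool
  | _ => Bool

/-- The finite memory: the part of the input being read, the current bit, the inner product so far,
and whether all comparisons succeeded. -/
abbrev Mem : Type := Option Bool × Option Bool × Bool × Bool

variable {M : FinTM2}

/-- The stacks with given contents. -/
abbrev stks (inp : List (Option Bool)) (r v y r' v' y' out : List Bool)
    (H : ∀ k, List (M.Γ k)) : Stacks Sym M
  | .inl .inp => inp
  | .inl .r => r
  | .inl .v => v
  | .inl .y => y
  | .inl .r' => r'
  | .inl .v' => v'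
  | .inl .y' => y'
  | .inl .out => out
  | .inr k => H k

section Update

variable (inp : List (Option Bool)) (r v y r' v' y' out l : List Bool) (H : ∀ k, List (M.Γ k))

theorem update_inp (l : List (Option Bool)) :
    Function.update (stks inp r v y r' v' y' out H) (.inl .inp) l =
      stks l r v y r' v' y' out H := by
  funext k; rcases k with k | k
  · cases k <;> rfl
  · rfl

theorem update_r : Function.update (stks inp r v y r' v' y' out H) (.inl .r) l =
    stks inp l v y r' v' y' out H := by
  funext k; rcases k with k | k
  · cases k <;> rfl
  · rfl

theorem update_v : Function.update (stks inp r v y r' v' y' out H) (.inl .v) l =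
    stks inp r l y r' v' y' out H := by
  funext k; rcases k with k | k
  · cases k <;> rfl
  · rfl

theorem update_y : Function.update (stks inp r v y r' v' y' out H) (.inl .y) l =
    stks inp r v l r' v' y' out H := by
  funext k; rcases k with k | k
  · cases k <;> rfl
  · rfl

theorem update_r' : Function.update (stks inp r v y r' v' y' out H) (.inl .r') l =
    stks inp r v y l v' y' out H := by
  funext k; rcases k with k | k
  · cases k <;> rfl
  · rfl

theorem update_v' : Function.update (stks inp r v y r' v' y' out H) (.inl .v') l =
    stks inp r v y r' l y' out H := by
  funext k; rcases k with k | k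
  · cases k <;> rfl
  · rfl

theorem update_y' : Function.update (stks inp r v y r' v' y' out H) (.inl .y') l =
    stks inp r v y r' v' l out H := by
  funext k; rcases k with k | k
  · cases k <;> rfl
  · rfl

theorem update_out : Function.update (stks inp r v y r' v' y' out H) (.inl .out) l =
    stks inp r v y r' v' y' l H := by
  funext k; rcases k with k | k
  · cases k <;> rfl
  · rfl

theorem update_inr (k : M.K) (l : List (M.Γ k)) :
    Function.update (stks inp r v y r' v' y' out H) (.inr k) l =
      stks inp r v y r' v' y' out (Function.update H k l) := by
  funext k'
  rcases k' with k' | k'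
  · cases k' <;> rfl
  · rcases eq_or_ne k' k with rfl | h
    · simp
    · rw [Function.update_of_ne (by simpa using h)]
      simp [Function.update_of_ne h]

end Update

/-- Distribute the input over the stacks `r`, `v` and `y`. -/
def readInput : Prog Sym M Mem :=
  .forPop (.inl .inp) (fun s γ => (s.1, γ, s.2.2)) <|
    .ite (fun s => s.2.1.isNone) (.load fun s => (none, s.2)) <|
    .seq
      (.ite (fun s => s.1.isNone) (.push (.inl .y) fun s => s.2.1.getD false) <|
        .seq
          (.ite (fun s => s.1 == some true) (.push (.inl .v) fun s => s.2.1.getD false)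
            (.push (.inl .r) fun s => s.2.1.getD false))
          (.load fun s => (s.1.map (!·), s.2)))
      (.load fun s => (s.1, none, s.2.2))

/-- The effect of reading one symbol. -/
def readStep : Option Bool × List Bool × List Bool × List Bool → Option Bool →
    Option Bool × List Bool × List Bool × List Bool
  | (_, r, v, y), none => (none, r, v, y)
  | (none, r, v, y), some b => (none, r, v, b :: y)
  | (some true, r, v, y), some b => (some false, r, b :: v, y)
  | (some false, r, v, y), some b => (some true, b :: r, v, y)

theorem foldl_readStep_y (y r v y₀ : List Bool) :
    (y.map some).foldl readStep (none, r, v, y₀) = (none, r, v, y.reverse ++ y₀) := by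
  induction y generalizing y₀ with
  | nil => rfl
  | cons b y ih => simp [readStep, ih]

/-- The final phase depends on the parity of the length of `u`; the separator overwrites it, so it
need not be named. -/
theorem foldl_readStep_u : ∀ u r v : List Bool, ∃ ph,
    (u.map some).foldl readStep (some false, r, v, []) =
      (ph, (deinterleave u).1.reverse ++ r, (deinterleave u).2.reverse ++ v, [])
  | a :: b :: u, r, v => by
    obtain ⟨ph, h⟩ := foldl_readStep_u u (a :: r) (b :: v)
    exact ⟨ph, by simpa [readStep, deinterleave] using h⟩
  | [a], r, v => ⟨some true, by simp [readStep, deinterleave]⟩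
  | [], r, v => ⟨some false, by simp [deinterleave]⟩

theorem foldl_readStep (u y : List Bool) :
    (encodePair (u, y)).foldl readStep (some false, [], [], []) =
      (none, (deinterleave u).1.reverse, (deinterleave u).2.reverse, y.reverse) := by
  obtain ⟨ph, h⟩ := foldl_readStep_u u [] []
  simp only [encodePair, List.foldl_append, h, List.foldl_cons, readStep, foldl_readStep_y,
    List.append_nil]

theorem run_readInput (l : List (Option Bool)) (H : ∀ k, List (M.Γ k)) :
    Run readInput ((some false, none, false, true), stks l [] [] [] [] [] [] [] H)
      (((l.foldl readStep (some false, [], [], [])).1, none, false, true),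
        stks [] (l.foldl readStep (some false, [], [], [])).2.1
          (l.foldl readStep (some false, [], [], [])).2.2.1
          (l.foldl readStep (some false, [], [], [])).2.2.2 [] [] [] [] H)
      (l.length * 8 + 1) := by
  refine run_forPop (k := .inl .inp) (fun (g : Option Bool × List Bool × List Bool × List Bool) l =>
    ((g.1, none, false, true), stks l g.2.1 g.2.2.1 g.2.2.2 [] [] [] [] H)) readStep
    (fun _ => True) 7 (fun g l => rfl) (fun _ _ _ => trivial) ?_ (some false, [], [], []) trivial l
  rintro ⟨ph, r, v, y⟩ γ l -
  simp only [update_inp]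
  rcases γ with _ | b
  · exact (Run.ite_true rfl .load).mono (by norm_num)
  · refine .ite_false rfl (t := 6) ?_
    rcases ph with _ | ph
    · exact (Run.seq (.ite_true rfl .push) .load).congr (by simp [update_y, readStep]) (by norm_num)
    · cases ph
      · exact (Run.seq (.ite_false rfl (.seq (.ite_false rfl .push) .load)) .load).congr
          (by simp [update_r, readStep]) (by norm_num)
      · exact (Run.seq (.ite_false rfl (.seq (.ite_true rfl .push) .load)) .load).congr
          (by simp [update_v, readStep]) (by norm_num)

theorem foldl_cons (l l' : List Bool) : l.foldl (fun g b => b :: g) l' = l.reverse ++ l' := by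
  induction l generalizing l' with
  | nil => rfl
  | cons b l ih => simp [ih]

/-- Remember a bit. -/
abbrev setCur (s : Mem) (b : Bool) : Mem := (s.1, some b, s.2.2)

/-- Forget the current bit. -/
abbrev reset : Prog Sym M Mem := .load fun s => (s.1, none, s.2.2)

/-- Reverse `r` onto `r'` and `v` onto `v'`. -/
def moveRV : Prog Sym M Mem :=
  .seq (.forPop (.inl .r) setCur (.seq (.push (.inl .r') fun s => s.2.1.getD false) reset))
    (.forPop (.inl .v) setCur (.seq (.push (.inl .v') fun s => s.2.1.getD false) reset))

theorem run_moveRV (ph : Option Bool) (acc ok : Bool) (r v y : List Bool)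
    (H : ∀ k, List (M.Γ k)) :
    Run moveRV ((ph, none, acc, ok), stks [] r v y [] [] [] [] H)
      ((ph, none, acc, ok), stks [] [] [] y r.reverse v.reverse [] [] H)
      ((r.length + v.length) * 3 + 2) := by
  have h1 := run_forPop (M := M) (σ := Mem) (k := .inl .r) (f := setCur)
    (p := .seq (.push (.inl .r') fun s => s.2.1.getD false) reset)
    (fun (g : List Bool) l => ((ph, none, acc, ok), stks [] l v y g [] [] [] H))
    (fun g b => b :: g) (fun _ => True) 2 (fun g l => rfl) (fun _ _ _ => trivial)
    (fun g γ l _ => (Run.seq .push .load).congr (by simp [update_r, update_r']) le_rfl) []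
    trivial r
  have h2 := run_forPop (M := M) (σ := Mem) (k := .inl .v) (f := setCur)
    (p := .seq (.push (.inl .v') fun s => s.2.1.getD false) reset)
    (fun (g : List Bool) l => ((ph, none, acc, ok), stks [] [] l y r.reverse g [] [] H))
    (fun g b => b :: g) (fun _ => True) 2 (fun g l => rfl) (fun _ _ _ => trivial)
    (fun g γ l _ => (Run.seq .push .load).congr (by simp [update_v, update_v']) le_rfl) []
    trivial v
  simp only [foldl_cons, List.append_nil] at h1 h2
  exact (Run.seq h1 h2).mono (by omega)

/-- Reverse `y` onto `y'` and onto the input stack of the subroutine. -/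
def moveY (e : M.Γ M.k₀ ≃ Bool) : Prog Sym M Mem :=
  .forPop (.inl .y) setCur (.seq (.push (.inl .y') fun s => s.2.1.getD false)
    (.seq (.push (.inr M.k₀) fun s => e.symm (s.2.1.getD false)) reset))

theorem run_moveY (e : M.Γ M.k₀ ≃ Bool) (ph : Option Bool) (acc ok : Bool) (y r' v' : List Bool) :
    Run (moveY e) ((ph, none, acc, ok), stks [] [] [] y r' v' [] [] fun _ => [])
      ((ph, none, acc, ok), stks [] [] [] [] r' v' y.reverse []
        (initList M (y.reverse.map e.symm)).stk) (y.length * 4 + 1) := by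
  have h1 := run_forPop (M := M) (σ := Mem) (k := .inl .y) (f := setCur)
    (p := .seq (.push (.inl .y') fun s => s.2.1.getD false)
      (.seq (.push (.inr M.k₀) fun s => e.symm (s.2.1.getD false)) reset))
    (fun (g : List Bool) l => ((ph, none, acc, ok),
      stks [] [] [] l r' v' g [] (initList M (g.map e.symm)).stk))
    (fun g b => b :: g) (fun _ => True) 3 (fun g l => rfl) (fun _ _ _ => trivial)
    (fun g γ l _ => (Run.seq .push (.seq .push .load)).congr (by
      simp [update_y, update_y', update_inr, initList_stk_self, update_initList_stk]) le_rfl) []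
    trivial y
  simp only [foldl_cons, List.append_nil, List.map_nil, initList_nil_stk] at h1
  exact h1

/-- Compute the inner product of `y'` and `r'`. -/
def innerProduct : Prog Sym M Mem :=
  .forPop (.inl .y') setCur (.pop (.inl .r') fun s o =>
    (s.1, none, s.2.2.1 ^^ (s.2.1.getD false && o.getD false), s.2.2.2))

/-- An exhausted stack `r` yields the default `false`, which contributes nothing to the sum; this
agrees with the truncation in `dot`. Of the remainder `r'` only the length matters, for the time
needed to clear it. -/
theorem foldl_dot (l r : List Bool) (acc : Bool) :
    ∃ r', l.foldl (fun g b => (g.1 ^^ (b && g.2.head?.getD false), g.2.tail)) (acc, r) =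
      (acc ^^ dot l r, r') ∧ r'.length ≤ r.length := by
  induction l generalizing r acc with
  | nil => exact ⟨r, by simp [dot], le_rfl⟩
  | cons b l ih =>
    obtain ⟨r', h, h'⟩ := ih r.tail (acc ^^ (b && r.head?.getD false))
    refine ⟨r', ?_, h'.trans (by simp)⟩
    rw [List.foldl_cons, h]
    cases r with
    | nil => cases l <;> simp [dot]
    | cons c r => simp [dot]

theorem run_innerProduct (ph : Option Bool) (ok : Bool) (r' v' y' : List Bool)
    (H : ∀ k, List (M.Γ k)) : ∃ r'', r''.length ≤ r'.length ∧
    Run innerProduct ((ph, none, false, ok), stks [] [] [] [] r' v' y' [] H)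
      ((ph, none, dot y' r', ok), stks [] [] [] [] r'' v' [] [] H) (y'.length * 2 + 1) := by
  have h1 := run_forPop (M := M) (σ := Mem) (k := .inl .y') (f := setCur)
    (p := .pop (.inl .r') fun s o =>
      (s.1, none, s.2.2.1 ^^ (s.2.1.getD false && o.getD false), s.2.2.2))
    (fun (g : Bool × List Bool) l => ((ph, none, g.1, ok), stks [] [] [] [] g.2 v' l [] H))
    (fun g b => (g.1 ^^ (b && g.2.head?.getD false), g.2.tail)) (fun _ => True) 1
    (fun g l => rfl) (fun _ _ _ => trivial)
    (fun g γ l _ => Run.pop.congr (by simp [update_y', update_r']) le_rfl) (false, r')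
    trivial y'
  obtain ⟨r'', h, h'⟩ := foldl_dot y' r' false
  refine ⟨r'', h', ?_⟩
  simp only [h, Bool.false_xor] at h1
  exact h1

/-- Compare the output of the subroutine with `v'`. -/
def compare (e : M.Γ M.k₁ ≃ Bool) : Prog Sym M Mem :=
  .seq (.forPop (.inr M.k₁) (fun s γ => setCur s (e γ)) (.pop (.inl .v') fun s o =>
    (s.1, none, s.2.2.1, s.2.2.2 && (o == s.2.1)))) <|
    .pop (.inl .v') fun s o => (s.1, none, s.2.2.1, s.2.2.2 && o.isNone)

/-- The flag already fails if `v` runs out too early. The case that `v` is too long is left to the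
final emptiness test, hence the form of the second clause. -/
theorem foldl_compare (l v : List Bool) (ok : Bool) :
    ∃ v' ok', l.foldl (fun g b => (g.1 && (g.2.head? == some b), g.2.tail)) (ok, v) = (ok', v') ∧
      (ok' && v'.head?.isNone) = (ok && (l == v)) ∧ v'.length ≤ v.length := by
  induction l generalizing v ok with
  | nil => exact ⟨v, ok, rfl, by cases v <;> simp, le_rfl⟩
  | cons b l ih =>
    obtain ⟨v', ok', h, h', h''⟩ := ih v.tail (ok && (v.head? == some b))
    refine ⟨v', ok', h, ?_, h''.trans (by simp)⟩
    rw [h']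
    cases v with
    | nil => simp
    | cons c v => cases ok <;> cases b <;> cases c <;> simp

theorem run_compare (e : M.Γ M.k₁ ≃ Bool) (ph : Option Bool) (acc : Bool) (r' v' o : List Bool) :
    ∃ v'', v''.length ≤ v'.length ∧
    Run (compare e) ((ph, none, acc, true), stks [] [] [] [] r' v' [] []
        (haltList M (o.map e.symm)).stk)
      ((ph, none, acc, o == v'), stks [] [] [] [] r' v'' [] [] fun _ => [])
      (o.length * 2 + 2) := by
  have h1 := run_forPop (M := M) (σ := Mem) (k := .inr M.k₁) (f := fun s γ => setCur s (e γ))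
    (p := .pop (.inl .v') fun s o => (s.1, none, s.2.2.1, s.2.2.2 && (o == s.2.1)))
    (fun (g : Bool × List Bool) l => ((ph, none, acc, g.1),
      stks [] [] [] [] r' g.2 [] [] (haltList M l).stk))
    (fun g b => (g.1 && (g.2.head? == some (e b)), g.2.tail)) (fun _ => True) 1
    (fun g l => haltList_stk_self M l) (fun _ _ _ => trivial)
    (fun g γ l _ => Run.pop.congr (by
      simp [update_v', update_inr, update_haltList_stk]) le_rfl) (true, v')
    trivial (o.map e.symm)
  obtain ⟨v'', ok', h, h', h''⟩ := foldl_compare o v' true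
  rw [List.foldl_map] at h1
  simp only [Equiv.apply_symm_apply] at h1
  rw [h, haltList_nil_stk] at h1
  refine ⟨v''.tail, by simpa using (Nat.sub_le _ _).trans h'', ?_⟩
  refine (Run.seq h1 .pop).congr ?_ (by simp)
  rw [← Bool.true_and (o == v'), ← h']
  simp [update_v']

/-- Empty the stacks and write the result. -/
def finish (a : Bool) : Prog Sym M Mem :=
  .seq (.forPop (.inl .r') setCur reset) <|
  .seq (.forPop (.inl .v') setCur reset)
    (.push (.inl .out) fun s => s.2.2.2 && s.2.2.1 == a)

theorem run_finish (a : Bool) (ph : Option Bool) (acc ok : Bool) (r' v' : List Bool)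
    (H : ∀ k, List (M.Γ k)) :
    Run (finish a) ((ph, none, acc, ok), stks [] [] [] [] r' v' [] [] H)
      ((ph, none, acc, ok), stks [] [] [] [] [] [] [] [ok && acc == a] H)
      ((r'.length + v'.length) * 2 + 3) := by
  have h1 := run_forPop (M := M) (σ := Mem) (k := .inl .r') (f := setCur) (p := reset)
    (fun (_ : Unit) l => ((ph, none, acc, ok), stks [] [] [] [] l v' [] [] H))
    (fun g _ => g) (fun _ => True) 1 (fun g l => rfl) (fun _ _ _ => trivial)
    (fun g γ l _ => Run.load.congr (by simp [update_r']) le_rfl) () trivial r'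
  have h2 := run_forPop (M := M) (σ := Mem) (k := .inl .v') (f := setCur) (p := reset)
    (fun (_ : Unit) l => ((ph, none, acc, ok), stks [] [] [] [] [] l [] [] H))
    (fun g _ => g) (fun _ => True) 1 (fun g l => rfl) (fun _ _ _ => trivial)
    (fun g γ l _ => Run.load.congr (by simp [update_v']) le_rfl) () trivial v'
  exact (Run.seq h1 (.seq h2 .push)).congr (by simp [update_out]) (by omega)

end HardCoreMachine

/-! ### The hard-core bit as an NP ∩ coNP function -/

theorem length_deinterleave : ∀ u : List Bool,
    (deinterleave u).1.length + (deinterleave u).2.length = u.length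
  | a :: b :: l => by
    simp only [deinterleave, List.length_cons]
    have := length_deinterleave l
    omega
  | [a] => rfl
  | [] => rfl

-- Nothing has to be inverted: `y` is given, the machine for `h` is run on it as a subroutine, and
-- the output is compared with `v`. Length preservation bounds the time of the comparison.
open HardCoreMachine Prog in
theorem polyTimeRel_hardCoreRel {h : List Bool → List Bool} (hh : PolyTimeFun h)
    (hlen : ∀ v, (h v).length = v.length) (a : Bool) : PolyTimeRel (hardCoreRel h a) := by
  obtain ⟨c⟩ := hh
  obtain ⟨E, hE⟩ := polynomial_eval_le c.time
  refine polyTime_of_run (M := c.tm) (Γ₁ := Sym) (.seq readInput <| .seq moveRV <|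
    .seq (moveY c.inputAlphabet) <| .seq innerProduct <| .seq .call <|
    .seq (HardCoreMachine.compare c.outputAlphabet) (finish a)) (some false, none, false, true)
    .inp .out (Equiv.refl _) (Equiv.refl _) (.C E * (.X + 1) ^ E + 40 * .X + 40) ?_
  rintro ⟨u, y⟩
  have h1 := run_readInput (M := c.tm) (encodePair (u, y)) fun _ => []
  rw [foldl_readStep] at h1
  have h2 := run_moveRV (M := c.tm) none false true (deinterleave u).1.reverse
    (deinterleave u).2.reverse y.reverse fun _ => []
  have h3 := run_moveY c.inputAlphabet none false true y.reverse (deinterleave u).1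
    (deinterleave u).2
  simp only [List.reverse_reverse] at h2 h3
  obtain ⟨r', hr', h4⟩ := run_innerProduct (M := c.tm) none true (deinterleave u).1
    (deinterleave u).2 y (initList c.tm (y.map c.inputAlphabet.symm)).stk
  obtain ⟨v', hv', h5⟩ := run_compare c.outputAlphabet none (dot y (deinterleave u).1) r'
    (deinterleave u).2 (h y)
  have h6 := run_finish (M := c.tm) a none (dot y (deinterleave u).1)
    (h y == (deinterleave u).2) r' v' fun _ => []
  have hout := c.outputsFun y
  have hcall : Run (M := c.tm) (Γ₁ := Sym) (σ := Mem) .call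
      ((none, none, dot y (deinterleave u).1, true), stks [] [] [] [] r' (deinterleave u).2 [] []
        (initList c.tm (y.map c.inputAlphabet.symm)).stk)
      ((none, none, dot y (deinterleave u).1, true), stks [] [] [] [] r' (deinterleave u).2 [] []
        (haltList c.tm ((h y).map c.outputAlphabet.symm)).stk) (c.time.eval y.length) := by
    have h0 : Reaches c.tm.m (initList c.tm (y.map c.inputAlphabet.symm))
        (haltList c.tm ((h y).map c.outputAlphabet.symm)) (c.time.eval y.length) :=
      ⟨hout.steps, hout.steps_le_m, hout.evals_in_steps⟩
    refine (Run.call (S := stks [] [] [] [] r' (deinterleave u).2 [] []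
      (initList c.tm (y.map c.inputAlphabet.symm)).stk) h0).congr ?_ le_rfl
    congr 1
    funext k
    rcases k with k | k
    · cases k <;> rfl
    · rfl
  have hfirst : single c.tm .inp (encodePair (u, y)) =
      stks (encodePair (u, y)) [] [] [] [] [] [] [] fun _ => [] := by
    rw [← update_inp []]
    funext k
    rcases k with k | k
    · cases k <;> rfl
    · rfl
  have hlast (b : Bool) : single c.tm .out [b] = stks [] [] [] [] [] [] [] [b] fun _ => [] := by
    rw [← update_out _ _ _ _ _ _ _ []]
    funext k
    rcases k with k | k
    · cases k <;> rfl
    · rfl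
  simp only [Equiv.refl_symm, Equiv.coe_refl, List.map_id, hfirst]
  refine ⟨_, (h1.seq (h2.seq (h3.seq (h4.seq (hcall.seq (h5.seq h6)))))).congr
    (congrArg _ (hlast _).symm) ?_⟩
  have hu := length_deinterleave u
  have hN : (encodePair (u, y)).length = u.length + y.length + 1 := by
    simp [encodePair]; omega
  have hc : c.time.eval y.length ≤ E * ((encodePair (u, y)).length + 1) ^ E :=
    (hE _).trans (Nat.mul_le_mul_left _ (Nat.pow_le_pow_left (by omega) _))
  simp only [Polynomial.eval_add, Polynomial.eval_mul, Polynomial.eval_pow, Polynomial.eval_C,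
    Polynomial.eval_X, Polynomial.eval_one, Polynomial.eval_ofNat, List.length_reverse, hlen]
  omega

/-- As `h` is a bijection, the only candidate for a witness is the preimage of `v`, whatever the
value `a`. Uniqueness of witnesses and the correctness for both values follow together. -/
theorem hardCoreRel_eq_true_iff {h : List Bool → List Bool} (hh : IsPolyTimePerm h) (a : Bool)
    (u y : List Bool) : hardCoreRel h a u y = true ↔
      y = Function.invFun h (deinterleave u).2 ∧ hardCoreBit h u = a := by
  simp only [hardCoreRel, hardCoreBit, Bool.and_eq_true, beq_iff_eq]
  constructor
  · rintro ⟨h1, h2⟩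
    have : y = Function.invFun h (deinterleave u).2 := by
      rw [← h1, Function.leftInverse_invFun hh.bijective.injective]
    exact ⟨this, this ▸ h2⟩
  · rintro ⟨rfl, h2⟩
    exact ⟨Function.rightInverse_invFun hh.bijective.surjective _, h2⟩

theorem isNPcoNPUnique_hardCoreBit {h : List Bool → List Bool} (hh : IsPolyTimePerm h) :
    IsNPcoNPUnique (hardCoreBit h) := by
  have hinv := Function.rightInverse_invFun hh.bijective.surjective
  have hlen (u : List Bool) :
      (Function.invFun h (deinterleave u).2).length ≤ u.length ^ 1 := by
    rw [← hh.length_eq, hinv, length_deinterleave_snd, pow_one]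
    exact Nat.div_le_self _ _
  -- The witness is as long as `v`, half of the input rounded down, so exponent `1` suffices.
  refine ⟨hardCoreRel h, 1, fun a => polyTimeRel_hardCoreRel hh.polyTime hh.length_eq a,
    fun u a => ⟨fun hu => ⟨_, hlen u, (hardCoreRel_eq_true_iff hh a u _).2 ⟨rfl, hu⟩⟩, ?_⟩,
    fun u => ⟨_, ⟨hlen u, (hardCoreRel_eq_true_iff hh _ u _).2 ⟨rfl, rfl⟩⟩, ?_⟩⟩
  · rintro ⟨y, -, hy⟩
    exact ((hardCoreRel_eq_true_iff hh a u y).1 hy).2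
  · rintro y ⟨-, hy⟩
    exact ((hardCoreRel_eq_true_iff hh _ u y).1 hy).1

end HardTaut

namespace HardTaut

/-! ### Evaluating formulas given in Polish notation -/

/-- Unique readability. The arbitrary continuations `l`, `l'` are what the induction needs at a
binary connective, where the code of the second argument follows that of the first. -/
theorem PropFormula.encode_append_inj {φ ψ : PropFormula} {l l' : List Bool}
    (h : φ.encode ++ l = ψ.encode ++ l') : φ = ψ ∧ l = l' := by
  induction φ generalizing ψ l l' with
  | falsum => cases ψ <;> simp_all [encode]
  | verum => cases ψ <;> simp_all [encode]
  | var i =>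
    cases ψ with
    | var j =>
      simp only [encode, List.append_assoc, List.cons_append, List.nil_append, List.cons.injEq,
        true_and] at h
      induction i generalizing j with
      | zero => cases j <;> simp_all [List.replicate_succ]
      | succ i ih =>
        cases j with
        | zero => simp [List.replicate_succ] at h
        | succ j =>
          simp only [List.replicate_succ, List.cons_append, List.cons.injEq, true_and] at h
          have := ih j h
          simp_all
    | _ => simp [encode] at h
  | neg φ ih =>
    cases ψ with
    | neg ψ =>
      simp only [encode, List.cons_append, List.nil_append, List.cons.injEq, true_and] at h
      have := ih h
      simp_all
    | _ => simp [encode] at h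
  | and φ₁ φ₂ ih₁ ih₂ | or φ₁ φ₂ ih₁ ih₂ =>
    cases ψ with
    | and ψ₁ ψ₂ | or ψ₁ ψ₂ =>
      simp only [encode, List.cons_append, List.nil_append, List.append_assoc, List.cons.injEq,
        true_and, Bool.true_eq_false, Bool.false_eq_true, false_and] at h
      try
        obtain ⟨rfl, h'⟩ := ih₁ h
        obtain ⟨rfl, rfl⟩ := ih₂ h'
        exact ⟨rfl, rfl⟩
    | _ => simp [encode] at h

theorem PropFormula.encode_injective : Function.Injective PropFormula.encode := fun φ ψ h =>
  (encode_append_inj (l := []) (l' := []) (by simpa using h)).1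

/-- Indices are written in unary, so a variable that occurs has an index below the length of the
code. Hence assignments of that length suffice. -/
theorem PropFormula.eval_congr {α β : ℕ → Bool} (φ : PropFormula)
    (h : ∀ i < φ.encode.length, α i = β i) : φ.eval α = φ.eval β := by
  induction φ with
  | falsum | verum => rfl
  | var i => exact h i (by simp only [encode, List.length_append, List.length_replicate]; simp)
  | neg φ ih =>
    simp only [eval]
    rw [ih fun i hi => h i (by simp only [encode, List.length_append]; omega)]
  | and φ ψ ih₁ ih₂ | or φ ψ ih₁ ih₂ =>
    simp only [eval]
    rw [ih₁ fun i hi => h i (by simp only [encode, List.length_append]; omega),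
      ih₂ fun i hi => h i (by simp only [encode, List.length_append]; omega)]

/-- The symbols of a formula, with variables replaced by their values. -/
inductive Tok
  | val (b : Bool)
  | neg
  | and
  | or
  deriving DecidableEq

/-- The states of the automaton that splits the code of a formula into symbols. -/
inductive LexState
  | start | s0 | s1 | s00 | s01 | var
  deriving DecidableEq

/-- The next state, except within a variable. -/
def LexState.next : LexState → Bool → LexState
  | .start, false => .s0
  | .start, true => .s1
  | .s0, false => .s00
  | .s0, true => .s01
  | .s01, false => .var
  | _, _ => .start

/-- The symbol that is recognised, except within a variable. -/
def LexState.emit : LexState → Bool → Option Tok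
  | .s00, b => some (.val b)
  | .s01, true => some .neg
  | .s1, false => some .and
  | .s1, true => some .or
  | _, _ => none

/-- Reading one bit: besides the state there are the assignment, split at the current position
within a variable index, and the symbols recognised so far. -/
def lexStep : LexState × List Bool × List Bool × List Tok → Bool →
    LexState × List Bool × List Bool × List Tok
  | (.var, al, al', t), true => (.var, al.tail, al.head?.toList ++ al', t)
  | (.var, al, al', t), false =>
    (.start, (al.head?.toList ++ al').reverse ++ al.tail, [], .val (al.head?.getD false) :: t)
  | (q, al, al', t), b => (q.next b, al, al', (q.emit b).toList ++ t)

/-- Applying a symbol to a stack of values; the flag records whether there were enough values. -/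
def evStep : Bool × List Bool → Tok → Bool × List Bool
  | (ok, w), .val b => (ok, b :: w)
  | (ok, w), .neg => (ok && w.head?.isSome, (!w.head?.getD false) :: w.tail)
  | (ok, w), .and => (ok && w.head?.isSome && w.tail.head?.isSome,
      (w.head?.getD false && w.tail.head?.getD false) :: w.tail.tail)
  | (ok, w), .or => (ok && w.head?.isSome && w.tail.head?.isSome,
      (w.head?.getD false || w.tail.head?.getD false) :: w.tail.tail)

/-- Whether the string `x` is the code of a formula that is true under the assignment `α`. -/
def evalCode (α x : List Bool) : Bool :=
  let g := x.foldl lexStep (.start, α, [], [])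
  let r := g.2.2.2.foldl evStep (true, [])
  r.1 && r.2.head? == some true && r.2.tail.head?.isNone && g.1 == .start

/-- The symbols of a formula. -/
inductive RawTok
  | const (b : Bool)
  | var (i : ℕ)
  | neg
  | and
  | or

/-- The code of a symbol. -/
def RawTok.code : RawTok → List Bool
  | const b => [false, false, b]
  | var i => [false, true, false] ++ List.replicate i true ++ [false]
  | neg => [false, true, true]
  | and => [true, false]
  | or => [true, true]

/-- Replace a variable by its value. -/
def RawTok.subst (α : List Bool) : RawTok → Tok
  | const b => .val b
  | var i => .val (α.getD i false)
  | neg => .neg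
  | and => .and
  | or => .or

/-- The formula in Polish notation as a list of symbols. -/
def PropFormula.toks : PropFormula → List RawTok
  | falsum => [.const false]
  | verum => [.const true]
  | var i => [.var i]
  | neg φ => .neg :: φ.toks
  | and φ ψ => .and :: (φ.toks ++ ψ.toks)
  | or φ ψ => .or :: (φ.toks ++ ψ.toks)

theorem PropFormula.flatMap_code_toks (φ : PropFormula) :
    φ.toks.flatMap RawTok.code = φ.encode := by
  induction φ <;> simp_all [toks, encode, RawTok.code]

theorem foldl_lexStep_replicate (i : ℕ) (al al' : List Bool) (t : List Tok) :
    (List.replicate i true).foldl lexStep (.var, al, al', t) =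
      (.var, al.drop i, (al.take i).reverse ++ al', t) := by
  induction i generalizing al al' with
  | zero => simp
  | succ i ih =>
    rw [List.replicate_succ, List.foldl_cons, lexStep, ih]
    cases al <;> simp

/-- Within a variable index the pair of lists acts as the assignment with a reading head; the
closing zero rewinds it. So every complete symbol leaves the automaton at `start` with the
assignment intact. -/
theorem foldl_lexStep_code (α : List Bool) (r : RawTok) (t : List Tok) :
    r.code.foldl lexStep (.start, α, [], t) = (.start, α, [], r.subst α :: t) := by
  cases r with
  | const b => cases b <;> rfl
  | var i =>
    simp only [RawTok.code, List.foldl_append, foldl_lexStep_replicate, lexStep, LexState.next,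
      LexState.emit, List.foldl_cons, List.foldl_nil, List.append_nil, Option.toList_none,
      List.nil_append, RawTok.subst]
    congr 2
    -- An index beyond the end of `α` finds nothing under the head, and the variable gets the
    -- default value `false`.
    · rcases h : α.drop i with _ | ⟨b, l⟩
      · have : α.length ≤ i := by simpa using h
        simp [List.take_of_length_le this]
      · have h' := List.take_append_drop i α
        rw [h] at h'
        simpa using h'
    · simp [List.getD_eq_getElem?_getD, List.head?_drop]
  | neg | and | or => rfl

theorem foldl_lexStep_flatMap (α : List Bool) (rs : List RawTok) (t : List Tok) :
    (rs.flatMap RawTok.code).foldl lexStep (.start, α, [], t) =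
      (.start, α, [], (rs.map (RawTok.subst α)).reverse ++ t) := by
  induction rs generalizing t with
  | nil => rfl
  | cons r rs ih => simp [foldl_lexStep_code, ih]

theorem exists_of_foldl_lexStep_var (al al' : List Bool) (t : List Tok) (x : List Bool)
    (h : (x.foldl lexStep (.var, al, al', t)).1 = .start) :
    ∃ i x', x = List.replicate i true ++ false :: x' := by
  induction x generalizing al al' with
  | nil => cases h
  | cons b x ih =>
    cases b with
    | false => exact ⟨0, x, rfl⟩
    | true =>
      obtain ⟨i, x', rfl⟩ := ih _ _ h
      exact ⟨i + 1, x', rfl⟩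

/-- The automaton can end in `start` only at a boundary between symbols. The first symbol is split
off, and strong induction on the length treats the rest. -/
theorem exists_of_foldl_lexStep (α : List Bool) (x : List Bool) (t : List Tok)
    (h : (x.foldl lexStep (.start, α, [], t)).1 = .start) :
    ∃ rs : List RawTok, x = rs.flatMap RawTok.code := by
  induction hn : x.length using Nat.strong_induction_on generalizing x t with
  | _ n ih =>
  have key (r : RawTok) (x' : List Bool) (hx : x = r.code ++ x') :
      ∃ rs : List RawTok, x = rs.flatMap RawTok.code := by
    subst hx
    rw [List.foldl_append, foldl_lexStep_code] at h
    have hr : 0 < r.code.length := by cases r <;> simp [RawTok.code]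
    obtain ⟨rs, hrs⟩ := ih _ (by rw [← hn, List.length_append]; omega) x' _ h rfl
    exact ⟨r :: rs, by rw [hrs, List.flatMap_cons]⟩
  match x, h with
  | [], _ => exact ⟨[], rfl⟩
  -- Strings that break off inside a symbol end in another state.
  | [true], h | [false], h | [false, false], h | [false, true], h => cases h
  | true :: false :: x, _ => exact key .and x rfl
  | true :: true :: x, _ => exact key .or x rfl
  | false :: false :: b :: x, _ => exact key (.const b) x rfl
  | false :: true :: true :: x, _ => exact key .neg x rfl
  | false :: true :: false :: x, h =>
    obtain ⟨i, x', rfl⟩ := exists_of_foldl_lexStep_var α [] t x h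
    exact key (.var i) x' (by simp [RawTok.code])

/-- Evaluation of a list of symbols from the right. -/
def evRun (α : List Bool) (rs : List RawTok) : Bool × List Bool :=
  rs.foldr (fun r g => evStep g (r.subst α)) (true, [])

/-- Polish notation is evaluated from the right: when an operation is met, the values of its
arguments are on top of the stack, the first argument uppermost. -/
theorem evRun_toks (α : List Bool) (φ : PropFormula) (rs : List RawTok) :
    evRun α (φ.toks ++ rs) =
      ((evRun α rs).1, φ.eval (fun i => α.getD i false) :: (evRun α rs).2) := by
  unfold evRun
  induction φ generalizing rs with
  | falsum | verum | var i => rfl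
  | neg φ ih =>
    simp only [PropFormula.toks, List.cons_append, List.foldr_cons, ih]
    simp [RawTok.subst, evStep, PropFormula.eval]
  | and φ ψ ih₁ ih₂ | or φ ψ ih₁ ih₂ =>
    simp only [PropFormula.toks, List.cons_append, List.foldr_cons, List.append_assoc, ih₁, ih₂]
    simp [RawTok.subst, evStep, PropFormula.eval]

/-- As long as no operation lacks arguments, the suffix read so far is a concatenation of formulas,
and the stack lists their values. A final stack of height one thus certifies a single formula. -/
theorem exists_of_evRun (α : List Bool) (rs : List RawTok) (h : (evRun α rs).1 = true) :
    ∃ φs : List PropFormula, rs = φs.flatMap PropFormula.toks ∧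
      (evRun α rs).2 = φs.map fun φ => φ.eval fun i => α.getD i false := by
  induction rs with
  | nil => exact ⟨[], rfl, rfl⟩
  | cons r rs ih =>
    have hcons : evRun α (r :: rs) = evStep (evRun α rs) (r.subst α) := rfl
    rw [hcons] at h ⊢
    rcases hr : evRun α rs with ⟨ok, w⟩
    rw [hr] at h ih
    have hok : ok = true := by
      cases r <;> simp_all [RawTok.subst, evStep]
    obtain ⟨φs, rfl, hw⟩ := ih hok
    simp only at hw
    subst hw
    cases r with
    | const b =>
      cases b
      · exact ⟨.falsum :: φs, rfl, rfl⟩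
      · exact ⟨.verum :: φs, rfl, rfl⟩
    | var i => exact ⟨.var i :: φs, rfl, rfl⟩
    | neg =>
      rcases φs with _ | ⟨φ, φs⟩
      · simp [RawTok.subst, evStep] at h
      · exact ⟨.neg φ :: φs, rfl, rfl⟩
    | and =>
      rcases φs with _ | ⟨φ, _ | ⟨ψ, φs⟩⟩
      · simp [RawTok.subst, evStep] at h
      · simp [RawTok.subst, evStep] at h
      · exact ⟨.and φ ψ :: φs, by simp [PropFormula.toks], rfl⟩
    | or =>
      rcases φs with _ | ⟨φ, _ | ⟨ψ, φs⟩⟩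
      · simp [RawTok.subst, evStep] at h
      · simp [RawTok.subst, evStep] at h
      · exact ⟨.or φ ψ :: φs, by simp [PropFormula.toks], rfl⟩

/-- The lexer leaves the last symbol on top, which is precisely the order in which evaluation
consumes them. -/
theorem foldl_evStep_reverse (α : List Bool) (rs : List RawTok) :
    ((rs.map (RawTok.subst α)).reverse).foldl evStep (true, []) = evRun α rs := by
  rw [List.foldl_reverse, List.foldr_map]
  rfl

theorem evalCode_eq_true_iff (α x : List Bool) : evalCode α x = true ↔
    ∃ φ : PropFormula, φ.encode = x ∧ φ.eval (fun i => α.getD i false) = true := by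
  constructor
  · intro h
    simp only [evalCode, Bool.and_eq_true, beq_iff_eq] at h
    obtain ⟨⟨⟨h1, h2⟩, h3⟩, h4⟩ := h
    obtain ⟨rs, rfl⟩ := exists_of_foldl_lexStep α x [] h4
    rw [foldl_lexStep_flatMap, List.append_nil] at h1 h2 h3
    simp only [foldl_evStep_reverse] at h1 h2 h3
    obtain ⟨φs, rfl, hφ⟩ := exists_of_evRun α rs h1
    rw [hφ] at h2 h3
    rcases φs with _ | ⟨φ, _ | ⟨ψ, φs⟩⟩
    · simp at h2
    · refine ⟨φ, by simp [φ.flatMap_code_toks], by simpa using h2⟩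
    · simp at h3
  · rintro ⟨φ, rfl, h⟩
    have h1 := foldl_lexStep_flatMap α φ.toks []
    have h2 := evRun_toks α φ []
    rw [φ.flatMap_code_toks, List.append_nil] at h1
    rw [List.append_nil] at h2
    simp only [evalCode, h1, foldl_evStep_reverse, h2]
    simpa [evRun] using h

theorem forall_evalCode_iff (x : List Bool) :
    (∀ α : List Bool, α.length = x.length → evalCode α x = true) ↔
      ∃ φ : PropFormula, φ.encode = x ∧ φ.Tautology := by
  constructor
  · intro h
    -- Any assignment, here the zero one, yields a formula coded by `x`; injectivity of the code
    -- makes it the same for all assignments.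
    obtain ⟨φ, hφ, -⟩ := (evalCode_eq_true_iff _ _).1
      (h (List.replicate x.length false) (by simp))
    refine ⟨φ, hφ, fun β => ?_⟩
    obtain ⟨ψ, hψ, hβ⟩ := (evalCode_eq_true_iff _ _).1 (h ((List.range x.length).map β) (by simp))
    obtain rfl := PropFormula.encode_injective (hφ.trans hψ.symm)
    rw [← hβ]
    refine φ.eval_congr fun i hi => ?_
    rw [hφ] at hi
    simp [List.getD_eq_getElem?_getD, hi]
  · rintro ⟨φ, rfl, h⟩ α -
    exact (evalCode_eq_true_iff _ _).2 ⟨φ, rfl, h _⟩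

end HardTaut

namespace HardTaut

/-! ### Truth tables of the set of tautologies -/

theorem length_indexBits (k i : ℕ) : (indexBits k i).length = k := by simp [indexBits]

theorem indexBits_succ (k i : ℕ) : indexBits (k + 1) i = i.testBit 0 :: indexBits k (i / 2) := by
  simp only [indexBits, List.ofFn_succ, Fin.val_zero, Fin.val_succ, Nat.testBit_succ]

theorem indexBits_mod (k i : ℕ) : indexBits k (i % 2 ^ k) = indexBits k i := by
  simp [indexBits, Nat.testBit_mod_two_pow]

theorem indexBits_zero_right (k : ℕ) : indexBits k 0 = List.replicate k false := by
  simp [indexBits]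

theorem exists_indexBits_eq (α : List Bool) : ∃ i, indexBits α.length i = α := by
  induction α with
  | nil => exact ⟨0, rfl⟩
  | cons b α ih =>
    obtain ⟨i, hi⟩ := ih
    refine ⟨2 * i + b.toNat, ?_⟩
    rw [List.length_cons, indexBits_succ]
    congr 1
    · cases b <;> simp [Nat.testBit_zero, Nat.add_mod]
    · convert hi using 2
      have := b.toNat_lt
      omega

/-- Any `2 ^ k` consecutive numbers exhaust the residues modulo `2 ^ k`. The assignment counter may
therefore start anywhere and is never reset between entries of the table. -/
theorem forall_lt_indexBits_iff (k a : ℕ) (P : List Bool → Prop) :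
    (∀ j < 2 ^ k, P (indexBits k (a + j))) ↔ ∀ α : List Bool, α.length = k → P α := by
  refine ⟨?_, fun h j _ => h _ (length_indexBits _ _)⟩
  rintro h α rfl
  obtain ⟨i, hi⟩ := exists_indexBits_eq α
  have hpos : 0 < 2 ^ α.length := by positivity
  rw [← hi, ← indexBits_mod]
  have ha := Nat.mod_lt a hpos
  have hi' := Nat.mod_lt i hpos
  rcases le_or_gt (a % 2 ^ α.length) (i % 2 ^ α.length) with hle | hlt
  · have := h (i % 2 ^ α.length - a % 2 ^ α.length) (by omega)
    rwa [← indexBits_mod, Nat.add_mod, Nat.mod_eq_of_lt (a := _ - _) (by omega),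
      Nat.add_sub_cancel' hle, Nat.mod_mod] at this
  · have := h (i % 2 ^ α.length + 2 ^ α.length - a % 2 ^ α.length) (by omega)
    rwa [← indexBits_mod, Nat.add_mod, Nat.mod_eq_of_lt (a := _ - _) (by omega),
      Nat.add_sub_cancel' (by omega), Nat.add_mod_right, Nat.mod_mod] at this

/-- Adding a carry to a number in binary, least significant bit first. -/
def addCarry : Bool → List Bool → List Bool × Bool
  | c, [] => ([], c)
  | c, b :: l => ((b ^^ c) :: (addCarry (b && c) l).1, (addCarry (b && c) l).2)

theorem length_addCarry (c : Bool) (l : List Bool) : (addCarry c l).1.length = l.length := by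
  induction l generalizing c with
  | nil => rfl
  | cons b l ih => simp [addCarry, ih]

theorem addCarry_indexBits (k i : ℕ) (c : Bool) : addCarry c (indexBits k i) =
    (indexBits k (i + c.toNat), decide (i % 2 ^ k + c.toNat = 2 ^ k)) := by
  induction k generalizing i c with
  | zero => cases c <;> simp [indexBits, addCarry, Nat.mod_one]
  | succ k ih =>
    rw [indexBits_succ, indexBits_succ, addCarry, ih]
    have h1 : (i + c.toNat) / 2 = i / 2 + (i.testBit 0 && c).toNat := by
      rcases Nat.mod_two_eq_zero_or_one i with h | h <;> cases c <;>
        simp [Nat.testBit_zero, h] <;> omega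
    have h2 : (i + c.toNat).testBit 0 = (i.testBit 0 ^^ c) := by
      rcases Nat.mod_two_eq_zero_or_one i with h | h <;> cases c <;>
        simp [Nat.testBit_zero, Nat.add_mod, h]
    have h3 : i % 2 ^ (k + 1) = i % 2 + 2 * (i / 2 % 2 ^ k) := by
      rw [pow_succ', Nat.mod_mul]
    rw [h1, h2]
    refine Prod.ext rfl (decide_eq_decide.2 ?_)
    rw [h3, pow_succ']
    rcases Nat.mod_two_eq_zero_or_one i with h | h <;> cases c <;>
      simp [Nat.testBit_zero, h] <;> omega

/-- One iteration of the loop over the assignments. -/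
def innerStep (x : List Bool) (g : List Bool × Bool) (_ : Bool) : List Bool × Bool :=
  ((addCarry true g.1).1, g.2 && evalCode g.1 x)

/-- One iteration of the loop over the entries of the table: besides the counter `x` and the
assignment there are flags for the success so far and for an overflow of the counter. -/
def outerStep (c : List Bool) (g : List Bool × List Bool × Bool × Bool) (b : Bool) :
    List Bool × List Bool × Bool × Bool :=
  ((addCarry true g.1).1, (c.foldl (innerStep g.1) (g.2.1, true)).1,
    g.2.2.1 && (b == (c.foldl (innerStep g.1) (g.2.1, true)).2) && !g.2.2.2, (addCarry true g.1).2)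

open scoped Classical in
/-- The truth table of the set of tautologies of size `k`. -/
noncomputable def tautTable (k : ℕ) : List Bool :=
  List.ofFn fun i : Fin (2 ^ k) =>
    decide (∃ φ : PropFormula, φ.encode = indexBits k i ∧ φ.Tautology)

theorem length_tautTable (k : ℕ) : (tautTable k).length = 2 ^ k := by simp [tautTable]

/-- The symbols of `c` are ignored: the list is a clock that sets the number of assignments tried. A
copy of the table itself serves as this clock. -/
theorem foldl_innerStep (k a : ℕ) (x c : List Bool) (t : Bool) :
    c.foldl (innerStep x) (indexBits k a, t) =
      (indexBits k (a + c.length),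
        t && decide (∀ j < c.length, evalCode (indexBits k (a + j)) x = true)) := by
  induction c generalizing a t with
  | nil => simp
  | cons b c ih =>
    simp only [List.foldl_cons, innerStep, addCarry_indexBits, Bool.toNat_true, ih,
      List.length_cons]
    refine Prod.ext (by simp only; congr 1; ring) ?_
    rw [Bool.eq_iff_iff]
    simp only [Bool.and_eq_true, decide_eq_true_eq, and_assoc, and_congr_right_iff]
    intro _
    rw [Nat.forall_lt_succ_left]
    simp only [add_zero, and_congr_right_iff]
    intro _
    refine forall₂_congr fun j _ => ?_
    rw [show a + 1 + j = a + (j + 1) by ring]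

theorem foldl_innerStep_snd (k a : ℕ) (x c : List Bool) (hx : x.length = k)
    (hc : c.length = 2 ^ k) : (c.foldl (innerStep x) (indexBits k a, true)).2 = true ↔
      ∃ φ : PropFormula, φ.encode = x ∧ φ.Tautology := by
  rw [foldl_innerStep, Bool.true_and, decide_eq_true_iff, hc,
    forall_lt_indexBits_iff k a fun α => evalCode α x = true, ← hx, forall_evalCode_iff]

theorem foldl_outerStep_false (c z x al : List Bool) (ov : Bool) :
    (z.foldl (outerStep c) (x, al, false, ov)).2.2.1 = false := by
  induction z generalizing x al ov with
  | nil => rfl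
  | cons b z ih => simp [outerStep, ih]

/-- The length of `z` is checked without computing `2 ^ k`: the counter must overflow at the last
entry, and any entry after an overflow spoils the success flag. -/
theorem foldl_outerStep_length (k i a : ℕ) (c z : List Bool) (ok : Bool) (hi : i ≤ 2 ^ k)
    (h1 : (z.foldl (outerStep c) (indexBits k i, indexBits k a, ok, decide (i = 2 ^ k))).2.2.1
      = true)
    (h2 : (z.foldl (outerStep c) (indexBits k i, indexBits k a, ok, decide (i = 2 ^ k))).2.2.2
      = true) : z.length + i = 2 ^ k := by
  induction z generalizing i a ok with
  | nil => simpa using h2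
  | cons b z ih =>
    have hi' : i ≠ 2 ^ k := by
      rintro rfl
      simp [outerStep, foldl_outerStep_false] at h1
    have hlt : i < 2 ^ k := lt_of_le_of_ne hi hi'
    simp only [List.foldl_cons, outerStep, foldl_innerStep, addCarry_indexBits, Bool.toNat_true,
      Nat.mod_eq_of_lt hlt] at h1 h2
    have := ih (i + 1) _ _ hlt h1 h2
    rw [List.length_cons]
    omega

theorem foldl_outerStep_eq_true_iff (k i a : ℕ) (c z : List Bool) (ok : Bool)
    (hc : c.length = 2 ^ k) (hz : z.length + i = 2 ^ k) :
    (z.foldl (outerStep c) (indexBits k i, indexBits k a, ok, decide (i = 2 ^ k))).2.2.1 = true ∧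
      (z.foldl (outerStep c) (indexBits k i, indexBits k a, ok, decide (i = 2 ^ k))).2.2.2 = true ↔
      ok = true ∧ z = (tautTable k).drop i := by
  induction z generalizing i a ok with
  | nil =>
    simp only [List.length_nil, zero_add] at hz
    subst hz
    simp [← length_tautTable]
  | cons b z ih =>
    rw [List.length_cons] at hz
    have hlt : i < 2 ^ k := by omega
    have ht : (c.foldl (innerStep (indexBits k i)) (indexBits k a, true)).2 =
        (tautTable k)[i]'(by rwa [length_tautTable]) := by
      rw [Bool.eq_iff_iff, foldl_innerStep_snd k a _ c (length_indexBits _ _) hc]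
      simp [tautTable]
    have hstep : outerStep c (indexBits k i, indexBits k a, ok, decide (i = 2 ^ k)) b =
        (indexBits k (i + 1), indexBits k (a + c.length),
          ok && (b == (tautTable k)[i]'(by rwa [length_tautTable])), decide (i + 1 = 2 ^ k)) := by
      rw [outerStep, ← ht]
      simp only [foldl_innerStep, addCarry_indexBits, Bool.toNat_true, Nat.mod_eq_of_lt hlt]
      simp [hlt.ne]
    rw [List.foldl_cons, hstep, ih (i + 1) _ _ (by omega),
      List.drop_eq_getElem_cons (by rwa [length_tautTable] : i < (tautTable k).length)]
    simp only [Bool.and_eq_true, beq_iff_eq, List.cons.injEq, and_assoc]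

/-- If both flags are set, the table has `2 ^ k` entries. Then the clock `c`, being equally long,
runs through all assignments and the entries are compared with the true values. -/
theorem foldl_outerStep_iff (k : ℕ) (c z : List Bool) (hc : c.length = z.length) :
    ((z.foldl (outerStep c) (List.replicate k false, List.replicate k false, true, false)).2.2.1 &&
      (z.foldl (outerStep c) (List.replicate k false, List.replicate k false, true, false)).2.2.2)
      = true ↔ z = tautTable k := by
  have h0 : false = decide (0 = 2 ^ k) :=
    (decide_eq_false (pow_pos two_pos k).ne).symm
  rw [← indexBits_zero_right, h0, Bool.and_eq_true]
  constructor
  · rintro ⟨h1, h2⟩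
    have hz := foldl_outerStep_length k 0 0 c z true (Nat.zero_le _) h1 h2
    have := (foldl_outerStep_eq_true_iff k 0 0 c z true (by omega) hz).1 ⟨h1, h2⟩
    simpa using this
  · rintro rfl
    rw [length_tautTable] at hc
    exact (foldl_outerStep_eq_true_iff k 0 0 c _ true hc (by rw [length_tautTable, add_zero])).2
      (by simp)

end HardTaut

namespace HardTaut

open Turing

/-! ### The machine checking truth tables -/

namespace TableMachine

open Prog

/-- The stacks of the machine that checks truth tables of the set of tautologies. -/
inductive Stk
  | inp | z | z' | c | c' | x | x' | al | al' | tok | w | out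
  deriving DecidableEq

instance : Finite Stk :=
  (⟨{.inp, .z, .z', .c, .c', .x, .x', .al, .al', .tok, .w, .out},
    fun k => by cases k <;> simp⟩ : Fintype Stk).finite

/-- The alphabets of the machine. -/
abbrev Sym : Stk → Type
  | .inp => Option Bool
  | .tok => Tok
  | _ => Bool

/-- The contents of the stacks. -/
structure Tapes where
  inp : List (Option Bool) := []
  z : List Bool := []
  z' : List Bool := []
  c : List Bool := []
  c' : List Bool := []
  x : List Bool := []
  x' : List Bool := []
  al : List Bool := []
  al' : List Bool := []
  tok : List Tok := []
  w : List Bool := []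
  out : List Bool := []

/-- The contents of the stacks as a dependent function. -/
def Tapes.stk (M : FinTM2) (S : Tapes) : Stacks Sym M
  | .inl .inp => S.inp
  | .inl .z => S.z
  | .inl .z' => S.z'
  | .inl .c => S.c
  | .inl .c' => S.c'
  | .inl .x => S.x
  | .inl .x' => S.x'
  | .inl .al => S.al
  | .inl .al' => S.al'
  | .inl .tok => S.tok
  | .inl .w => S.w
  | .inl .out => S.out
  | .inr _ => []

variable {M : FinTM2} {k₀ : ℕ}

theorem update_inp (S : Tapes) (l : List (Option Bool)) :
    Function.update (S.stk M) (.inl .inp) l = { S with inp := l }.stk M := by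
  funext k; rcases k with k | k
  · cases k <;> rfl
  · rfl

theorem update_z (S : Tapes) (l : List Bool) :
    Function.update (S.stk M) (.inl .z) l = { S with z := l }.stk M := by
  funext k; rcases k with k | k
  · cases k <;> rfl
  · rfl

theorem update_z' (S : Tapes) (l : List Bool) :
    Function.update (S.stk M) (.inl .z') l = { S with z' := l }.stk M := by
  funext k; rcases k with k | k
  · cases k <;> rfl
  · rfl

theorem update_c (S : Tapes) (l : List Bool) :
    Function.update (S.stk M) (.inl .c) l = { S with c := l }.stk M := by
  funext k; rcases k with k | k
  · cases k <;> rfl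
  · rfl

theorem update_c' (S : Tapes) (l : List Bool) :
    Function.update (S.stk M) (.inl .c') l = { S with c' := l }.stk M := by
  funext k; rcases k with k | k
  · cases k <;> rfl
  · rfl

theorem update_x (S : Tapes) (l : List Bool) :
    Function.update (S.stk M) (.inl .x) l = { S with x := l }.stk M := by
  funext k; rcases k with k | k
  · cases k <;> rfl
  · rfl

theorem update_x' (S : Tapes) (l : List Bool) :
    Function.update (S.stk M) (.inl .x') l = { S with x' := l }.stk M := by
  funext k; rcases k with k | k
  · cases k <;> rfl
  · rfl

theorem update_al (S : Tapes) (l : List Bool) :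
    Function.update (S.stk M) (.inl .al) l = { S with al := l }.stk M := by
  funext k; rcases k with k | k
  · cases k <;> rfl
  · rfl

theorem update_al' (S : Tapes) (l : List Bool) :
    Function.update (S.stk M) (.inl .al') l = { S with al' := l }.stk M := by
  funext k; rcases k with k | k
  · cases k <;> rfl
  · rfl

theorem update_tok (S : Tapes) (l : List Tok) :
    Function.update (S.stk M) (.inl .tok) l = { S with tok := l }.stk M := by
  funext k; rcases k with k | k
  · cases k <;> rfl
  · rfl

theorem update_w (S : Tapes) (l : List Bool) :
    Function.update (S.stk M) (.inl .w) l = { S with w := l }.stk M := by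
  funext k; rcases k with k | k
  · cases k <;> rfl
  · rfl

theorem update_out (S : Tapes) (l : List Bool) :
    Function.update (S.stk M) (.inl .out) l = { S with out := l }.stk M := by
  funext k; rcases k with k | k
  · cases k <;> rfl
  · rfl

/-- The finite memory of the machine. -/
structure Mem (k₀ : ℕ) where
  /-- all checks have succeeded so far -/
  ok : Bool := true
  /-- the counter has overflowed -/
  ov : Bool := false
  /-- the current string has been a true formula under all assignments so far -/
  ti : Bool := true
  /-- the evaluation of the current formula has not failed so far -/
  eok : Bool := true
  /-- the carry of an addition -/
  carry : Bool := false
  /-- the current bit of a loop -/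
  bit : Bool := false
  /-- the current entry of the table -/
  zb : Bool := false
  /-- the second part of the input is being read -/
  ph : Bool := false
  /-- the result of reading a symbol that may be missing -/
  ob : Option Bool := none
  /-- the state of the lexical analysis -/
  q : LexState := .start
  /-- the current symbol of the formula -/
  tk : Tok := .neg
  /-- the length of the first part of the input, if less than `k₀` -/
  cnt : Fin (k₀ + 1) := 0

instance : Finite Tok :=
  (⟨{.val false, .val true, .neg, .and, .or}, fun t => by
    rcases t with (_ | _) | _ | _ | _ <;> simp⟩ : Fintype Tok).finite

instance : Finite LexState :=
  (⟨{.start, .s0, .s1, .s00, .s01, .var}, fun t => by cases t <;> simp⟩ : Fintype LexState).finite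

instance : Finite (Mem k₀) :=
  Finite.of_injective (fun s : Mem k₀ => (s.ok, s.ov, s.ti, s.eok, s.carry, s.bit, s.zb, s.ph,
    s.ob, s.q, s.tk, s.cnt)) (by
      rintro ⟨⟩ ⟨⟩ h
      simp only [Prod.mk.injEq] at h
      obtain ⟨rfl, rfl, rfl, rfl, rfl, rfl, rfl, rfl, rfl, rfl, rfl, rfl⟩ := h
      rfl)

/-- Remember a bit. -/
abbrev setBit (s : Mem k₀) (b : Bool) : Mem k₀ := { s with bit := b }

/-- Forget the current bit. -/
abbrev resetBit : Prog Sym M (Mem k₀) := .load fun s => { s with bit := false }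

theorem foldl_cons (l l' : List Bool) : l.foldl (fun g b => b :: g) l' = l.reverse ++ l' := by
  induction l generalizing l' with
  | nil => rfl
  | cons b l ih => simp [ih]

/-- Reverse `z'` onto `z`. -/
def moveZ : Prog Sym M (Mem k₀) :=
  .forPop (.inl .z') setBit (.seq (.push (.inl .z) fun s => s.bit) resetBit)

theorem run_moveZ (s : Mem k₀) (S : Tapes) (hs : s.bit = false) :
    Run moveZ (s, S.stk M)
      (s, { S with z' := [], z := S.z'.reverse ++ S.z }.stk M)
      (S.z'.length * 3 + 1) := by
  have h := run_forPop (M := M) (Γ₁ := Sym) (σ := Mem k₀) (k := .inl .z') (f := setBit)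
    (p := .seq (.push (.inl .z) fun s => s.bit) resetBit)
    (fun (g : List Bool) l => (s, { S with z' := l, z := g }.stk M))
    (fun g b => b :: g) (fun _ => True) 2 (fun g l => rfl) (fun _ _ _ => trivial)
    (fun g γ l _ => (Run.seq .push .load).congr (by
      simp [update_z', update_z, Tapes.stk, ← hs]) le_rfl) S.z trivial S.z'
  rw [foldl_cons] at h
  exact h

/-- Reverse `c'` onto `c`. -/
def moveC : Prog Sym M (Mem k₀) :=
  .forPop (.inl .c') setBit (.seq (.push (.inl .c) fun s => s.bit) resetBit)

theorem run_moveC (s : Mem k₀) (S : Tapes) (hs : s.bit = false) :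
    Run moveC (s, S.stk M)
      (s, { S with c' := [], c := S.c'.reverse ++ S.c }.stk M)
      (S.c'.length * 3 + 1) := by
  have h := run_forPop (M := M) (Γ₁ := Sym) (σ := Mem k₀) (k := .inl .c') (f := setBit)
    (p := .seq (.push (.inl .c) fun s => s.bit) resetBit)
    (fun (g : List Bool) l => (s, { S with c' := l, c := g }.stk M))
    (fun g b => b :: g) (fun _ => True) 2 (fun g l => rfl) (fun _ _ _ => trivial)
    (fun g γ l _ => (Run.seq .push .load).congr (by
      simp [update_c', update_c, Tapes.stk, ← hs]) le_rfl) S.c trivial S.c'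
  rw [foldl_cons] at h
  exact h

/-- Reverse `x'` onto `x`. -/
def moveX : Prog Sym M (Mem k₀) :=
  .forPop (.inl .x') setBit (.seq (.push (.inl .x) fun s => s.bit) resetBit)

theorem run_moveX (s : Mem k₀) (S : Tapes) (hs : s.bit = false) :
    Run moveX (s, S.stk M)
      (s, { S with x' := [], x := S.x'.reverse ++ S.x }.stk M)
      (S.x'.length * 3 + 1) := by
  have h := run_forPop (M := M) (Γ₁ := Sym) (σ := Mem k₀) (k := .inl .x') (f := setBit)
    (p := .seq (.push (.inl .x) fun s => s.bit) resetBit)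
    (fun (g : List Bool) l => (s, { S with x' := l, x := g }.stk M))
    (fun g b => b :: g) (fun _ => True) 2 (fun g l => rfl) (fun _ _ _ => trivial)
    (fun g γ l _ => (Run.seq .push .load).congr (by
      simp [update_x', update_x, Tapes.stk, ← hs]) le_rfl) S.x trivial S.x'
  rw [foldl_cons] at h
  exact h

/-- Reverse `al'` onto `al`. -/
def moveAl : Prog Sym M (Mem k₀) :=
  .forPop (.inl .al') setBit (.seq (.push (.inl .al) fun s => s.bit) resetBit)

theorem run_moveAl (s : Mem k₀) (S : Tapes) (hs : s.bit = false) :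
    Run moveAl (s, S.stk M)
      (s, { S with al' := [], al := S.al'.reverse ++ S.al }.stk M)
      (S.al'.length * 3 + 1) := by
  have h := run_forPop (M := M) (Γ₁ := Sym) (σ := Mem k₀) (k := .inl .al') (f := setBit)
    (p := .seq (.push (.inl .al) fun s => s.bit) resetBit)
    (fun (g : List Bool) l => (s, { S with al' := l, al := g }.stk M))
    (fun g b => b :: g) (fun _ => True) 2 (fun g l => rfl) (fun _ _ _ => trivial)
    (fun g γ l _ => (Run.seq .push .load).congr (by
      simp [update_al', update_al, Tapes.stk, ← hs]) le_rfl) S.al trivial S.al'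
  rw [foldl_cons] at h
  exact h

/-! #### Lexical analysis -/

/-- Within a variable index: go to the next bit of the assignment. -/
def advance : Prog Sym M (Mem k₀) :=
  .seq (.pop (.inl .al) fun s o => { s with ob := o }) <|
  .seq (.ite (fun s => s.ob.isSome) (.push (.inl .al') fun s => s.ob.getD false) (.load id))
    (.load fun s => { s with ob := none, bit := false })

/-- At the end of a variable index: write the value of the variable, and restore the assignment. -/
def lookup : Prog Sym M (Mem k₀) :=
  .seq (.pop (.inl .al) fun s o => { s with ob := o }) <|
  .seq (.ite (fun s => s.ob.isSome) (.push (.inl .al') fun s => s.ob.getD false) (.load id)) <|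
  .seq (.push (.inl .tok) fun s => .val (s.ob.getD false)) <|
  .seq (.load fun s => { s with ob := none, bit := false, q := .start }) moveAl

/-- Process one bit of the code of a formula. -/
def lexBody : Prog Sym M (Mem k₀) :=
  .seq (.push (.inl .x') fun s => s.bit) <|
  .ite (fun s => s.q == .var) (.ite (fun s => s.bit) advance lookup) <|
  .seq (.ite (fun s => (s.q.emit s.bit).isSome)
    (.push (.inl .tok) fun s => (s.q.emit s.bit).getD .neg) (.load id))
    (.load fun s => { s with q := s.q.next s.bit, bit := false })

theorem run_advance (s : Mem k₀) (S : Tapes) (hs : s.ob = none) :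
    Run advance ({ s with bit := true }, S.stk M) ({ s with bit := false },
      { S with al := S.al.tail, al' := S.al.head?.toList ++ S.al' }.stk M) 4 := by
  obtain ⟨ok, ov, ti, eok, carry, bit, zb, ph, ob, q, tk, cnt⟩ := s
  obtain rfl : ob = none := hs
  rcases S with ⟨inp, z, z', c, c', x, x', _ | ⟨b, al⟩, al', tok, w, out⟩
  · refine (Run.seq .pop (.seq (.ite_false rfl .load) .load)).congr ?_ (by norm_num)
    simp [update_al, Tapes.stk]
  · refine (Run.seq .pop (.seq (.ite_true rfl .push) .load)).congr ?_ (by norm_num)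
    simp [update_al, update_al', Tapes.stk]

theorem run_lookup (s : Mem k₀) (S : Tapes) (hs : s.ob = none) (hb : s.bit = false) :
    Run lookup (s, S.stk M) ({ s with q := .start },
      { S with al := (S.al.head?.toList ++ S.al').reverse ++ S.al.tail, al' := [],
               tok := .val (S.al.head?.getD false) :: S.tok }.stk M)
      (S.al'.length * 3 + 9) := by
  obtain ⟨ok, ov, ti, eok, carry, bit, zb, ph, ob, q, tk, cnt⟩ := s
  obtain rfl : ob = none := hs
  obtain rfl : bit = false := hb
  rcases S with ⟨inp, z, z', c, c', x, x', _ | ⟨b, al⟩, al', tok, w, out⟩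
  · refine (Run.seq .pop (.seq (.ite_false rfl .load) (.seq .push (.seq .load
      ((run_moveAl ⟨ok, ov, ti, eok, carry, false, zb, ph, none, .start, tk, cnt⟩
        ⟨inp, z, z', c, c', x, x', [], al', .val false :: tok, w, out⟩ rfl).cast ?_ ?_))))).mono ?_
    · simp [update_al, update_tok, Tapes.stk]
    · simp
    · simp only; omega
  · refine (Run.seq .pop (.seq (.ite_true rfl .push) (.seq .push (.seq .load
      ((run_moveAl ⟨ok, ov, ti, eok, carry, false, zb, ph, none, .start, tk, cnt⟩
        ⟨inp, z, z', c, c', x, x', al, b :: al', .val b :: tok, w, out⟩ rfl).cast ?_ ?_))))).mono ?_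
    · simp [update_al, update_al', update_tok, Tapes.stk]
    · simp
    · simp only [List.length_cons]; omega

theorem run_lexBody (s : Mem k₀) (S : Tapes) (hs : s.ob = none) (hb : s.bit = false) (b : Bool) :
    Run lexBody ({ s with bit := b }, S.stk M)
      ({ s with q := (lexStep (s.q, S.al, S.al', S.tok) b).1 },
        { S with x' := b :: S.x', al := (lexStep (s.q, S.al, S.al', S.tok) b).2.1,
                 al' := (lexStep (s.q, S.al, S.al', S.tok) b).2.2.1,
                 tok := (lexStep (s.q, S.al, S.al', S.tok) b).2.2.2 }.stk M)
      (S.al'.length * 3 + 12) := by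
  obtain ⟨ok, ov, ti, eok, carry, bit, zb, ph, ob, q, tk, cnt⟩ := s
  obtain rfl : ob = none := hs
  obtain rfl : bit = false := hb
  obtain ⟨inp, z, z', c, c', x, x', al, al', tok, w, out⟩ := S
  by_cases hq : q = .var
  · subst hq
    cases b with
    | true =>
      refine (Run.seq .push (.ite_true rfl (.ite_true rfl
        ((run_advance ⟨ok, ov, ti, eok, carry, false, zb, ph, none, .var, tk, cnt⟩
          ⟨inp, z, z', c, c', x, true :: x', al, al', tok, w, out⟩ rfl).cast ?_ ?_)))).mono ?_
      · simp [update_x', Tapes.stk]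
      · simp [lexStep]
      · omega
    | false =>
      refine (Run.seq .push (.ite_true rfl (.ite_false rfl
        ((run_lookup ⟨ok, ov, ti, eok, carry, false, zb, ph, none, .var, tk, cnt⟩
          ⟨inp, z, z', c, c', x, false :: x', al, al', tok, w, out⟩ rfl rfl).cast ?_ ?_)))).mono ?_
      · simp [update_x', Tapes.stk]
      · simp [lexStep]
      · simp only; omega
  · have hstep : lexStep (q, al, al', tok) b = (q.next b, al, al', (q.emit b).toList ++ tok) := by
      cases q <;> first | rfl | exact absurd rfl hq
    simp only [hstep]
    rcases he : q.emit b with _ | t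
    · refine (Run.seq .push (.ite_false (by simp [hq])
        (.seq (.ite_false (by simp [he]) .load) .load))).congr ?_ (by omega)
      simp [update_x', Tapes.stk]
    · refine (Run.seq .push (.ite_false (by simp [hq])
        (.seq (.ite_true (by simp [he]) .push) .load))).congr ?_ (by omega)
      simp [update_x', update_tok, Tapes.stk, he]

/-- Lexing only moves the head along the assignment. This bounds the time of rewinding, and it
allows the assignment to be restored even when the string ends inside a variable index. -/
theorem lexStep_zip (g : LexState × List Bool × List Bool × List Tok) (b : Bool) :
    (lexStep g b).2.2.1.reverse ++ (lexStep g b).2.1 = g.2.2.1.reverse ++ g.2.1 := by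
  obtain ⟨q, al, al', t⟩ := g
  by_cases hq : q = .var
  · subst hq
    cases b <;> cases al <;> simp [lexStep]
  · have hstep : lexStep (q, al, al', t) b = (q.next b, al, al', (q.emit b).toList ++ t) := by
      cases q <;> first | rfl | exact absurd rfl hq
    rw [hstep]

theorem foldl_lexStep_zip (g : LexState × List Bool × List Bool × List Tok) (l : List Bool) :
    (l.foldl lexStep g).2.2.1.reverse ++ (l.foldl lexStep g).2.1 = g.2.2.1.reverse ++ g.2.1 := by
  induction l generalizing g with
  | nil => rfl
  | cons b l ih => rw [List.foldl_cons, ih, lexStep_zip]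

theorem length_lexStep_le (g : LexState × List Bool × List Bool × List Tok) (b : Bool) :
    (lexStep g b).2.2.2.length ≤ g.2.2.2.length + 1 := by
  obtain ⟨q, al, al', t⟩ := g
  by_cases hq : q = .var
  · subst hq
    cases b <;> simp [lexStep]
  · have hstep : lexStep (q, al, al', t) b = (q.next b, al, al', (q.emit b).toList ++ t) := by
      cases q <;> first | rfl | exact absurd rfl hq
    rw [hstep]
    cases q.emit b <;> simp

theorem length_foldl_lexStep_le (g : LexState × List Bool × List Bool × List Tok)
    (l : List Bool) : (l.foldl lexStep g).2.2.2.length ≤ g.2.2.2.length + l.length := by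
  induction l generalizing g with
  | nil => rfl
  | cons b l ih =>
    have := length_lexStep_le g b
    have := ih (lexStep g b)
    rw [List.foldl_cons, List.length_cons]
    omega

/-- Split the code of a formula into symbols. -/
def lex : Prog Sym M (Mem k₀) := .forPop (.inl .x) setBit lexBody

theorem run_lex (s : Mem k₀) (S : Tapes) (hs : s.ob = none) (hb : s.bit = false)
    (g : LexState × List Bool × List Bool × List Tok)
    (hg : S.x.foldl lexStep (s.q, S.al, S.al', S.tok) = g) :
    Run lex (s, S.stk M) ({ s with q := g.1 },
        { S with x := [], x' := S.x.reverse ++ S.x', al := g.2.1, al' := g.2.2.1,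
                 tok := g.2.2.2 }.stk M)
      (S.x.length * ((S.al'.reverse ++ S.al).length * 3 + 13) + 1) := by
  have hfold (l xs : List Bool) (g : LexState × List Bool × List Bool × List Tok) :
      l.foldl (fun (g : (LexState × List Bool × List Bool × List Tok) × List Bool) b =>
        (lexStep g.1 b, b :: g.2)) (g, xs) = (l.foldl lexStep g, l.reverse ++ xs) := by
    induction l generalizing xs g with
    | nil => rfl
    | cons b l ih => simp [ih]
  have h := run_forPop (M := M) (Γ₁ := Sym) (σ := Mem k₀) (k := .inl .x) (f := setBit)
    (p := lexBody)
    (fun (g : (LexState × List Bool × List Bool × List Tok) × List Bool) l =>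
      ({ s with q := g.1.1 }, { S with x := l, x' := g.2, al := g.1.2.1, al' := g.1.2.2.1,
                                       tok := g.1.2.2.2 }.stk M))
    (fun g b => (lexStep g.1 b, b :: g.2))
    (fun g => g.1.2.2.1.reverse ++ g.1.2.1 = S.al'.reverse ++ S.al)
    ((S.al'.reverse ++ S.al).length * 3 + 12) (fun g l => rfl)
    (fun g b hg => (lexStep_zip g.1 b).trans hg)
    (fun g b l hg => by
      refine ((run_lexBody { s with q := g.1.1 }
        { S with x := l, x' := g.2, al := g.1.2.1, al' := g.1.2.2.1, tok := g.1.2.2.2 }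
        hs hb b).cast ?_ rfl).mono ?_
      · rw [update_x]
      · have := congrArg List.length hg
        simp only [List.length_append, List.length_reverse] at this ⊢
        omega)
    ((s.q, S.al, S.al', S.tok), S.x') rfl S.x
  rw [hfold, hg] at h
  exact h

/-! #### Evaluation -/

/-- The value of a constant symbol. -/
def valBit : Tok → Option Bool
  | .val b => some b
  | _ => none

/-- The binary operation of a symbol. -/
def binop : Tok → Bool → Bool → Bool
  | .and, a, b => a && b
  | .or, a, b => a || b
  | _, _, _ => false

/-- Apply a symbol to the stack of values. -/
def evBody : Prog Sym M (Mem k₀) :=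
  .seq (.ite (fun s => (valBit s.tk).isSome) (.push (.inl .w) fun s => (valBit s.tk).getD false) <|
    .seq (.pop (.inl .w) fun s o => { s with ob := o, eok := s.eok && o.isSome }) <|
    .seq (.ite (fun s => s.tk == .neg) (.load fun s => { s with bit := !s.ob.getD false })
      (.pop (.inl .w) fun s o => { s with
        eok := s.eok && o.isSome, bit := binop s.tk (s.ob.getD false) (o.getD false) })) <|
    .push (.inl .w) fun s => s.bit)
  (.load fun s => { s with tk := .neg, ob := none, bit := false })

theorem run_evBody (s : Mem k₀) (S : Tapes) (hs : s.ob = none) (hb : s.bit = false)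
    (ht : s.tk = .neg) (t : Tok) :
    Run evBody ({ s with tk := t }, S.stk M)
      ({ s with eok := (evStep (s.eok, S.w) t).1 },
        { S with w := (evStep (s.eok, S.w) t).2 }.stk M) 6 := by
  obtain ⟨ok, ov, ti, eok, carry, bit, zb, ph, ob, q, tk, cnt⟩ := s
  obtain rfl : ob = none := hs
  obtain rfl : bit = false := hb
  obtain rfl : tk = .neg := ht
  obtain ⟨inp, z, z', c, c', x, x', al, al', tok, w, out⟩ := S
  cases t with
  | val b =>
    refine (Run.seq (.ite_true rfl .push) .load).congr ?_ (by norm_num)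
    simp [update_w, Tapes.stk, evStep, valBit]
  | neg =>
    refine (Run.seq (.ite_false rfl (.seq .pop (.seq (.ite_true rfl .load) .push)))
      .load).congr ?_ (by norm_num)
    simp [update_w, Tapes.stk, evStep]
  | and =>
    refine (Run.seq (.ite_false rfl (.seq .pop (.seq (.ite_false rfl .pop) .push)))
      .load).congr ?_ (by norm_num)
    simp [update_w, Tapes.stk, evStep, binop]
  | or =>
    refine (Run.seq (.ite_false rfl (.seq .pop (.seq (.ite_false rfl .pop) .push)))
      .load).congr ?_ (by norm_num)
    simp [update_w, Tapes.stk, evStep, binop]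

/-- Apply all symbols to the stack of values. -/
def evToks : Prog Sym M (Mem k₀) := .forPop (.inl .tok) (fun s t => { s with tk := t }) evBody

theorem run_evToks (s : Mem k₀) (S : Tapes) (hs : s.ob = none) (hb : s.bit = false)
    (ht : s.tk = .neg) (g : Bool × List Bool) (hg : S.tok.foldl evStep (s.eok, S.w) = g) :
    Run evToks (s, S.stk M) ({ s with eok := g.1 }, { S with tok := [], w := g.2 }.stk M)
      (S.tok.length * 7 + 1) := by
  have h := run_forPop (M := M) (Γ₁ := Sym) (σ := Mem k₀) (k := .inl .tok)
    (f := fun s t => { s with tk := t }) (p := evBody)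
    (fun (g : Bool × List Bool) l => ({ s with eok := g.1 }, { S with tok := l, w := g.2 }.stk M))
    evStep (fun _ => True) 6 (fun g l => rfl) (fun _ _ _ => trivial)
    (fun g t l _ => (run_evBody { s with eok := g.1 } { S with tok := l, w := g.2 } hs hb ht
      t).cast (by rw [update_tok]) rfl)
    (s.eok, S.w) trivial S.tok
  rw [hg] at h
  exact h

theorem length_foldl_evStep_le (g : Bool × List Bool) (l : List Tok) :
    (l.foldl evStep g).2.length ≤ g.2.length + l.length := by
  induction l generalizing g with
  | nil => rfl
  | cons t l ih =>
    have h1 : (evStep g t).2.length ≤ g.2.length + 1 := by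
      obtain ⟨ok, w⟩ := g
      cases t <;> simp only [evStep, List.length_cons, List.length_tail] <;> omega
    have := ih (evStep g t)
    rw [List.foldl_cons, List.length_cons]
    omega

/-- Evaluate the formula on stack `x` under the assignment on stack `al`. -/
def eval : Prog Sym M (Mem k₀) :=
  .seq lex <| .seq moveX <| .seq moveAl <| .seq evToks <|
  .seq (.pop (.inl .w) fun s o => { s with eok := s.eok && o == some true }) <|
  .seq (.pop (.inl .w) fun s o => { s with eok := s.eok && o.isNone }) <|
  .seq (.forPop (.inl .w) setBit resetBit) <|
  .load fun s => { s with ti := s.ti && (s.eok && s.q == .start), eok := true, q := .start }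

/-- The state between the iterations of the main loops. -/
def Mem.Idle (s : Mem k₀) : Prop :=
  s.ob = none ∧ s.bit = false ∧ s.tk = .neg ∧ s.q = .start ∧ s.eok = true ∧ s.carry = false

theorem run_clearW (s : Mem k₀) (S : Tapes) (hb : s.bit = false) :
    Run (.forPop (.inl .w) setBit resetBit) (s, S.stk M) (s, { S with w := [] }.stk M)
      (S.w.length * 2 + 1) := by
  have h := run_forPop (M := M) (Γ₁ := Sym) (σ := Mem k₀) (k := .inl .w) (f := setBit)
    (p := resetBit) (fun (_ : Unit) l => (s, { S with w := l }.stk M)) (fun g _ => g)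
    (fun _ => True) 1 (fun g l => rfl) (fun _ _ _ => trivial)
    (fun g γ l _ => Run.load.congr (by simp [update_w, ← hb]) le_rfl) () trivial S.w
  exact h

/-- The quadratic bound reflects that each of the `k` bits may cause a rewinding of an assignment of
length `k`. Both `x` and the assignment are restored, ready for the next round. -/
theorem run_eval (s : Mem k₀) (S : Tapes) (hs : s.Idle) (hx' : S.x' = []) (hal' : S.al' = [])
    (htok : S.tok = []) (hw : S.w = []) {k : ℕ} (hx : S.x.length = k) (hal : S.al.length = k) :
    Run eval (s, S.stk M) ({ s with ti := s.ti && evalCode S.al S.x }, S.stk M)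
      (40 * (k + 1) ^ 2) := by
  obtain ⟨ok, ov, ti, eok, carry, bit, zb, ph, ob, q, tk, cnt⟩ := s
  obtain ⟨rfl, rfl, rfl, rfl, rfl, rfl⟩ : ob = none ∧ bit = false ∧ tk = .neg ∧ q = .start ∧
    eok = true ∧ carry = false := hs
  obtain ⟨inp, z, z', c, c', x, x', al, al', tok, w, out⟩ := S
  simp only at hx' hal' htok hw hx hal ⊢
  subst hx' hal' htok hw
  set g := x.foldl lexStep (.start, al, [], []) with hg
  set r := g.2.2.2.foldl evStep (true, []) with hr
  have h1 := run_lex (M := M) ⟨ok, ov, ti, true, false, false, zb, ph, none, .start, .neg, cnt⟩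
    ⟨inp, z, z', c, c', x, [], al, [], [], [], out⟩ rfl rfl g hg.symm
  have h2 := run_moveX (M := M) ⟨ok, ov, ti, true, false, false, zb, ph, none, g.1, .neg, cnt⟩
    ⟨inp, z, z', c, c', [], x.reverse ++ [], g.2.1, g.2.2.1, g.2.2.2, [], out⟩ rfl
  have hzip : g.2.2.1.reverse ++ g.2.1 = al := foldl_lexStep_zip (.start, al, [], []) x
  have hx2 : (x.reverse ++ []).reverse ++ [] = x := by simp
  simp only [hx2] at h2
  have h3 := run_moveAl (M := M) ⟨ok, ov, ti, true, false, false, zb, ph, none, g.1, .neg, cnt⟩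
    ⟨inp, z, z', c, c', x, [], g.2.1, g.2.2.1, g.2.2.2, [], out⟩ rfl
  simp only [hzip] at h3
  have h4 := run_evToks (M := M) ⟨ok, ov, ti, true, false, false, zb, ph, none, g.1, .neg, cnt⟩
    ⟨inp, z, z', c, c', x, [], al, [], g.2.2.2, [], out⟩ rfl rfl rfl r hr.symm
  have h5 := run_clearW (M := M) ⟨ok, ov, ti, r.1 && r.2.head? == some true && r.2.tail.head?.isNone,
    false, false, zb, ph, none, g.1, .neg, cnt⟩
    ⟨inp, z, z', c, c', x, [], al, [], [], r.2.tail.tail, out⟩ rfl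
  have hlen1 : g.2.2.2.length ≤ k := by
    have := length_foldl_lexStep_le (.start, al, [], []) x
    simpa [hx] using this
  have hlen2 : r.2.length ≤ k := by
    have := length_foldl_evStep_le (true, []) g.2.2.2
    simp only [List.length_nil, zero_add] at this
    exact this.trans hlen1
  have hlen3 : g.2.2.1.length ≤ k := by
    have := congrArg List.length hzip
    simp only [List.length_append, List.length_reverse, hal] at this
    omega
  refine (h1.seq (h2.seq (h3.seq (h4.seq (Run.seq .pop (Run.seq .pop
    (Run.seq (h5.cast ?_ rfl) .load))))))).congr ?_ ?_
  · simp [update_w, Tapes.stk]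
  · simp [evalCode, ← hg, ← hr]
  · simp only [List.length_append, List.length_reverse, List.length_nil, hx, hal,
      List.length_tail, List.reverse_nil, List.nil_append]
    have : 40 * (k + 1) ^ 2 = k * (k * 3 + 13) + (37 * (k * k) + 67 * k + 40) := by ring
    have := Nat.zero_le (k * k)
    omega

end TableMachine

end HardTaut

namespace HardTaut

open Turing

namespace TableMachine

open Prog

variable {M : FinTM2} {k₀ : ℕ}

/-! #### The loops -/

/-- Add the carry to the current bit. -/
abbrev addBit : Prog Sym M (Mem k₀) :=
  .load fun s => { s with carry := s.bit && s.carry, bit := false }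

theorem foldl_addCarry (l l' : List Bool) (c : Bool) :
    l.foldl (fun (g : Bool × List Bool) b => (b && g.1, (b ^^ g.1) :: g.2)) (c, l') =
      ((addCarry c l).2, (addCarry c l).1.reverse ++ l') := by
  induction l generalizing c l' with
  | nil => rfl
  | cons b l ih => simp [ih, addCarry]

/-- Increment the counter on stack `x`. -/
def incX : Prog Sym M (Mem k₀) :=
  .seq (.load fun s => { s with carry := true }) <|
  .seq (.forPop (.inl .x) setBit (.seq (.push (.inl .x') fun s => s.bit ^^ s.carry) addBit)) moveX

/-- Increment the counter on stack `al`. -/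
def incAl : Prog Sym M (Mem k₀) :=
  .seq (.load fun s => { s with carry := true }) <|
  .seq (.forPop (.inl .al) setBit (.seq (.push (.inl .al') fun s => s.bit ^^ s.carry) addBit))
    moveAl

theorem run_incX (s : Mem k₀) (S : Tapes) (hb : s.bit = false) (hx' : S.x' = []) :
    Run incX (s, S.stk M) ({ s with carry := (addCarry true S.x).2 },
      { S with x := (addCarry true S.x).1 }.stk M) (S.x.length * 6 + 3) := by
  have h1 := run_forPop (M := M) (Γ₁ := Sym) (σ := Mem k₀) (k := .inl .x) (f := setBit)
    (p := .seq (.push (.inl .x') fun s => s.bit ^^ s.carry) addBit)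
    (fun (g : Bool × List Bool) l =>
      ({ s with carry := g.1 }, { S with x := l, x' := g.2 }.stk M))
    (fun g b => (b && g.1, (b ^^ g.1) :: g.2)) (fun _ => True) 2 (fun g l => rfl)
    (fun _ _ _ => trivial)
    (fun g γ l _ => (Run.seq .push .load).congr (by
      simp [update_x, update_x', Tapes.stk, ← hb]) le_rfl) (true, S.x') trivial S.x
  rw [foldl_addCarry] at h1
  have h2 := run_moveX (M := M) { s with carry := (addCarry true S.x).2 }
    { S with x := [], x' := (addCarry true S.x).1.reverse ++ S.x' } hb
  refine (Run.seq .load (h1.seq h2)).congr ?_ ?_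
  · simp [hx']
  · simp only [hx', List.append_nil, List.length_reverse, length_addCarry]
    omega

theorem run_incAl (s : Mem k₀) (S : Tapes) (hb : s.bit = false) (hal' : S.al' = []) :
    Run incAl (s, S.stk M) ({ s with carry := (addCarry true S.al).2 },
      { S with al := (addCarry true S.al).1 }.stk M) (S.al.length * 6 + 3) := by
  have h1 := run_forPop (M := M) (Γ₁ := Sym) (σ := Mem k₀) (k := .inl .al) (f := setBit)
    (p := .seq (.push (.inl .al') fun s => s.bit ^^ s.carry) addBit)
    (fun (g : Bool × List Bool) l =>
      ({ s with carry := g.1 }, { S with al := l, al' := g.2 }.stk M))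
    (fun g b => (b && g.1, (b ^^ g.1) :: g.2)) (fun _ => True) 2 (fun g l => rfl)
    (fun _ _ _ => trivial)
    (fun g γ l _ => (Run.seq .push .load).congr (by
      simp [update_al, update_al', Tapes.stk, ← hb]) le_rfl) (true, S.al') trivial S.al
  rw [foldl_addCarry] at h1
  have h2 := run_moveAl (M := M) { s with carry := (addCarry true S.al).2 }
    { S with al := [], al' := (addCarry true S.al).1.reverse ++ S.al' } hb
  refine (Run.seq .load (h1.seq h2)).congr ?_ ?_
  · simp [hal']
  · simp only [hal', List.append_nil, List.length_reverse, length_addCarry]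
    omega

/-- Evaluate the formula under the current assignment, and go to the next assignment. -/
def innerBody : Prog Sym M (Mem k₀) :=
  .seq (.push (.inl .c') fun s => s.bit) <| .seq resetBit <| .seq eval <|
  .seq incAl (.load fun s => { s with carry := false })

/-- A bound for the time of one iteration of the inner loop. -/
def innerTime (k : ℕ) : ℕ := 50 * (k + 1) ^ 2

theorem run_innerBody (s : Mem k₀) (S : Tapes) (hs : s.Idle) (hx' : S.x' = []) (hal' : S.al' = [])
    (htok : S.tok = []) (hw : S.w = []) {k : ℕ} (hx : S.x.length = k) (hal : S.al.length = k)
    (b : Bool) :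
    Run innerBody ({ s with bit := b }, S.stk M)
      ({ s with ti := s.ti && evalCode S.al S.x },
        { S with c' := b :: S.c', al := (addCarry true S.al).1 }.stk M) (innerTime k) := by
  have h1 := run_eval (M := M) s { S with c' := b :: S.c' } hs hx' hal' htok hw hx hal
  have h2 := run_incAl (M := M) { s with ti := s.ti && evalCode S.al S.x }
    { S with c' := b :: S.c' } hs.2.1 hal'
  refine (Run.seq .push (Run.seq .load ((h1.cast ?_ rfl).seq (h2.seq .load)))).congr ?_ ?_
  · simp [update_c', Tapes.stk, ← hs.2.1]
  · simp [← hs.2.2.2.2.2]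
  · simp only [hal, innerTime]
    nlinarith

/-- Evaluate the formula under as many assignments as stack `c` has symbols. -/
def inner : Prog Sym M (Mem k₀) := .seq (.forPop (.inl .c) setBit innerBody) moveC

theorem run_inner (s : Mem k₀) (S : Tapes) (hs : s.Idle) (hc' : S.c' = []) (hx' : S.x' = [])
    (hal' : S.al' = []) (htok : S.tok = []) (hw : S.w = []) {k : ℕ} (hx : S.x.length = k)
    (hal : S.al.length = k) (g : List Bool × Bool)
    (hg : S.c.foldl (innerStep S.x) (S.al, s.ti) = g) :
    Run inner (s, S.stk M) ({ s with ti := g.2 }, { S with al := g.1 }.stk M)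
      (S.c.length * (innerTime k + 4) + 2) := by
  -- The loop data is paired with the symbols already popped, because the clock `c` has to be
  -- rebuilt from `c'` afterwards.
  have hfold (l xs : List Bool) (g : List Bool × Bool) :
      l.foldl (fun (g : (List Bool × Bool) × List Bool) b =>
        (innerStep S.x g.1 b, b :: g.2)) (g, xs) =
        (l.foldl (innerStep S.x) g, l.reverse ++ xs) := by
    induction l generalizing xs g with
    | nil => rfl
    | cons b l ih => simp [ih]
  have h1 := run_forPop (M := M) (Γ₁ := Sym) (σ := Mem k₀) (k := .inl .c) (f := setBit)
    (p := innerBody)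
    (fun (g : (List Bool × Bool) × List Bool) l =>
      ({ s with ti := g.1.2 }, { S with c := l, c' := g.2, al := g.1.1 }.stk M))
    (fun g b => (innerStep S.x g.1 b, b :: g.2))
    (fun g => g.1.1.length = k) (innerTime k) (fun g l => rfl)
    (fun g b hg => by simpa [innerStep, length_addCarry] using hg)
    (fun g b l hg =>
      (run_innerBody { s with ti := g.1.2 } { S with c := l, c' := g.2, al := g.1.1 }
        hs hx' hal' htok hw hx hg b).cast (by rw [update_c]) rfl)
    ((S.al, s.ti), S.c') hal S.c
  rw [hfold, hg] at h1
  have h2 := run_moveC (M := M) { s with ti := g.2 }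
    { S with c := [], c' := S.c.reverse ++ S.c', al := g.1 } hs.2.1
  refine (h1.seq h2).congr ?_ ?_
  · simp [hc']
  · simp only [hc', List.append_nil, List.length_reverse]
    ring_nf
    omega

/-- Check one entry of the table, and go to the next string. -/
def outerBody : Prog Sym M (Mem k₀) :=
  .seq inner <| .seq incX <| .load fun s =>
    { s with ok := s.ok && (s.zb == s.ti) && !s.ov, ov := s.carry, carry := false, ti := true,
             zb := false }

theorem run_outerBody (s : Mem k₀) (S : Tapes) (hs : s.Idle) (hti : s.ti = true)
    (hzb : s.zb = false) (hc' : S.c' = []) (hx' : S.x' = [])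
    (hal' : S.al' = []) (htok : S.tok = []) (hw : S.w = []) {k : ℕ} (hx : S.x.length = k)
    (hal : S.al.length = k) (b : Bool) (g : List Bool × List Bool × Bool × Bool)
    (hg : outerStep S.c (S.x, S.al, s.ok, s.ov) b = g) :
    Run outerBody ({ s with zb := b }, S.stk M)
      ({ s with ok := g.2.2.1, ov := g.2.2.2 }, { S with x := g.1, al := g.2.1 }.stk M)
      (S.c.length * (innerTime k + 4) + k * 6 + 6) := by
  subst hg
  obtain ⟨ok, ov, ti, eok, carry, bit, zb, ph, ob, q, tk, cnt⟩ := s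
  have h1 := run_inner (M := M) ⟨ok, ov, ti, eok, carry, bit, b, ph, ob, q, tk, cnt⟩ S hs hc' hx'
    hal' htok hw hx hal (S.c.foldl (innerStep S.x) (S.al, true)) (by rw [← hti])
  have h2 := run_incX (M := M)
    ⟨ok, ov, (S.c.foldl (innerStep S.x) (S.al, true)).2, eok, carry, bit, b, ph, ob, q, tk, cnt⟩
    { S with al := (S.c.foldl (innerStep S.x) (S.al, true)).1 } hs.2.1 hx'
  obtain rfl : ti = true := hti
  obtain rfl : zb = false := hzb
  obtain rfl : carry = false := hs.2.2.2.2.2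
  refine (h1.seq (h2.seq .load)).congr ?_ ?_
  · simp [outerStep]
  · simp only [hx]
    omega

/-- Check all entries of the table. -/
def outer : Prog Sym M (Mem k₀) := .forPop (.inl .z) (fun s b => { s with zb := b }) outerBody

/-- The lengths of the two counters form the loop invariant; they are returned as well, since they
determine the time for clearing the stacks. -/
theorem run_outer (s : Mem k₀) (S : Tapes) (hs : s.Idle) (hti : s.ti = true)
    (hzb : s.zb = false) (hc' : S.c' = []) (hx' : S.x' = [])
    (hal' : S.al' = []) (htok : S.tok = []) (hw : S.w = []) {k : ℕ} (hx : S.x.length = k)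
    (hal : S.al.length = k) (g : List Bool × List Bool × Bool × Bool)
    (hg : S.z.foldl (outerStep S.c) (S.x, S.al, s.ok, s.ov) = g) :
    Run outer (s, S.stk M)
      ({ s with ok := g.2.2.1, ov := g.2.2.2 }, { S with z := [], x := g.1, al := g.2.1 }.stk M)
      (S.z.length * (S.c.length * (innerTime k + 4) + k * 6 + 7) + 1) ∧
    g.1.length = k ∧ g.2.1.length = k := by
  have hfold (l xs : List Bool) (g : List Bool × Bool) (h : g.1.length = k) :
      (l.foldl (innerStep xs) g).1.length = k := by
    induction l generalizing g with
    | nil => exact h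
    | cons b l ih => exact ih _ (by simpa [innerStep, length_addCarry] using h)
  have hstep (g : List Bool × List Bool × Bool × Bool) (b : Bool)
      (h : g.1.length = k ∧ g.2.1.length = k) :
      (outerStep S.c g b).1.length = k ∧ (outerStep S.c g b).2.1.length = k :=
    ⟨by simpa [outerStep, length_addCarry] using h.1, hfold _ _ _ h.2⟩
  constructor
  · have h1 := run_forPop (M := M) (Γ₁ := Sym) (σ := Mem k₀) (k := .inl .z)
      (f := fun s b => { s with zb := b }) (p := outerBody)
      (fun (g : List Bool × List Bool × Bool × Bool) l =>
        ({ s with ok := g.2.2.1, ov := g.2.2.2 }, { S with z := l, x := g.1, al := g.2.1 }.stk M))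
      (outerStep S.c)
      (fun g => g.1.length = k ∧ g.2.1.length = k)
      (S.c.length * (innerTime k + 4) + k * 6 + 6) (fun g l => rfl) hstep
      (fun g b l hg =>
        (run_outerBody { s with ok := g.2.2.1, ov := g.2.2.2 }
          { S with z := l, x := g.1, al := g.2.1 }
          hs hti hzb hc' hx' hal' htok hw hg.1 hg.2 b _ rfl).cast (by rw [update_z]) rfl)
      (S.x, S.al, s.ok, s.ov) ⟨hx, hal⟩ S.z
    rw [hg] at h1
    exact h1
  · rw [← hg]
    have key (l : List Bool) (g : List Bool × List Bool × Bool × Bool)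
        (h : g.1.length = k ∧ g.2.1.length = k) :
        (l.foldl (outerStep S.c) g).1.length = k ∧ (l.foldl (outerStep S.c) g).2.1.length = k := by
      induction l generalizing g with
      | nil => exact h
      | cons b l ih => exact ih _ (hstep g b h)
    exact key S.z _ ⟨hx, hal⟩

/-! #### Input and output -/

/-- Count up to `k₀`. -/
def satSucc (i : Fin (k₀ + 1)) : Fin (k₀ + 1) := if h : i.1 + 1 < k₀ + 1 then ⟨i.1 + 1, h⟩ else i

theorem val_satSucc (i : Fin (k₀ + 1)) : (satSucc i).1 = min (i.1 + 1) k₀ := by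
  have := i.2
  unfold satSucc
  split_ifs <;> grind

/-- Read the input. -/
def readInput : Prog Sym M (Mem k₀) :=
  .forPop (.inl .inp) (fun s γ => { s with ob := γ }) <|
  .seq (.ite (fun s => s.ob.isNone) (.load fun s => { s with ph := true }) <|
    .ite (fun s => s.ph)
      (.seq (.push (.inl .x) fun _ => false) (.push (.inl .al) fun _ => false)) <|
    .seq (.push (.inl .z') fun s => s.ob.getD false) <|
    .seq (.push (.inl .c) fun s => s.ob.getD false)
      (.load fun s => { s with cnt := satSucc s.cnt }))
  (.load fun s => { s with ob := none })

/-- The effect of reading one symbol. -/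
def readStep : Bool × Fin (k₀ + 1) × List Bool × List Bool → Option Bool →
    Bool × Fin (k₀ + 1) × List Bool × List Bool
  | (_, i, z, x), none => (true, i, z, x)
  | (true, i, z, x), some _ => (true, i, z, false :: x)
  | (false, i, z, x), some b => (false, satSucc i, b :: z, x)

theorem foldl_readStep_x (v z x : List Bool) (i : Fin (k₀ + 1)) :
    (v.map some).foldl readStep (true, i, z, x) =
      (true, i, z, List.replicate v.length false ++ x) := by
  induction v generalizing x with
  | nil => rfl
  | cons b v ih =>
    simp only [List.map_cons, List.foldl_cons, readStep, ih, List.length_cons,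
      List.replicate_succ', List.append_assoc, List.singleton_append]

theorem foldl_readStep_z (z z₀ x : List Bool) (i : Fin (k₀ + 1)) : ∃ j : Fin (k₀ + 1),
    j.1 = min (i.1 + z.length) k₀ ∧
    (z.map some).foldl readStep (false, i, z₀, x) = (false, j, z.reverse ++ z₀, x) := by
  induction z generalizing z₀ i with
  | nil => exact ⟨i, by have := i.2; simp only [List.length_nil, add_zero]; omega, rfl⟩
  | cons b z ih =>
    obtain ⟨j, hj, h⟩ := ih (b :: z₀) (satSucc i)
    refine ⟨j, ?_, by simpa [readStep] using h⟩
    rw [hj, val_satSucc, List.length_cons]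
    omega

theorem foldl_readStep (z v : List Bool) : ∃ j : Fin (k₀ + 1), j.1 = min z.length k₀ ∧
    (encodePair (z, v)).foldl readStep (false, 0, [], []) =
      (true, j, z.reverse, List.replicate v.length false) := by
  obtain ⟨j, hj, h⟩ := foldl_readStep_z (k₀ := k₀) z [] [] 0
  refine ⟨j, by simpa using hj, ?_⟩
  simp only [encodePair, List.foldl_append, h, List.foldl_cons, readStep, foldl_readStep_x,
    List.append_nil]

theorem run_readInput (l : List (Option Bool)) (g : Bool × Fin (k₀ + 1) × List Bool × List Bool)
    (hg : l.foldl readStep (false, 0, [], []) = g) :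
    Run readInput (({} : Mem k₀), { inp := l : Tapes }.stk M)
      (({ ph := g.1, cnt := g.2.1 } : Mem k₀),
        { z' := g.2.2.1, c := g.2.2.1, x := g.2.2.2, al := g.2.2.2 : Tapes }.stk M)
      (l.length * 8 + 1) := by
  subst hg
  refine run_forPop (k := .inl .inp)
    (fun (g : Bool × Fin (k₀ + 1) × List Bool × List Bool) l =>
      (({ ph := g.1, cnt := g.2.1 } : Mem k₀),
        { inp := l, z' := g.2.2.1, c := g.2.2.1, x := g.2.2.2, al := g.2.2.2 : Tapes }.stk M))
    readStep (fun _ => True) 7 (fun g l => rfl) (fun _ _ _ => trivial) ?_ (false, 0, [], [])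
    trivial l
  rintro ⟨ph, i, z, x⟩ γ l -
  simp only [update_inp]
  rcases γ with _ | b
  · exact (Run.seq (.ite_true rfl .load) .load).congr (by simp [readStep]) (by norm_num)
  · cases ph
    · exact (Run.seq (.ite_false rfl (.ite_false rfl (.seq .push (.seq .push .load))))
        .load).congr (by simp [update_z', update_c, Tapes.stk, readStep]) (by norm_num)
    · exact (Run.seq (.ite_false rfl (.ite_true rfl (.seq .push .push)))
        .load).congr (by simp [update_x, update_al, Tapes.stk, readStep]) (by norm_num)

/-- Empty the stacks and write the result. -/
def finish : Prog Sym M (Mem k₀) :=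
  .seq (.forPop (.inl .c) setBit resetBit) <|
  .seq (.forPop (.inl .x) setBit resetBit) <|
  .seq (.forPop (.inl .al) setBit resetBit) <|
  .push (.inl .out) fun s => (s.ok && s.ov) && s.cnt == Fin.last k₀

theorem run_finish (s : Mem k₀) (c x al : List Bool) (hb : s.bit = false) :
    Run finish (s, { c := c, x := x, al := al : Tapes }.stk M)
      (s, { out := [(s.ok && s.ov) && s.cnt == Fin.last k₀] : Tapes }.stk M)
      ((c.length + x.length + al.length) * 2 + 4) := by
  have h1 := run_forPop (M := M) (Γ₁ := Sym) (σ := Mem k₀) (k := .inl .c) (f := setBit)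
    (p := resetBit) (fun (_ : Unit) l => (s, { c := l, x := x, al := al : Tapes }.stk M))
    (fun g _ => g) (fun _ => True) 1 (fun g l => rfl) (fun _ _ _ => trivial)
    (fun g γ l _ => Run.load.congr (by simp [update_c, ← hb]) le_rfl) () trivial c
  have h2 := run_forPop (M := M) (Γ₁ := Sym) (σ := Mem k₀) (k := .inl .x) (f := setBit)
    (p := resetBit) (fun (_ : Unit) l => (s, { x := l, al := al : Tapes }.stk M))
    (fun g _ => g) (fun _ => True) 1 (fun g l => rfl) (fun _ _ _ => trivial)
    (fun g γ l _ => Run.load.congr (by simp [update_x, ← hb]) le_rfl) () trivial x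
  have h3 := run_forPop (M := M) (Γ₁ := Sym) (σ := Mem k₀) (k := .inl .al) (f := setBit)
    (p := resetBit) (fun (_ : Unit) l => (s, { al := l : Tapes }.stk M))
    (fun g _ => g) (fun _ => True) 1 (fun g l => rfl) (fun _ _ _ => trivial)
    (fun g γ l _ => Run.load.congr (by simp [update_al, ← hb]) le_rfl) () trivial al
  exact (h1.seq (h2.seq (h3.seq .push))).congr (by simp [update_out, Tapes.stk]) (by omega)

end TableMachine

open scoped Classical in
/-- The relation `z` is the truth table of the set of tautologies of size `|v|`, and `|z| ≥ k₀`. -/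
noncomputable def tableRel (k₀ : ℕ) (z v : List Bool) : Bool :=
  decide (z = tautTable v.length ∧ k₀ ≤ z.length)

-- Brute force: `|z|` entries times `|z|` assignments, each with an evaluation quadratic in `k`, is
-- polynomial in the input. The second string only supplies `k` in unary, and the condition on `k₀`
-- is read off a saturating counter.
open TableMachine Prog in
theorem polyTimeRel_tableRel (k₀ : ℕ) : PolyTimeRel (tableRel k₀) := by
  refine polyTime_of_run (M := default) (Γ₁ := Sym) (σ := Mem k₀)
    (.seq readInput <| .seq moveZ <| .seq outer finish) {} .inp .out (Equiv.refl _) (Equiv.refl _)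
    (200 * (.X + 1) ^ 4) ?_
  rintro ⟨z, v⟩
  obtain ⟨j, hj, hread⟩ := foldl_readStep (k₀ := k₀) z v
  have h1 := run_readInput (M := default) _ _ hread
  have h2 := run_moveZ (M := default) ({ ph := true, cnt := j } : Mem k₀)
    { z' := z.reverse, c := z.reverse, x := List.replicate v.length false,
      al := List.replicate v.length false } rfl
  simp only [List.reverse_reverse, List.append_nil] at h2
  obtain ⟨g, hg⟩ : ∃ g, z.foldl (outerStep z.reverse) (List.replicate v.length false,
      List.replicate v.length false, true, false) = g := ⟨_, rfl⟩
  obtain ⟨h3, hx, hal⟩ := run_outer (M := default) ({ ph := true, cnt := j } : Mem k₀)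
    { z := z, c := z.reverse, x := List.replicate v.length false,
      al := List.replicate v.length false } ⟨rfl, rfl, rfl, rfl, rfl, rfl⟩ rfl rfl rfl rfl rfl rfl
    rfl (k := v.length) (by simp) (by simp) g hg
  have h4 := run_finish (M := default)
    ({ ok := g.2.2.1, ov := g.2.2.2, ph := true, cnt := j } : Mem k₀) z.reverse g.1 g.2.1 rfl
  have hres : (g.2.2.1 && g.2.2.2 && j == Fin.last k₀) = tableRel k₀ z v := by
    rw [Bool.eq_iff_iff, Bool.and_eq_true, ← hg, foldl_outerStep_iff _ _ _ (by simp), tableRel,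
      decide_eq_true_iff, beq_iff_eq, Fin.ext_iff, hj, Fin.val_last, min_eq_right_iff]
  have hfirst : single default .inp (encodePair (z, v)) =
      { inp := encodePair (z, v) : Tapes }.stk default := by
    rw [← update_inp {}]
    funext k
    rcases k with k | k
    · cases k <;> rfl
    · rfl
  have hlast (b : Bool) : single default .out [b] = { out := [b] : Tapes }.stk default := by
    rw [← update_out {}]
    funext k
    rcases k with k | k
    · cases k <;> rfl
    · rfl
  simp only [Equiv.refl_symm, Equiv.coe_refl, List.map_id, hfirst]
  refine ⟨{ ok := g.2.2.1, ov := g.2.2.2, ph := true, cnt := j },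
    (h1.seq (h2.seq (h3.seq h4))).congr ?_ ?_⟩
  · dsimp only
    rw [hres]
    exact congrArg _ (hlast _).symm
  · set T := (encodePair (z, v)).length + 1 with hT
    have hlen : T = z.length + v.length + 2 := by
      simp [hT, encodePair]
      omega
    have hk : v.length + 1 ≤ T := by omega
    have hm : z.length ≤ T := by omega
    have h1T : 1 ≤ T := by omega
    calc _ = (encodePair (z, v)).length * 8 + 1 + (z.length * 3 + 1 +
          (z.length * (z.length * (50 * (v.length + 1) ^ 2 + 4) + v.length * 6 + 7) + 1 +
            ((z.length + v.length + v.length) * 2 + 4))) := by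
            simp only [List.length_reverse, hx, hal, innerTime]
      _ ≤ T * 8 + 1 + (T * 3 + 1 + (T * (T * (50 * T ^ 2 + 4) + T * 6 + 7) + 1 +
            ((T + T + T) * 2 + 4))) := by
            gcongr <;> omega
      _ = 50 * T ^ 4 + 10 * T ^ 2 + 24 * T + 7 := by ring
      _ ≤ 50 * T ^ 4 + 10 * T ^ 4 + 24 * T ^ 4 + 7 * T ^ 4 := by
            have h2 : T ^ 2 ≤ T ^ 4 := Nat.pow_le_pow_right h1T (by norm_num)
            have h3 : T ≤ T ^ 4 := Nat.le_self_pow (by norm_num) T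
            omega
      _ ≤ _ := by
            simp only [Polynomial.eval_mul, Polynomial.eval_pow, Polynomial.eval_add,
              Polynomial.eval_X, Polynomial.eval_one, Polynomial.eval_ofNat, ← hT]
            omega

end HardTaut

namespace HardTaut

/-! ### The Goldreich–Levin decoder -/

section Decoder

variable {V Y : Type*} [AddCommGroup V]

/-- `±1` instead of `0/1`. -/
def sgn (b : Bool) : ℝ := if b then -1 else 1

theorem sgn_xor (a b : Bool) : sgn (a ^^ b) = sgn a * sgn b := by
  cases a <;> cases b <;> simp [sgn]

theorem abs_sgn (a : Bool) : |sgn a| = 1 := by cases a <;> simp [sgn]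

/-- The bits guessed for the secret `y`, by a majority vote. -/
def vote {n q : ℕ} (B : V → Bool) (e : Fin n → V) (r : Fin q → V) (b : Finset (Fin q) → Bool)
    (i : Fin n) : Bool :=
  decide (2 ^ q < 2 * (Finset.univ.filter fun s : Finset (Fin q) =>
    (b s ^^ B (∑ j ∈ s, r j + e i)) = true).card)

/-- A positive sum of signs says that a strict majority of the votes equals `a`. Strictness excludes
ties, which `vote` would resolve as `false`. -/
theorem vote_eq {n q : ℕ} (B : V → Bool) (e : Fin n → V) (r : Fin q → V) (b : Finset (Fin q) → Bool)
    (i : Fin n) (a : Bool)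
    (h : 0 < ∑ s : Finset (Fin q), sgn (a ^^ (b s ^^ B (∑ j ∈ s, r j + e i)))) :
    vote B e r b i = a := by
  have h1 : ∑ s : Finset (Fin q), sgn (b s ^^ B (∑ j ∈ s, r j + e i)) =
      2 ^ q - 2 * ((Finset.univ.filter fun s : Finset (Fin q) =>
        (b s ^^ B (∑ j ∈ s, r j + e i)) = true).card : ℝ) := by
    have h2 (c : Bool) : sgn c = 1 - 2 * (if c = true then 1 else 0) := by
      cases c <;> simp [sgn]; norm_num
    simp_rw [h2 (_ ^^ _), Finset.sum_sub_distrib, ← Finset.mul_sum, Finset.sum_boole]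
    simp
  simp_rw [sgn_xor a, ← Finset.mul_sum, h1] at h
  cases a
  · simp only [sgn, Bool.false_eq_true, if_false, one_mul, sub_pos] at h
    rw [vote, decide_eq_false_iff_not, not_lt]
    exact_mod_cast h.le
  · simp only [sgn, if_true, neg_mul, one_mul, neg_sub, sub_pos] at h
    rw [vote, decide_eq_true_iff]
    exact_mod_cast h

variable [Fintype V]

/-- Pairwise independence of subset sums: translating `r j` by `v` moves the sum over `s` and fixes
the sum over `t`. Averaging over `v` replaces `G` by its mean, which is zero. -/
theorem sum_mul_subsetSum_eq_zero {q : ℕ} {G H : V → ℝ} (hG : ∑ v, G v = 0) {s t : Finset (Fin q)}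
    {j : Fin q} (hs : j ∈ s) (ht : j ∉ t) :
    ∑ r : Fin q → V, G (∑ j ∈ s, r j) * H (∑ j ∈ t, r j) = 0 := by
  have key (v : V) : ∑ r : Fin q → V, G (∑ j ∈ s, r j) * H (∑ j ∈ t, r j) =
      ∑ r : Fin q → V, G ((∑ j ∈ s, r j) + v) * H (∑ j ∈ t, r j) := by
    rw [← Equiv.sum_comp (Equiv.addRight (Pi.single j v : Fin q → V))]
    refine Finset.sum_congr rfl fun r _ => ?_
    have h1 : ∑ i ∈ s, (r + Pi.single j v : Fin q → V) i = ∑ i ∈ s, r i + v := by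
      simp [Finset.sum_add_distrib, Finset.sum_pi_single', hs]
    have h2 : ∑ i ∈ t, (r + Pi.single j v : Fin q → V) i = ∑ i ∈ t, r i := by
      simp [Finset.sum_add_distrib, Finset.sum_pi_single', ht]
    simp only [Equiv.coe_addRight, h1, h2]
  have h : (Fintype.card V : ℝ) * ∑ r : Fin q → V, G (∑ j ∈ s, r j) * H (∑ j ∈ t, r j) = 0 := by
    rw [← nsmul_eq_mul, ← Finset.card_univ, ← Finset.sum_const, Finset.sum_congr rfl fun v _ => key v,
      Finset.sum_comm]
    refine Finset.sum_eq_zero fun r _ => ?_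
    rw [← Finset.sum_mul, show ∑ v, G (∑ j ∈ s, r j + v) = ∑ v, G v from
      Equiv.sum_comp (Equiv.addLeft (∑ j ∈ s, r j)) G, hG, zero_mul]
  exact (mul_eq_zero.1 h).resolve_left (by simp)

/-- The cross terms of the second moment vanish by pairwise independence, leaving the `2 ^ q`
diagonal ones. -/
theorem sum_sq_sum_subsetSum_le {q : ℕ} {G : V → ℝ} (hG : ∑ v, G v = 0) {c : ℝ}
    (hc : ∀ v, G v * G v ≤ c) :
    ∑ r : Fin q → V, (∑ s : Finset (Fin q), G (∑ j ∈ s, r j)) ^ 2 ≤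
      2 ^ q * c * Fintype.card (Fin q → V) := by
  have hst (s t : Finset (Fin q)) :
      ∑ r : Fin q → V, G (∑ j ∈ s, r j) * G (∑ j ∈ t, r j) ≤
        if s = t then c * Fintype.card (Fin q → V) else 0 := by
    split_ifs with h
    · subst h
      refine (Finset.sum_le_sum fun r _ => hc _).trans_eq ?_
      rw [Finset.sum_const, Finset.card_univ, nsmul_eq_mul, mul_comm]
    · have : ∃ j, (j ∈ s ∧ j ∉ t) ∨ (j ∈ t ∧ j ∉ s) := by
        by_contra! h'
        exact h (Finset.ext fun j => ⟨(h' j).1, (h' j).2⟩)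
      obtain ⟨j, ⟨h1, h2⟩ | ⟨h1, h2⟩⟩ := this
      · exact (sum_mul_subsetSum_eq_zero hG h1 h2).le
      · simp_rw [mul_comm (G (∑ j ∈ s, _))]
        exact (sum_mul_subsetSum_eq_zero hG h1 h2).le
  calc _ = ∑ s, ∑ t, ∑ r : Fin q → V, G (∑ j ∈ s, r j) * G (∑ j ∈ t, r j) := by
        simp_rw [sq, Finset.sum_mul_sum]
        rw [Finset.sum_comm]
        exact Finset.sum_congr rfl fun s _ => Finset.sum_comm
    _ ≤ ∑ s : Finset (Fin q), ∑ t : Finset (Fin q),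
          if s = t then c * Fintype.card (Fin q → V) else 0 :=
        Finset.sum_le_sum fun s _ => Finset.sum_le_sum fun t _ => hst s t
    _ = _ := by
        simp [mul_assoc]

-- Chebyshev's inequality: a nonpositive sum deviates from its mean `2 ^ q * μ` by at least that
-- mean.
open scoped Classical in
theorem card_sum_subsetSum_nonpos_le {q : ℕ} {g : V → ℝ} {μ : ℝ} (hμ : 0 < μ) (hμ1 : μ ≤ 1)
    (hg : ∑ v, g v = μ * Fintype.card V) (hg1 : ∀ v, |g v| ≤ 1) :
    ((Finset.univ.filter fun r : Fin q → V => ∑ s : Finset (Fin q), g (∑ j ∈ s, r j) ≤ 0).card : ℝ) *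
      (2 ^ q * μ ^ 2) ≤ 4 * Fintype.card (Fin q → V) := by
  -- The constant `4` comes from `|g v - μ| ≤ 2`.
  have h := sum_sq_sum_subsetSum_le (q := q) (G := fun v => g v - μ) (c := 4)
    (by simp [Finset.sum_sub_distrib, hg, mul_comm]) fun v => by
      have := abs_le.1 (hg1 v)
      nlinarith
  have h2 : ∀ r ∈ Finset.univ.filter fun r : Fin q → V =>
      ∑ s : Finset (Fin q), g (∑ j ∈ s, r j) ≤ 0,
      (2 ^ q * μ) ^ 2 ≤ (∑ s : Finset (Fin q), (g (∑ j ∈ s, r j) - μ)) ^ 2 := fun r hr => by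
    have hr := (Finset.mem_filter.1 hr).2
    have : ∑ s : Finset (Fin q), (g (∑ j ∈ s, r j) - μ) =
        ∑ s : Finset (Fin q), g (∑ j ∈ s, r j) - 2 ^ q * μ := by
      simp [Finset.sum_sub_distrib]
    have h0 : (0 : ℝ) < 2 ^ q * μ := by positivity
    rw [this]
    nlinarith
  have h3 := Finset.card_nsmul_le_sum _ _ _ h2
  have h4 := h3.trans ((Finset.sum_le_univ_sum_of_nonneg fun r => sq_nonneg _).trans h)
  rw [nsmul_eq_mul] at h4
  have h0 : (0 : ℝ) < 2 ^ q := by positivity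
  refine le_of_mul_le_mul_left ?_ h0
  nlinarith

-- Given the true values of `L` at the subset sums, linearity turns each vote for `i` into a test of
-- `B` against `L` at a translated sum. By Chebyshev the majority for one `i` fails for at most a
-- fraction `1 / (2n)` of the `r`, and a union bound leaves half of them.
open scoped Classical in
theorem card_le_two_mul_card_vote {n q : ℕ} (B L : V → Bool) (hL : ∀ u v, L (u + v) = (L u ^^ L v))
    (e : Fin n → V) {μ : ℝ} (hμ : 0 < μ)
    (hB : ∑ v, sgn (L v ^^ B v) = μ * Fintype.card V) (hq : 8 * n ≤ 2 ^ q * μ ^ 2) :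
    Fintype.card (Fin q → V) ≤ 2 * (Finset.univ.filter fun r : Fin q → V =>
      ∀ i, vote B e r (fun s => L (∑ j ∈ s, r j)) i = L (e i)).card := by
  have hV : (0 : ℝ) < Fintype.card V := by exact_mod_cast Fintype.card_pos
  have hμ1 : μ ≤ 1 := by
    have h1 : ∑ v, sgn (L v ^^ B v) ≤ ∑ _v : V, (1 : ℝ) :=
      Finset.sum_le_sum fun v _ => (le_abs_self _).trans (abs_sgn _).le
    rw [hB, Finset.sum_const, nsmul_eq_mul, mul_one, Finset.card_univ] at h1
    exact (mul_le_iff_le_one_left hV).1 h1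
  set bad : Fin n → Finset (Fin q → V) := fun i => Finset.univ.filter fun r : Fin q → V =>
    ∑ s : Finset (Fin q), sgn (L (∑ j ∈ s, r j + e i) ^^ B (∑ j ∈ s, r j + e i)) ≤ 0
  have hbad (i : Fin n) : ((bad i).card : ℝ) * (2 ^ q * μ ^ 2) ≤ 4 * Fintype.card (Fin q → V) :=
    card_sum_subsetSum_nonpos_le (g := fun v => sgn (L (v + e i) ^^ B (v + e i))) hμ hμ1
      (by rw [← hB]; exact Equiv.sum_comp (Equiv.addRight (e i)) fun v => sgn (L v ^^ B v))
      fun v => (abs_sgn _).le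
  set good := Finset.univ.filter fun r : Fin q → V =>
      ∀ i, vote B e r (fun s => L (∑ j ∈ s, r j)) i = L (e i)
  have hgood : Finset.univ ⊆ good ∪ Finset.univ.biUnion bad := fun r _ => by
    by_contra h
    simp only [Finset.mem_union, Finset.mem_biUnion, not_or, not_exists, good, bad,
      Finset.mem_filter, Finset.mem_univ, true_and, not_le] at h
    refine h.1 fun i => vote_eq _ _ _ _ _ _ ?_
    refine (h.2 i).trans_eq (Finset.sum_congr rfl fun s _ => ?_)
    rw [hL, ← Bool.xor_assoc, Bool.xor_comm (L (e i))]
  have h1 : (Fintype.card (Fin q → V) : ℝ) ≤ good.card + ∑ i, ((bad i).card : ℝ) := by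
    exact_mod_cast (Finset.card_le_card hgood).trans
      ((Finset.card_union_le _ _).trans (Nat.add_le_add_left Finset.card_biUnion_le _))
  have h2 : (∑ i, ((bad i).card : ℝ)) * (2 ^ q * μ ^ 2) ≤ n * (4 * Fintype.card (Fin q → V)) := by
    rw [Finset.sum_mul]
    refine (Finset.sum_le_sum fun i _ => hbad i).trans_eq ?_
    simp
  have h3 : (0 : ℝ) < 2 ^ q * μ ^ 2 := by positivity
  have h4 : 2 * (∑ i, ((bad i).card : ℝ)) ≤ Fintype.card (Fin q → V) := by
    refine le_of_mul_le_mul_right ?_ h3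
    have := mul_le_mul_of_nonneg_right hq (Nat.cast_nonneg (α := ℝ) (Fintype.card (Fin q → V)))
    nlinarith
  have h5 : (Fintype.card (Fin q → V) : ℝ) ≤ 2 * good.card := by linarith
  exact_mod_cast h5

open scoped Classical in
/-- A predictor of the linear forms `L y` with advantage `ε` can be turned into a decoder with
hard-wired advice, which finds the values of `L y` at the `e i` with probability `ε / 2 ^ (q + 2)`. -/
theorem exists_vote {n q : ℕ} [Fintype Y] (B L : Y → V → Bool)
    (hL : ∀ y u v, L y (u + v) = (L y u ^^ L y v)) (e : Fin n → V) {ε : ℝ} (hε : 0 < ε)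
    (hB : ε * (Fintype.card Y * Fintype.card V) ≤ ∑ y, ∑ v, sgn (L y v ^^ B y v))
    (hq : 32 * n ≤ 2 ^ q * ε ^ 2) :
    ∃ (r : Fin q → V) (b : Finset (Fin q) → Bool), ε * Fintype.card Y ≤ 4 * 2 ^ q *
      (Finset.univ.filter fun y => ∀ i, vote (B y) e r b i = L y (e i)).card := by
  have hV : (0 : ℝ) < Fintype.card V := by exact_mod_cast Fintype.card_pos
  -- Averaging: at least a fraction `ε / 2` of the `y` have advantage at least `ε / 2` of their own.
  -- With this smaller advantage the requirement `8 * n ≤ 2 ^ q * μ ^ 2` becomes `32 * n ≤ 2 ^ q * ε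
  -- ^ 2`.
  set heavy : Finset Y := Finset.univ.filter fun y =>
    ε / 2 * Fintype.card V ≤ ∑ v, sgn (L y v ^^ B y v)
  have hheavy : ε / 2 * Fintype.card Y ≤ heavy.card := by
    have h1 : ∑ y, ∑ v, sgn (L y v ^^ B y v) ≤
        ∑ y, ((if y ∈ heavy then (Fintype.card V : ℝ) else 0) + ε / 2 * Fintype.card V) := by
      refine Finset.sum_le_sum fun y _ => ?_
      split_ifs with h
      · have h2 : ∑ v, sgn (L y v ^^ B y v) ≤ ∑ _v : V, (1 : ℝ) :=
          Finset.sum_le_sum fun v _ => (le_abs_self _).trans (abs_sgn _).le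
        rw [Finset.sum_const, nsmul_eq_mul, mul_one, Finset.card_univ] at h2
        have : 0 ≤ ε / 2 * Fintype.card V := by positivity
        linarith
      · simp only [heavy, Finset.mem_filter, Finset.mem_univ, true_and, not_le] at h
        linarith
    rw [Finset.sum_add_distrib, Finset.sum_ite_mem, Finset.univ_inter, Finset.sum_const,
      Finset.sum_const, nsmul_eq_mul, nsmul_eq_mul, Finset.card_univ] at h1
    refine le_of_mul_le_mul_right ?_ hV
    linarith
  set R := Fin q → V
  have hcard (y : Y) (hy : y ∈ heavy) : Fintype.card R ≤ 2 * (Finset.univ.filter fun r : R =>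
      ∀ i, vote (B y) e r (fun s => L y (∑ j ∈ s, r j)) i = L y (e i)).card := by
    have hy := (Finset.mem_filter.1 hy).2
    have h1 : ε / 2 ≤ (∑ v, sgn (L y v ^^ B y v)) / Fintype.card V := (le_div_iff₀ hV).2 hy
    refine card_le_two_mul_card_vote (B y) (L y) (hL y) e
      (μ := (∑ v, sgn (L y v ^^ B y v)) / Fintype.card V) (by linarith) (by field_simp) ?_
    have h2 : (ε / 2) ^ 2 ≤ ((∑ v, sgn (L y v ^^ B y v)) / Fintype.card V) ^ 2 := by gcongr
    have h3 : (0 : ℝ) < 2 ^ q := by positivity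
    nlinarith
  have hL0 (y : Y) : L y 0 = false := by
    have := hL y 0 0
    rwa [add_zero, Bool.xor_self] at this
  -- the advice consists of `q` points and of the values of `L y` there
  set adv : R → (Fin q → Bool) → Finset (Fin q) → Bool := fun r β s =>
    (s.toList.map β).foldr xor false
  have hadv (r : R) (y : Y) : adv r (fun j => L y (r j)) = fun s => L y (∑ j ∈ s, r j) := by
    funext s
    rw [← Finset.sum_map_toList]
    simp only [adv]
    induction s.toList with
    | nil => simp [hL0]
    | cons a l ih => simp [hL, ih]
  -- Double counting of pairs of advice and decoded `y`: each heavy `y` is decoded by half of the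
  -- points `r` together with its true values there. If every one of the `2 ^ q * |R|` pieces of
  -- advice did badly, the total would be too small.
  by_contra! hcon
  have h1 : (∑ r : R, ∑ β : Fin q → Bool, (Finset.univ.filter fun y =>
      ∀ i, vote (B y) e r (adv r β) i = L y (e i)).card : ℝ) * (4 * 2 ^ q) <
        Fintype.card R * (2 ^ q * (ε * Fintype.card Y)) := by
    have hne : (Finset.univ : Finset R).Nonempty := Finset.univ_nonempty
    have hne' : (Finset.univ : Finset (Fin q → Bool)).Nonempty := Finset.univ_nonempty
    have := Finset.sum_lt_sum_of_nonempty hne fun (r : R) _ =>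
      Finset.sum_lt_sum_of_nonempty hne' fun (β : Fin q → Bool) _ => hcon r (adv r β)
    simpa [Finset.sum_const, ← Finset.mul_sum, mul_comm, mul_assoc, mul_left_comm] using this
  have h2 : heavy.card * Fintype.card R ≤ 2 * ∑ r : R, ∑ β : Fin q → Bool,
      (Finset.univ.filter fun y => ∀ i, vote (B y) e r (adv r β) i = L y (e i)).card := by
    calc _ ≤ ∑ y ∈ heavy, 2 * (Finset.univ.filter fun r : R =>
          ∀ i, vote (B y) e r (fun s => L y (∑ j ∈ s, r j)) i = L y (e i)).card := by
            rw [← smul_eq_mul]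
            exact Finset.card_nsmul_le_sum _ _ _ hcard
      _ ≤ 2 * ∑ y, (Finset.univ.filter fun r : R =>
          ∀ i, vote (B y) e r (fun s => L y (∑ j ∈ s, r j)) i = L y (e i)).card := by
            rw [← Finset.mul_sum]
            exact Nat.mul_le_mul_left _ (Finset.sum_le_univ_sum_of_nonneg fun _ => Nat.zero_le _)
      _ = 2 * ∑ r : R, (Finset.univ.filter fun y : Y =>
          ∀ i, vote (B y) e r (fun s => L y (∑ j ∈ s, r j)) i = L y (e i)).card := by
            simp_rw [Finset.card_filter]
            rw [Finset.sum_comm]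
      _ ≤ _ := by
            refine Nat.mul_le_mul_left _ (Finset.sum_le_sum fun r _ => ?_)
            have hsub : (Finset.univ.filter fun y : Y =>
                ∀ i, vote (B y) e r (fun s => L y (∑ j ∈ s, r j)) i = L y (e i)) ⊆
                Finset.univ.biUnion fun β : Fin q → Bool => Finset.univ.filter fun y =>
                  ∀ i, vote (B y) e r (adv r β) i = L y (e i) := fun y hy => by
              refine Finset.mem_biUnion.2 ⟨fun j => L y (r j), Finset.mem_univ _, ?_⟩
              rw [Finset.mem_filter, hadv]
              exact Finset.mem_filter.1 hy
            exact (Finset.card_le_card hsub).trans Finset.card_biUnion_le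
  have h3 : (heavy.card : ℝ) * Fintype.card R ≤ 2 * ∑ r : R, ∑ β : Fin q → Bool,
      ((Finset.univ.filter fun y => ∀ i, vote (B y) e r (adv r β) i = L y (e i)).card : ℝ) := by
    exact_mod_cast h2
  have h4 : (0 : ℝ) < 2 ^ q := by positivity
  have h5 := mul_le_mul_of_nonneg_right hheavy (Nat.cast_nonneg (α := ℝ) (Fintype.card R))
  have h6 := mul_le_mul_of_nonneg_right (h5.trans h3) h4.le
  nlinarith

end Decoder

end HardTaut

namespace HardTaut

/-! ### A circuit for the decoder -/

namespace Derives

variable {n c : ℕ} {𝓕 : Set ((Fin n → Bool) → Bool)}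

/-- Counting in unary how many of the available functions take the value true. -/
theorem le_countP (l : List ((Fin n → Bool) → Bool)) (hl : ∀ f ∈ l, f ∈ 𝓕) (m : ℕ) :
    Derives (2 * (m + 1) * (l.length + 1)) 𝓕
      (Set.range fun (t : Fin (m + 1)) x => decide (t.1 ≤ l.countP fun f => f x)) := by
  induction l with
  | nil =>
    refine (Derives.range (c := 1) fun t : Fin (m + 1) => ?_).mono_cost ?_
    · exact (const (decide (t.1 ≤ 0))).congr fun x => by simp
    · simp only [Fintype.card_fin, List.length_nil]
      omega
  | cons f l ih =>
    refine ((ih fun g hg => hl g (List.mem_cons_of_mem _ hg)).trans_right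
      (Derives.range (c := 2) (κ := Fin (m + 1)) fun t => ?_)).mono_cost (c₂ := _) ?_
    · have hmem (t' : ℕ) (ht' : t' < m + 1) : Derives 0 (𝓕 ∪ Set.range
          fun (t : Fin (m + 1)) (x : Fin n → Bool) => decide (t.1 ≤ l.countP fun f => f x))
          {fun x => decide (t' ≤ l.countP fun f => f x)} :=
        of_mem (Or.inr ⟨⟨t', ht'⟩, rfl⟩)
      have hf : Derives 0 (𝓕 ∪ Set.range
          fun (t : Fin (m + 1)) (x : Fin n → Bool) => decide (t.1 ≤ l.countP fun f => f x)) {f} :=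
        of_mem (Or.inl (hl f List.mem_cons_self))
      refine ((hmem t t.2).or (hf.and (hmem (t - 1) (by omega)))).congr fun x => ?_
      rw [List.countP_cons, Bool.eq_iff_iff]
      cases f x <;> simp
      omega
    · simp only [Fintype.card_fin, List.length_cons]
      ring_nf
      omega

/-- The points `r` and the guesses `b` are constants of the circuit. Each output bit takes `2 ^ q`
queries to `B` and a comparison of a unary count with a threshold. -/
theorem vote {V : Type*} [AddCommGroup V] {k q : ℕ} (B : (Fin n → Bool) → V → Bool)
    (hB : ∀ v, Derives c 𝓕 {fun x => B x v}) (e : Fin k → V) (r : Fin q → V)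
    (b : Finset (Fin q) → Bool) :
    Derives (k * (2 ^ q * (c + 1) + 2 * (2 ^ q + 2) * (2 ^ q + 1))) 𝓕
      (Set.range fun i x => HardTaut.vote (B x) e r b i) := by
  refine (Derives.range (c := 2 ^ q * (c + 1) + 2 * (2 ^ q + 2) * (2 ^ q + 1))
    fun i : Fin k => ?_).mono_cost (by simp)
  have h1 : Derives (2 ^ q * (c + 1)) 𝓕 (Set.range fun (s : Finset (Fin q)) x =>
      b s ^^ B x (∑ j ∈ s, r j + e i)) := by
    refine (Derives.range (c := c + 1) fun s => ?_).mono_cost (by simp)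
    cases b s
    · exact ((hB (∑ j ∈ s, r j + e i)).congr fun x => by simp).mono_cost (Nat.le_succ _)
    · exact (hB (∑ j ∈ s, r j + e i)).not.congr fun x => by simp
  have h2 := le_countP (𝓕 := Set.range fun (s : Finset (Fin q)) x =>
      b s ^^ B x (∑ j ∈ s, r j + e i))
    (Finset.univ.toList.map fun (s : Finset (Fin q)) x => b s ^^ B x (∑ j ∈ s, r j + e i))
    (by simp) (2 ^ q + 1)
  -- A strict majority among `2 ^ q` votes means at least `2 ^ q / 2 + 1` of them.
  refine (h1.trans_of_right (h2.mono le_rfl subset_rfl (Set.singleton_subset_iff.2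
    ⟨⟨2 ^ q / 2 + 1, by have := Nat.div_le_self (2 ^ q) 2; omega⟩, ?_⟩))).mono_cost (by simp)
  funext x
  have h3 : (Finset.univ.filter fun s : Finset (Fin q) =>
      (b s ^^ B x (∑ j ∈ s, r j + e i)) = true).card =
      Finset.univ.toList.countP fun s => b s ^^ B x (∑ j ∈ s, r j + e i) := by
    rw [Finset.card, Finset.filter_val, ← Multiset.countP_eq_card_filter, ← Finset.coe_toList,
      Multiset.coe_countP]
    exact List.countP_congr fun s _ => by simp
  simp only [HardTaut.vote, decide_eq_decide, List.countP_map, h3]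
  exact ⟨fun h => by simp only [Function.comp_def] at h; omega,
    fun h => by simp only [Function.comp_def]; omega⟩

end Derives

/-! ### The hard-core bit on fixed lengths -/

theorem getElem?_deinterleave : ∀ (u : List Bool) (i : ℕ),
    (deinterleave u).1[i]? = u[2 * i]? ∧ (deinterleave u).2[i]? = u[2 * i + 1]?
  | a :: b :: l, 0 => by simp [deinterleave]
  | a :: b :: l, i + 1 => by
    have := getElem?_deinterleave l i
    simpa [deinterleave, Nat.mul_add] using this
  | [a], i => by cases i <;> simp [deinterleave, Nat.mul_add]
  | [], i => by simp [deinterleave]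

/-- A string of length `ℓ` as a pair of strings of half the length, at the even and at the odd
positions. -/
def interleaveEquiv (ℓ : ℕ) :
    (Fin (ℓ / 2) → Bool) × (Fin ((ℓ + 1) / 2) → Bool) ≃ (Fin ℓ → Bool) where
  toFun p j := if h : j.1 % 2 = 1 then p.1 ⟨j / 2, by omega⟩ else p.2 ⟨j / 2, by omega⟩
  invFun u := (fun i => u ⟨2 * i + 1, by omega⟩, fun i => u ⟨2 * i, by omega⟩)
  left_inv p := by
    ext i
    · have h1 : (2 * i.1 + 1) % 2 = 1 := by omega
      have h2 : (2 * i.1 + 1) / 2 = i := by omega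
      simp [h2]
    · simp
  right_inv u := by
    ext j
    by_cases h : j.1 % 2 = 1
    · have : 2 * (j.1 / 2) + 1 = j := by omega
      simp [h, this]
    · have : 2 * (j.1 / 2) = j := by omega
      simp [h, this]

theorem deinterleave_ofFn {ℓ : ℕ} (p : (Fin (ℓ / 2) → Bool) × (Fin ((ℓ + 1) / 2) → Bool)) :
    deinterleave (List.ofFn (interleaveEquiv ℓ p)) = (List.ofFn p.2, List.ofFn p.1) := by
  obtain ⟨u, rfl⟩ : ∃ u, (interleaveEquiv ℓ).symm u = p := ⟨_, Equiv.symm_apply_apply _ _⟩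
  rw [Equiv.apply_symm_apply]
  ext1
  · ext1 i
    rw [(getElem?_deinterleave _ i).1, List.getElem?_ofFn, List.getElem?_ofFn]
    by_cases h : i < (ℓ + 1) / 2
    · have : 2 * i < ℓ := by omega
      simp [h, this, interleaveEquiv]
    · have : ¬ 2 * i < ℓ := by omega
      simp [h, this]
  · ext1 i
    rw [(getElem?_deinterleave _ i).2, List.getElem?_ofFn, List.getElem?_ofFn]
    by_cases h : i < ℓ / 2
    · have : 2 * i + 1 < ℓ := by omega
      simp [h, this, interleaveEquiv]
    · have : ¬ 2 * i + 1 < ℓ := by omega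
      simp [h, this]

theorem dot_nil_right (l : List Bool) : dot l [] = false := by cases l <;> rfl

theorem dot_ofFn_add {n : ℕ} (l : List Bool) (r r' : Fin n → Bool) :
    dot l (List.ofFn (r + r')) = (dot l (List.ofFn r) ^^ dot l (List.ofFn r')) := by
  induction n generalizing l with
  | zero => simp [dot_nil_right]
  | succ n ih =>
    cases l with
    | nil => rfl
    | cons a l =>
      have := ih l (fun i => r i.succ) (fun i => r' i.succ)
      simp only [List.ofFn_succ, dot]
      rw [show (fun i : Fin n => (r + r') i.succ) = (fun i : Fin n => r i.succ) +
        (fun i : Fin n => r' i.succ) from rfl, this]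
      have h : (r + r') 0 = (r 0 ^^ r' 0) := rfl
      rw [h]
      cases a <;> cases r 0 <;> cases r' 0 <;> simp

/-- The two lengths differ because for odd `ℓ` the string `r` has one bit more than `y`. -/
theorem dot_ofFn_single {n m : ℕ} (y : Fin n → Bool) (i : Fin n) (hnm : i.1 < m) :
    dot (List.ofFn y) (List.ofFn (Pi.single ⟨i, hnm⟩ true : Fin m → Bool)) = y i := by
  induction n generalizing m with
  | zero => exact i.elim0
  | succ n ih =>
    obtain _ | m := m
    · omega
    simp only [List.ofFn_succ, dot]
    refine Fin.cases (fun hnm => ?_) (fun i hnm => ?_) i hnm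
    · have h : dot (List.ofFn fun i => y i.succ) (List.ofFn (0 : Fin m → Bool)) = false := by
        have := dot_ofFn_add (List.ofFn fun i => y i.succ) (0 : Fin m → Bool) 0
        rwa [add_zero, Bool.xor_self] at this
      have h' : (fun i : Fin m => (Pi.single (⟨((0 : Fin (n + 1)) : ℕ), hnm⟩ : Fin (m + 1)) true :
          Fin (m + 1) → Bool) i.succ) = 0 := by
        funext i
        exact Pi.single_eq_of_ne (Fin.succ_ne_zero i) _
      rw [h', h]
      simp
    · have hi : i.1 < m := by simpa using hnm
      have h0 : (⟨(i.succ : ℕ), hnm⟩ : Fin (m + 1)) = Fin.succ ⟨i, hi⟩ := rfl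
      have h' : (fun j : Fin m => (Pi.single (⟨(i.succ : ℕ), hnm⟩ : Fin (m + 1)) true :
          Fin (m + 1) → Bool) j.succ) = Pi.single ⟨i, hi⟩ true := by
        funext j
        rw [h0]
        simp only [Pi.single_apply, Fin.succ_inj]
      rw [h', ih (fun i => y i.succ) i hi, h0, Pi.single_eq_of_ne (Fin.succ_ne_zero _).symm]
      simp only [show (0 : Bool) = false from rfl, Bool.and_false, Bool.false_xor]

/-- The restriction of a length-preserving permutation to the strings of length `n`. -/
noncomputable def restrictPerm {h : List Bool → List Bool} (hh : IsPolyTimePerm h) (n : ℕ) :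
    (Fin n → Bool) ≃ (Fin n → Bool) :=
  Equiv.ofBijective (fun v j => (h (List.ofFn v)).getD j false) <| by
    refine Finite.injective_iff_bijective.1 fun v v' hv => List.ofFn_injective ?_
    refine hh.bijective.1 (List.ext_getElem (by simp [hh.length_eq]) fun i h1 h2 => ?_)
    have := congrFun hv ⟨i, by simpa [hh.length_eq] using h1⟩
    simpa [List.getD_eq_getElem?_getD, h1, h2] using this

theorem ofFn_restrictPerm {h : List Bool → List Bool} (hh : IsPolyTimePerm h) {n : ℕ}
    (v : Fin n → Bool) : List.ofFn (restrictPerm hh n v) = h (List.ofFn v) := by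
  refine List.ext_getElem (by simp [hh.length_eq]) fun i h1 h2 => ?_
  simp [restrictPerm, List.getD_eq_getElem?_getD, h2]

/-- Parametrising the second half as `h y` replaces the preimage by `y` itself. As `y` ranges
uniformly, so does `h y`, and probabilities are unchanged. -/
theorem hardCoreBit_interleave {h : List Bool → List Bool} (hh : IsPolyTimePerm h) {ℓ : ℕ}
    (y : Fin (ℓ / 2) → Bool) (r : Fin ((ℓ + 1) / 2) → Bool) :
    hardCoreBit h (List.ofFn (interleaveEquiv ℓ (restrictPerm hh _ y, r))) =
      dot (List.ofFn y) (List.ofFn r) := by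
  rw [hardCoreBit, deinterleave_ofFn, ofFn_restrictPerm,
    Function.leftInverse_invFun hh.bijective.1]

end HardTaut

namespace HardTaut

/-! ### The Goldreich–Levin theorem -/

theorem sum_sgn_xor {κ : Type*} [Fintype κ] (f g : κ → Bool) :
    ∑ u, sgn (f u ^^ g u) = 2 * (Nat.card {u // g u = f u} : ℝ) - Fintype.card κ := by
  classical
  have h (u : κ) : sgn (f u ^^ g u) = 2 * (if g u = f u then 1 else 0) - 1 := by
    cases f u <;> cases g u <;> simp [sgn] <;> norm_num
  simp_rw [h, Finset.sum_sub_distrib, ← Finset.mul_sum, Finset.sum_boole, Nat.card_eq_fintype_card,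
    Fintype.card_subtype]
  simp

theorem derives_interleave {ℓ : ℕ} (C : Circuit ℓ 1) (r : Fin ((ℓ + 1) / 2) → Bool) :
    Derives C.size (Set.range (fun (i : Fin (ℓ / 2)) (x : Fin (ℓ / 2) → Bool) => x i) ∪
      Set.range fun (b : Bool) (_ : Fin (ℓ / 2) → Bool) => b)
      {fun x => C.eval (interleaveEquiv ℓ (x, r)) 0} := by
  refine (Derives.circuit C (fun j x => interleaveEquiv ℓ (x, r) j) fun j => ?_).mono le_rfl
    subset_rfl (Set.singleton_subset_iff.2 ⟨0, rfl⟩)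
  by_cases h : j.1 % 2 = 1
  · exact Or.inl ⟨⟨j / 2, by omega⟩, by funext x; simp [interleaveEquiv, h]⟩
  · exact Or.inr ⟨r ⟨j / 2, by omega⟩, by funext x; simp [interleaveEquiv, h]⟩

/-- On input `h y` joined with `r`, the predictor is a noisy oracle for `r ↦ ⟨y, r⟩`. Decoding this
linear form at the unit vectors returns the bits of `y`. -/
theorem exists_inverter {h : List Bool → List Bool} (hh : IsPolyTimePerm h) {ℓ : ℕ}
    (C : Circuit ℓ 1) {ε : ℝ} (hε : 0 < ε)
    (hC : 1 / 2 + ε / 2 ≤ uniformProb fun u : Fin ℓ → Bool =>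
      C.eval u 0 = hardCoreBit h (List.ofFn u))
    {q : ℕ} (hq : 32 * (ℓ / 2 : ℕ) ≤ 2 ^ q * ε ^ 2) :
    ∃ D : Circuit (ℓ / 2) (ℓ / 2),
      D.size ≤ 2 + ℓ / 2 * (2 ^ q * (C.size + 1) + 2 * (2 ^ q + 2) * (2 ^ q + 1)) ∧
      ε ≤ 4 * 2 ^ q * uniformProb fun v : Fin (ℓ / 2) → Bool =>
        D.eval (fun j => (h (List.ofFn v)).getD j false) = v := by
  classical
  have hB : ε * (Fintype.card (Fin (ℓ / 2) → Bool) * Fintype.card (Fin ((ℓ + 1) / 2) → Bool)) ≤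
      ∑ y : Fin (ℓ / 2) → Bool, ∑ r : Fin ((ℓ + 1) / 2) → Bool,
        sgn (dot (List.ofFn y) (List.ofFn r) ^^
          C.eval (interleaveEquiv ℓ (restrictPerm hh _ y, r)) 0) := by
    have h1 := sum_sgn_xor (fun u : Fin ℓ → Bool => hardCoreBit h (List.ofFn u))
      (fun u => C.eval u 0)
    rw [← Equiv.sum_comp (interleaveEquiv ℓ), Fintype.sum_prod_type,
      ← Equiv.sum_comp (restrictPerm hh _)] at h1
    simp_rw [hardCoreBit_interleave hh] at h1
    rw [h1, ← Nat.cast_mul, ← Fintype.card_prod, Fintype.card_congr (interleaveEquiv ℓ)]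
    rw [uniformProb, le_div_iff₀ (by positivity)] at hC
    have h2 : (Fintype.card (Fin ℓ → Bool) : ℝ) = 2 ^ ℓ := by simp
    rw [h2]
    linarith
  obtain ⟨r, b, hrb⟩ := exists_vote (q := q)
    (fun y r => C.eval (interleaveEquiv ℓ (restrictPerm hh _ y, r)) 0)
    (fun y r => dot (List.ofFn y) (List.ofFn r)) (fun y u v => dot_ofFn_add _ u v)
    (fun i : Fin (ℓ / 2) => Pi.single ⟨i, by omega⟩ true) hε hB hq
  -- Two constant gates feed the hard-wired bits of `r` into `C`; they are the summand `2` in the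
  -- size bound.
  have hD := ((Derives.range (T := fun (b : Bool) (_ : Fin (ℓ / 2) → Bool) => b) (c := 1)
    (𝓕 := Set.range fun (i : Fin (ℓ / 2)) (x : Fin (ℓ / 2) → Bool) => x i)
    fun b => Derives.const b).trans_right
      (Derives.vote (fun x v => C.eval (interleaveEquiv ℓ (x, v)) 0) (derives_interleave C)
        (fun i : Fin (ℓ / 2) => Pi.single ⟨i, by omega⟩ true) r b)) 0 _ subset_rfl
          (computes_inputs _)
  obtain ⟨D, hDs, hD⟩ := hD.exists_circuit _ fun i => Or.inr ⟨i, rfl⟩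
  refine ⟨D, hDs.trans (by simp), ?_⟩
  rw [uniformProb, mul_div_assoc', le_div_iff₀ (by positivity)]
  have h2 : (Fintype.card (Fin (ℓ / 2) → Bool) : ℝ) = 2 ^ (ℓ / 2) := by simp
  rw [h2] at hrb
  refine hrb.trans ?_
  rw [Nat.card_eq_fintype_card, Fintype.card_subtype]
  gcongr with y hy
  intro hy
  funext i
  have := hy i
  rw [dot_ofFn_single] at this
  rw [← this, hD]
  rfl

end HardTaut

/-! ### Exponential hardness of the hard-core bit -/

namespace HardTaut

/-- Put `X = ℓ ^ (η / 2)`. Since `ℓ ^ 3 ≤ 2 ^ X` eventually, the left side is at most `2 ^ (18 + 5 *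
X)`. The exponent on the right is at least `X ^ 2 / 3 ^ η`, by `ℓ / 3 ≤ ⌊ℓ / 2⌋`, and it wins once
`X` exceeds both `18` and `6 * 3 ^ η`. Halving `η` is what makes the exponent quadratic in `X`. -/
theorem eventually_pow_mul_lt_two_rpow {η : ℝ} (hη : 0 < η) : ∀ᶠ ℓ : ℕ in atTop,
    10000 * ((ℓ / 2 : ℕ) : ℝ) ^ 3 * (⌈(2 : ℝ) ^ ((ℓ : ℝ) ^ (η / 2))⌉₊ : ℝ) ^ 4 <
      2 ^ (((ℓ / 2 : ℕ) : ℝ) ^ η) := by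
  have hη' : 0 < η / 2 := half_pos hη
  have hX : Tendsto (fun ℓ : ℕ => (ℓ : ℝ) ^ (η / 2)) atTop atTop :=
    (tendsto_rpow_atTop hη').comp tendsto_natCast_atTop_atTop
  have hlog := ((isLittleO_log_rpow_atTop hη').comp_tendsto
    (tendsto_natCast_atTop_atTop (R := ℝ))).bound
    (show (0 : ℝ) < Real.log 2 / 3 from div_pos (Real.log_pos one_lt_two) three_pos)
  filter_upwards [hlog, hX.eventually_gt_atTop 18, hX.eventually_gt_atTop (6 * 3 ^ η),
    eventually_ge_atTop 3] with ℓ h1 h2 h3 h4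
  set X : ℝ := (ℓ : ℝ) ^ (η / 2) with hXdef
  have hℓ : (0 : ℝ) < ℓ := by
    have : 0 < ℓ := by omega
    exact_mod_cast this
  have hXsq : (ℓ : ℝ) ^ η = X ^ 2 := by
    rw [hXdef, ← Real.rpow_natCast, ← Real.rpow_mul hℓ.le]
    norm_num
  have hcube : (ℓ : ℝ) ^ 3 ≤ 2 ^ X := by
    have h5 : Real.log ℓ ≤ Real.log 2 / 3 * X := by
      have h6 : ‖Real.log ℓ‖ ≤ Real.log 2 / 3 * ‖X‖ := h1
      rw [Real.norm_of_nonneg (Real.rpow_nonneg hℓ.le _)] at h6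
      exact (le_abs_self _).trans h6
    rw [← Real.log_le_log_iff (by positivity) (by positivity), Real.log_pow,
      Real.log_rpow two_pos]
    push_cast
    linarith
  have hS : (⌈(2 : ℝ) ^ X⌉₊ : ℝ) ≤ 2 * 2 ^ X := by
    have h5 : (1 : ℝ) ≤ 2 ^ X := Real.one_le_rpow one_le_two (by linarith)
    have := (Nat.ceil_lt_add_one (show (0 : ℝ) ≤ 2 ^ X by positivity)).le
    linarith
  have hn : ((ℓ / 2 : ℕ) : ℝ) ≤ ℓ := by exact_mod_cast Nat.div_le_self ℓ 2
  have hn' : (ℓ : ℝ) / 3 ≤ ((ℓ / 2 : ℕ) : ℝ) := by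
    rw [div_le_iff₀ three_pos]
    have : ℓ ≤ ℓ / 2 * 3 := by omega
    exact_mod_cast this
  calc _ ≤ 10000 * (ℓ : ℝ) ^ 3 * (2 * 2 ^ X) ^ 4 := by gcongr
    _ ≤ 10000 * 2 ^ X * (2 * 2 ^ X) ^ 4 := by gcongr
    _ = 160000 * (2 ^ X) ^ 5 := by ring
    _ ≤ 2 ^ (18 : ℝ) * (2 ^ X) ^ 5 := by
      gcongr
      norm_num
    _ = 2 ^ (18 + X * 5) := by
      rw [Real.rpow_add two_pos, Real.rpow_mul two_pos.le]
      norm_num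
    _ < 2 ^ (X ^ 2 / 3 ^ η) := by
      refine Real.rpow_lt_rpow_of_exponent_lt one_lt_two ?_
      rw [lt_div_iff₀ (by positivity)]
      have h0 : (0 : ℝ) < 3 ^ η := by positivity
      nlinarith
    _ ≤ _ := by
      refine Real.rpow_le_rpow_of_exponent_le one_le_two ?_
      rw [← hXsq, ← Real.div_rpow hℓ.le three_pos.le]
      exact Real.rpow_le_rpow (by positivity) hn' hη.le

/-- The Goldreich–Levin theorem: the hard-core bit of an exponentially hard one-way permutation is
exponentially hard to predict. -/
theorem hasExpHardness_hardCoreBit {h : List Bool → List Bool} (hh : IsExpHardOWP h) :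
    HasExpHardness (hardCoreBit h) := by
  obtain ⟨hperm, ε, t, hone, η, hη, hev⟩ := hh
  refine ⟨η / 2, half_pos hη, ?_⟩
  have hdiv : Tendsto (fun ℓ : ℕ => ℓ / 2) atTop atTop :=
    Nat.tendsto_div_const_atTop two_ne_zero
  filter_upwards [hdiv.eventually hev, eventually_pow_mul_lt_two_rpow hη, eventually_ge_atTop 2]
    with ℓ ⟨hε, ht⟩ hlt h2
  set S := ⌈(2 : ℝ) ^ ((ℓ : ℝ) ^ (η / 2))⌉₊
  have hS : 1 ≤ S := Nat.one_le_ceil_iff.2 (by positivity)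
  refine le_iSup₂_of_le S ⟨hS, fun C hC => ?_⟩ le_rfl
  by_contra! hcon
  set n := ℓ / 2
  have hn : 1 ≤ n := by omega
  -- The decoder with advantage `1 / S` needs `2 ^ q` at least `32 * n * S ^ 2`; a power of two
  -- exists within a factor of two.
  obtain ⟨q, hq1, hq2⟩ : ∃ q, 32 * n * S ^ 2 ≤ 2 ^ q ∧ 2 ^ q ≤ 64 * n * S ^ 2 := by
    have h0 : 32 * n * S ^ 2 ≠ 0 := by positivity
    refine ⟨Nat.log 2 (32 * n * S ^ 2) + 1, (Nat.lt_pow_succ_log_self one_lt_two _).le, ?_⟩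
    have := Nat.pow_log_le_self 2 h0
    rw [pow_succ]
    linarith
  have hS0 : (0 : ℝ) < S := by exact_mod_cast hS
  obtain ⟨D, hD, hsucc⟩ := exists_inverter hperm C (ε := 1 / S) (by positivity) hcon (q := q) (by
    rw [div_pow, one_pow, mul_one_div, le_div_iff₀ (by positivity)]
    exact_mod_cast hq1)
  have hsize : D.size ≤ 10000 * n ^ 3 * S ^ 4 := by
    have hnS : 1 ≤ n * S ^ 2 := Nat.mul_pos hn (pow_pos hS 2)
    have hnS' : n * S ^ 3 ≤ n ^ 2 * S ^ 4 :=
      Nat.mul_le_mul (Nat.le_self_pow two_ne_zero n) (Nat.pow_le_pow_right hS (by norm_num))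
    have h3 : 1 ≤ n ^ 3 * S ^ 4 := Nat.mul_pos (pow_pos hn 3) (pow_pos hS 4)
    calc _ ≤ 2 + n * (2 ^ q * (S + S) + 2 * (2 ^ q + 2) * (2 ^ q + 1)) := by
          refine hD.trans ?_
          gcongr
      _ ≤ 2 + n * (64 * n * S ^ 2 * (S + S) + 2 * (64 * n * S ^ 2 + 2 * (n * S ^ 2)) *
            (64 * n * S ^ 2 + n * S ^ 2)) := by
          gcongr
          omega
      _ = 2 + n * (128 * (n * S ^ 3)) + 8580 * (n ^ 3 * S ^ 4) := by ring
      _ ≤ 2 + n * (128 * (n ^ 2 * S ^ 4)) + 8580 * (n ^ 3 * S ^ 4) := by gcongr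
      _ = 2 + 8708 * (n ^ 3 * S ^ 4) := by ring
      _ ≤ _ := by linarith
  have hD1 : (D.size : ℝ) ≤ 10000 * (n : ℝ) ^ 3 * (S : ℝ) ^ 4 := by exact_mod_cast hsize
  have hinv := (hone n D (hD1.trans (hlt.le.trans ht))).trans hε
  rw [Real.rpow_neg two_pos.le] at hinv
  set T : ℝ := 2 ^ ((n : ℝ) ^ η)
  have hT : 0 < T := by positivity
  have h5 : 1 / (S : ℝ) ≤ 4 * (64 * n * S ^ 2) * T⁻¹ := by
    refine hsucc.trans ?_
    have : (2 : ℝ) ^ q ≤ 64 * n * S ^ 2 := by exact_mod_cast hq2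
    have h0 : 0 ≤ uniformProb fun v : Fin n → Bool =>
        D.eval (fun j => (h (List.ofFn v)).getD j false) = v := by
      unfold uniformProb
      positivity
    gcongr
  -- The success probability forces `T ≤ 256 * n * S ^ 3`, whereas `T` exceeds `10000 * n ^ 3 * S ^
  -- 4`, the quantity that also bounds the size of the inverter.
  rw [← div_eq_mul_inv, div_le_div_iff₀ hS0 hT, one_mul] at h5
  have h6 : 4 * (64 * n * S ^ 2) * S ≤ 10000 * n ^ 3 * S ^ 4 := by
    calc _ = 256 * (n ^ 1 * S ^ 3) := by ring
      _ ≤ 10000 * (n ^ 3 * S ^ 4) := by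
        gcongr <;> omega
      _ = _ := by ring
  have h7 : 4 * (64 * (n : ℝ) * (S : ℝ) ^ 2) * S ≤ 10000 * (n : ℝ) ^ 3 * (S : ℝ) ^ 4 := by
    exact_mod_cast h6
  linarith

end HardTaut

namespace HardTaut

/-! ### The circuit that guesses witnesses for the bits of the generator -/

namespace Derives

variable {n c : ℕ} {𝓕 : Set ((Fin n → Bool) → Bool)}

theorem getElem?_ofFn {k : ℕ} (a : Fin k → (Fin n → Bool) → Bool) (ha : ∀ i, a i ∈ 𝓕) (i : ℕ)
    (b : Bool) : Derives 1 𝓕 {fun x => decide ((List.ofFn fun j => a j x)[i]? = some b)} := by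
  simp only [List.getElem?_ofFn]
  split_ifs with h
  · cases b
    · exact (of_mem (ha ⟨i, h⟩)).not.congr fun x => by simp
    · exact ((of_mem (ha ⟨i, h⟩)).congr fun x => by simp).mono_cost zero_le_one
  · exact (const false).congr fun x => by simp

theorem getElem?_encodePair_replicate (m : ℕ) {k : ℕ} (a : Fin k → (Fin n → Bool) → Bool)
    (ha : ∀ i, a i ∈ 𝓕) (i : ℕ) (γ : Option Bool) : Derives 1 𝓕 {fun x =>
      decide ((encodePair (List.replicate m true, List.ofFn fun j => a j x))[i]? = some γ)} := by
  simp only [encodePair]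
  rcases lt_trichotomy i m with h | rfl | h
  · exact (const (decide (some true = γ))).congr fun x => by simp [List.getElem?_append, h]
  · exact (const (decide (none = γ))).congr fun x => by simp
  · obtain ⟨j, rfl⟩ : ∃ j, i = m + 1 + j := ⟨i - (m + 1), by omega⟩
    have h1 : m + 1 + j - m = j + 1 := by omega
    have h2 : ¬ m + 1 + j < m := by omega
    rcases γ with _ | b
    · exact (const false).congr fun x => by
        simp [List.getElem?_append, h1, h2, -List.getElem?_ofFn, -List.map_ofFn]
    · exact (getElem?_ofFn a ha j b).congr fun x => by
        simp [List.getElem?_append, h1, h2, -List.getElem?_ofFn, -List.map_ofFn]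

/-- The values of `w` at the positions selected by available functions. -/
theorem getElem?_map_filter {κ : Type*} (L : List κ) (χ : κ → (Fin n → Bool) → Bool)
    (hχ : ∀ j, χ j ∈ 𝓕) (w : κ → Bool) (m : ℕ) :
    Derives ((L.length + 1) * (m * 10)) 𝓕 (Set.range fun (p : Fin m × Bool) x =>
      decide (((L.filter fun j => χ j x).map w)[p.1.1]? = some p.2)) := by
  induction L with
  | nil =>
    refine (Derives.range (c := 1) fun p : Fin m × Bool => ?_).mono_cost ?_
    · exact (const false).congr fun x => by simp
    · simp; omega
  | cons a L ih =>
    refine (ih.trans_right (Derives.range (c := 5) (κ := Fin m × Bool) fun p => ?_)).mono_cost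
      (c₂ := _) ?_
    · obtain ⟨⟨p, hp⟩, b⟩ := p
      set 𝓖 := 𝓕 ∪ Set.range fun (p : Fin m × Bool) (x : Fin n → Bool) =>
        decide (((L.filter fun j => χ j x).map w)[p.1.1]? = some p.2)
      have hmem (p' : ℕ) (hp' : p' < m) :
          Derives 0 𝓖 {fun x => decide (((L.filter fun j => χ j x).map w)[p']? = some b)} :=
        of_mem (Or.inr ⟨(⟨p', hp'⟩, b), rfl⟩)
      have ha : Derives 0 𝓖 {χ a} := of_mem (Or.inl (hχ a))
      cases p with
      | zero =>
        refine (ha.cond (const (decide (w a = b))) (hmem 0 hp)).congr fun x => ?_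
        cases hx : χ a x <;> simp [hx]
      | succ p =>
        refine ((ha.cond (hmem p (by omega)) (hmem (p + 1) hp)).congr fun x => ?_).mono_cost
          (by norm_num)
        cases hx : χ a x <;> simp [hx]
    · simp only [Fintype.card_prod, Fintype.card_fin, Fintype.card_bool, List.length_cons]
      ring_nf
      omega

theorem dot (l : List ((Fin n → Bool) → Bool)) (hl : ∀ f ∈ l, f ∈ 𝓕)
    (r : (Fin n → Bool) → List Bool)
    (hr : ∀ i < l.length, Derives c 𝓕 {fun x => decide ((r x)[i]? = some true)}) :
    Derives (l.length * (c + 6) + 1) 𝓕 {fun x => HardTaut.dot (l.map fun f => f x) (r x)} := by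
  induction l generalizing r with
  | nil => exact ((const false).congr fun x => rfl).mono_cost (by simp)
  | cons f l ih =>
    have h1 := ih (fun g hg => hl g (List.mem_cons_of_mem _ hg)) (fun x => (r x).tail)
      fun i hi => (hr (i + 1) (by simpa using hi)).congr fun x => by rw [List.getElem?_tail]
    have h2 := ((of_mem (hl f List.mem_cons_self)).and (hr 0 (by simp))).xor h1
    refine (h2.congr fun x => ?_).mono_cost ?_
    · cases hx : r x <;> simp [HardTaut.dot, dot_nil_right]
    · simp only [List.length_cons]
      ring_nf
      omega

/-- Two lists of the same length are equal. -/
theorem list_eq (l l' : (Fin n → Bool) → List Bool) (m : ℕ) (hl : ∀ x, (l x).length = m)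
    (hl' : ∀ x, (l' x).length = m)
    (h : ∀ i < m, Derives 0 𝓕 {fun x => decide ((l x)[i]? = some true)})
    (h' : ∀ i < m, Derives 0 𝓕 {fun x => decide ((l' x)[i]? = some true)}) :
    Derives (m * 7 + 1) 𝓕 {fun x => l x == l' x} := by
  have := list_all (List.finRange m) fun j _ => ((h j j.2).xor (h' j j.2)).not
  refine (this.congr fun x => ?_).mono_cost (by simp)
  rw [Bool.eq_iff_iff, beq_iff_eq, List.all_eq_true]
  constructor
  · intro h j _
    simp [h]
  · intro h
    refine List.ext_getElem ((hl x).trans (hl' x).symm) fun i h1 h2 => ?_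
    have := h ⟨i, hl x ▸ h1⟩ (List.mem_finRange _)
    simp only [List.getElem?_eq_getElem h1, List.getElem?_eq_getElem h2] at this
    cases h3 : (l x)[i] <;> cases h4 : (l' x)[i] <;> simp [h3, h4] at this ⊢

end Derives

/-- The string `w(J)`, where `J` has the characteristic string `χ`. -/
def selectBits {n : ℕ} (w : Fin n → Bool) (χ : List Bool) : List Bool :=
  ((List.finRange n).filter fun j => decide (χ[j.1]? = some true)).map w

/-- The seed `w` is hard-wired. The circuit computes the characteristic string of the design set
from its index, selects `u`, and tests the Goldreich–Levin relation on `u` and `y`. The constant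
length of `u` puts its two halves at fixed wires. `X` and `Y` locate the index and the witness among
the inputs; all other inputs are ignored. -/
theorem exists_verifier {h : List Bool → List Bool} (hh : IsPolyTimePerm h)
    {g : List Bool → List Bool → List Bool} (hg : PolyTimeFun₂ g) :
    ∃ E : ℕ, ∀ (n k ℓ T : ℕ) (w : Fin n → Bool) (X : Fin k → Fin T) (Y : Fin (ℓ / 2) → Fin T),
      k ≤ n → ℓ ≤ n →
      (∀ x : Fin k → Bool, (selectBits w (g (List.replicate n true) (List.ofFn x))).length = ℓ) →
      ∃ C : Circuit T 1, C.size ≤ E * (n + 1) ^ E ∧ ∀ z, C.eval z 0 = hardCoreRel h true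
        (selectBits w (g (List.replicate n true) (List.ofFn fun i => z (X i))))
        (List.ofFn fun i => z (Y i)) := by
  obtain ⟨cg⟩ := hg
  obtain ⟨ch⟩ := hh.polyTime
  obtain ⟨Eg, hEg⟩ := derives_of_polyTime cg
  obtain ⟨Eh, hEh⟩ := derives_of_polyTime ch
  -- The terms pay for `g` on an encoded pair of length `n + 1 + k`, for the selection, for `h`, and
  -- for the comparison and the inner product.
  obtain ⟨E, hE⟩ := polynomial_eval_le (.C Eg * (2 * .X + 2) ^ Eg + ((.X + 1) * (.X * 10) +
    (.C Eh * (.X + 1) ^ Eh + ((.X * 7 + 1) + (.X * 6 + 1) + 1))))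
  refine ⟨E, fun n k ℓ T w X Y hk hℓ hlen => ?_⟩
  set u : (Fin T → Bool) → List Bool := fun z =>
    selectBits w (g (List.replicate n true) (List.ofFn fun i => z (X i)))
  set y : (Fin T → Bool) → List Bool := fun z => List.ofFn fun i => z (Y i)
  have hu (z) : (u z).length = ℓ := hlen _
  set 𝓘 : Set ((Fin T → Bool) → Bool) := Set.range fun i z => z i
  have hI (i : Fin T) : (fun z => z i) ∈ 𝓘 := ⟨i, rfl⟩
  have h1 := hEg T 𝓘 (n + 1 + k)
    (fun z => (List.replicate n true, List.ofFn fun i => z (X i)))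
    (fun z => by simp [encodePair]; omega)
    (fun i γ => (Derives.getElem?_encodePair_replicate n (fun i z => z (X i)) (fun i => hI _)
      i γ).congr fun z => decide_eq_decide.2 Iff.rfl)
  have h2 := h1.trans_of_right ((Derives.getElem?_map_filter (List.finRange n)
    (𝓕 := Set.range fun (j : Fin n) z => decide
      ((g (List.replicate n true) (List.ofFn fun i => z (X i)))[j.1]? = some true))
    (fun j z => decide ((g (List.replicate n true) (List.ofFn fun i => z (X i)))[j.1]? = some true))
    (fun j => ⟨j, rfl⟩) w ℓ).mono le_rfl (by
      rintro _ ⟨j, rfl⟩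
      exact ⟨(j.1, true), funext fun z => decide_eq_decide.2 Iff.rfl⟩) subset_rfl)
  have h3 := hEh T 𝓘 (ℓ / 2) y (fun z => by simp [y])
    (fun i b => (Derives.getElem?_ofFn (fun i z => z (Y i)) (fun i => hI _) i b).congr
      fun z => decide_eq_decide.2 Iff.rfl)
  set 𝓤 : Set ((Fin T → Bool) → Bool) := Set.range fun (p : Fin ℓ × Bool) z =>
    decide ((u z)[p.1.1]? = some p.2)
  have h2' : Derives _ 𝓘 𝓤 := h2
  have h23 := h2'.union h3
  have hmemu (i : ℕ) (hi : i < ℓ) {𝓕} (h𝓕 : 𝓤 ⊆ 𝓕) :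
      Derives 0 𝓕 {fun z => decide ((u z)[i]? = some true)} :=
    .of_mem (h𝓕 ⟨(⟨i, hi⟩, true), rfl⟩)
  have h4 := h23.trans_right ((Derives.list_eq (fun z => h (y z))
      (fun z => (deinterleave (u z)).2) (ℓ / 2) (fun z => by simp [hh.length_eq, y])
      (fun z => by rw [length_deinterleave_snd, hu]) (fun i hi => ?_) fun i hi => ?_).and
    (Derives.dot (c := 0) (List.ofFn fun i z => z (Y i)) ?_ (fun z => (deinterleave (u z)).1)
      fun i hi => ?_))
  · obtain ⟨C, hC, hC'⟩ := (h4 0 𝓘 subset_rfl (computes_inputs T)).exists_circuit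
      (fun _ : Fin 1 => _) fun _ => Or.inr rfl
    refine ⟨C, (hC.trans ?_).trans (hE n), fun z => (hC' z 0).trans ?_⟩
    · have h5 : ℓ / 2 ≤ n := by omega
      have h6 : (n + 1 + k + 1) ^ Eg ≤ (2 * n + 2) ^ Eg := Nat.pow_le_pow_left (by omega) _
      simp only [List.length_finRange, List.length_ofFn, zero_add]
      calc _ ≤ Eg * (2 * n + 2) ^ Eg + (n + 1) * (n * 10) + Eh * (n + 1) ^ Eh +
            (n * 7 + 1 + (n * 6 + 1) + 1) := by
              gcongr
        _ = _ := by
              simp only [Polynomial.eval_add, Polynomial.eval_mul, Polynomial.eval_pow,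
                Polynomial.eval_C, Polynomial.eval_X, Polynomial.eval_one, Polynomial.eval_ofNat]
              ring
    · simp only [List.map_ofFn, Function.comp_def, hardCoreRel, beq_true, y]
      rfl
  · exact .of_mem (Or.inr (Or.inr ⟨(i, true), funext fun z => decide_eq_decide.2 Iff.rfl⟩))
  · exact (hmemu (2 * i + 1) (by omega)
      (Set.subset_union_left.trans Set.subset_union_right)).congr fun z => by
        rw [(getElem?_deinterleave _ i).2]
  · intro f hf
    obtain ⟨i, rfl⟩ := List.mem_ofFn.1 hf
    exact Or.inl (hI _)
  · rw [List.length_ofFn] at hi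
    exact (hmemu (2 * i) (by omega)
      (Set.subset_union_left.trans Set.subset_union_right)).congr fun z => by
        rw [(getElem?_deinterleave _ i).1]

end HardTaut

namespace HardTaut

/-! ### Parameters of the generator -/

theorem floor_rpow_le {n : ℕ} (hn : 1 ≤ n) {δ : ℝ} (hδ : δ ≤ 1) : ⌊(n : ℝ) ^ δ⌋₊ ≤ n := by
  refine Nat.floor_le_of_le ?_
  have : (1 : ℝ) ≤ n := by exact_mod_cast hn
  simpa using Real.rpow_le_rpow_of_exponent_le this hδ

/-- With `k = logM δ n ≥ 2`, the rounding costs at most a square: `n ^ δ ≤ k + 1 ≤ k ^ 2`. Raising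
to a power `a ≥ 1 / δ` shows that bounds polynomial in `n` are polynomial in `k`. -/
theorem le_logM_pow {δ : ℝ} {a : ℕ} (ha : 1 ≤ δ * a) {n : ℕ} (hn : 1 ≤ n)
    (hk : 2 ≤ logM δ n) : n ≤ logM δ n ^ (2 * a) := by
  have h1 : (1 : ℝ) ≤ n := by exact_mod_cast hn
  have h2 : (n : ℝ) ^ δ ≤ (logM δ n : ℝ) ^ 2 := by
    have h3 := (Nat.lt_floor_add_one ((n : ℝ) ^ δ)).le
    have h4 : (2 : ℝ) ≤ logM δ n := by exact_mod_cast hk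
    refine h3.trans ?_
    change (logM δ n : ℝ) + 1 ≤ _
    nlinarith
  have : (n : ℝ) ≤ (logM δ n : ℝ) ^ (2 * a) := by
    calc (n : ℝ) = (n : ℝ) ^ (1 : ℝ) := (Real.rpow_one _).symm
      _ ≤ (n : ℝ) ^ (δ * a) := Real.rpow_le_rpow_of_exponent_le h1 ha
      _ = ((n : ℝ) ^ δ) ^ a := by rw [Real.rpow_mul (by positivity), Real.rpow_natCast]
      _ ≤ ((logM δ n : ℝ) ^ 2) ^ a := by gcongr
      _ = _ := (pow_mul _ _ _).symm
  exact_mod_cast this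

theorem tendsto_logM {δ : ℝ} (hδ : 0 < δ) : Tendsto (logM δ) atTop atTop :=
  tendsto_nat_floor_atTop.comp ((tendsto_rpow_atTop hδ).comp tendsto_natCast_atTop_atTop)

theorem selectBits_ofFn {n : ℕ} (w : Fin n → Bool) (J : Finset (Fin n)) :
    selectBits w (List.ofFn fun j => decide (j ∈ J)) = restrictTo w J := by
  simp [selectBits, restrictTo]

theorem length_restrictTo {n : ℕ} (w : Fin n → Bool) (J : Finset (Fin n)) :
    (restrictTo w J).length = J.card := by
  have h : ((List.finRange n).filter fun j => decide (j ∈ J)).toFinset = J := by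
    ext j; simp
  rw [restrictTo, List.length_map, ← h, List.toFinset_card_of_nodup
    ((List.nodup_finRange n).filter _), h]

theorem exists_fin_indexBits_eq {k : ℕ} (x : Fin k → Bool) :
    ∃ i : Fin (2 ^ k), indexBits k i = List.ofFn x := by
  obtain ⟨i, hi⟩ := exists_indexBits_eq (List.ofFn x)
  rw [List.length_ofFn] at hi
  exact ⟨⟨i % 2 ^ k, Nat.mod_lt _ (by positivity)⟩, (indexBits_mod k i).trans hi⟩

/-! ### The truth tables of the sets of tautologies -/

/-- The witness merely announces `k` by its length, and `k ≤ 2 ^ k` is at most the length of the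
table. The cutoff `k₀` will force large `k`. -/
theorem inNP_tautTable (k₀ : ℕ) : InNP {z | (∃ k, z = tautTable k) ∧ k₀ ≤ z.length} := by
  refine ⟨tableRel k₀, 1, polyTimeRel_tableRel k₀, fun z => ⟨?_, ?_⟩⟩
  · rintro ⟨⟨k, rfl⟩, hk⟩
    refine ⟨List.replicate k false, ?_, ?_⟩
    · simpa [length_tautTable] using Nat.lt_two_pow_self.le
    · simpa [tableRel] using hk
  · rintro ⟨v, -, hv⟩
    obtain ⟨h1, h2⟩ := of_decide_eq_true hv
    exact ⟨⟨_, h1⟩, h2⟩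

/-- The table for `k = logM δ n` has length exactly `m(n)`, and `logM δ` is unbounded. -/
theorem infinite_tautTable {δ : ℝ} (hδ : 0 < δ) (k₀ : ℕ) :
    {z ∈ {z | (∃ k, z = tautTable k) ∧ k₀ ≤ z.length} |
      ∃ n, 1 ≤ n ∧ z.length = 2 ^ logM δ n}.Infinite := by
  refine Set.Infinite.of_image List.length (Set.infinite_of_not_bddAbove ?_)
  rintro ⟨M, hM⟩
  obtain ⟨n, hn, hn1⟩ := (((tendsto_logM hδ).eventually_ge_atTop (M + k₀)).and
    (eventually_ge_atTop 1)).exists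
  have h1 : M + k₀ < 2 ^ logM δ n := hn.trans_lt Nat.lt_two_pow_self
  have := hM ⟨tautTable (logM δ n), ⟨⟨⟨_, rfl⟩, by rw [length_tautTable]; omega⟩, n, hn1,
    length_tautTable _⟩, length_tautTable _⟩
  omega

/-- If the generator attached to the hard-core bit hits the truth table of the tautologies, then
the witnesses for the bits of the table give a hard instance of `Cert`. -/
theorem exists_certInput {h : List Bool → List Bool} (hh : IsPolyTimePerm h) {δ : ℝ} (hδ : 0 < δ)
    (hδ1 : δ ≤ 1 / 3) {A : SetSystems δ} (hA : IsUniformDesign δ A) :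
    ∃ c : ℕ, 1 ≤ c ∧ ∀ (n : ℕ) (w : Fin n → Bool), 1 ≤ n → 2 ≤ logM δ n →
      NW A (hardCoreBit h) n w = tautTable (logM δ n) →
      ∃ D : Circuit (logM δ n + logM δ n ^ c) 1, IsCertInput c (logM δ n) D ∧
        ¬ ∃ x, IsCertSolution c (logM δ n) D x := by
  classical
  obtain ⟨g, hg, hgA⟩ := hA.polyTime
  obtain ⟨E, hE⟩ := exists_verifier hh hg
  obtain ⟨a, ha⟩ := exists_nat_ge (1 / δ)
  have ha : 1 ≤ δ * a := by rwa [div_le_iff₀' hδ] at ha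
  -- Large enough for the exponent `E + (2 * a + 1) * E` of the circuit size and for the exponent `2
  -- * a` bounding the witness length.
  set c := E + (2 * a + 1) * E + 2 * a + 1 with hc
  refine ⟨c, by omega, fun n w hn hk hNW => ?_⟩
  have hnk := le_logM_pow ha hn hk
  have hkn : logM δ n ≤ n := floor_rpow_le hn (by linarith)
  have hℓn : seedLen n ≤ n := floor_rpow_le hn (by norm_num)
  set k := logM δ n
  have hk0 : 0 < k := by omega
  have hℓc : seedLen n / 2 ≤ k ^ c := (Nat.div_le_self _ _).trans
    (hℓn.trans (hnk.trans (Nat.pow_le_pow_right hk0 (by omega))))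
  have hsel (x : Fin k → Bool) (i : Fin (2 ^ k)) (hi : indexBits k i = List.ofFn x) :
      selectBits w (g (List.replicate n true) (List.ofFn x)) = restrictTo w (A n i) := by
    rw [← hi, hgA n hn i, selectBits_ofFn]
  -- The variables `x` are the index; the first `seedLen n / 2` of the variables `y` carry the
  -- witness, and the others are dummies.
  obtain ⟨D, hD, hDeval⟩ := hE n k (seedLen n) (k + k ^ c) w (Fin.castAdd _)
    (fun i => Fin.natAdd k ⟨i, by omega⟩) hkn hℓn fun x => by
      obtain ⟨i, hi⟩ := exists_fin_indexBits_eq x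
      rw [hsel x i hi, length_restrictTo, hA.card_eq n hn]
  refine ⟨D, ?_, ?_⟩
  · have h1 : n + 1 ≤ k ^ (2 * a + 1) := by
      calc n + 1 ≤ n * 2 := by omega
        _ ≤ k ^ (2 * a) * k := Nat.mul_le_mul hnk hk
        _ = _ := (pow_succ _ _).symm
    calc D.size ≤ E * (n + 1) ^ E := hD
      _ ≤ k ^ E * (k ^ (2 * a + 1)) ^ E := by
        gcongr
        exact Nat.lt_two_pow_self.le.trans (Nat.pow_le_pow_left hk E)
      _ = k ^ (E + (2 * a + 1) * E) := by rw [← pow_mul, ← pow_add]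
      _ ≤ k ^ (c ^ 2) := Nat.pow_le_pow_right hk0
        ((show _ ≤ c by omega).trans (Nat.le_self_pow two_ne_zero c))
  · rintro ⟨x, φ, hφ, hsol⟩
    obtain ⟨i, hi⟩ := exists_fin_indexBits_eq x
    set u := restrictTo w (A n i)
    have hu : u.length = seedLen n := by rw [length_restrictTo, hA.card_eq n hn]
    -- The bit of the generator at the index coded by `x` is the entry of the table there; that
    -- entry concerns `φ` because the code is injective.
    have htaut : hardCoreBit h u = true ↔ φ.Tautology := by
      have h1 : (NW A (hardCoreBit h) n w)[i.1]? = (tautTable k)[i.1]? := by rw [hNW]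
      have h2 : i.1 < 2 ^ logM δ n := i.2
      simp only [NW, tautTable, List.getElem?_ofFn, h2, i.2, dif_pos, Option.some_inj] at h1
      change hardCoreBit h u = _ at h1
      rw [h1, decide_eq_true_iff, hi]
      refine ⟨?_, fun h => ⟨φ, hφ, h⟩⟩
      rintro ⟨ψ, hψ, hψ'⟩
      rwa [← PropFormula.encode_injective (hψ.trans hφ.symm)]
    have hacc (y : Fin (k ^ c) → Bool) : D.Accepts x y ↔
        (List.ofFn fun j : Fin (seedLen n / 2) => y ⟨j, by omega⟩) =
          Function.invFun h (deinterleave u).2 ∧ hardCoreBit h u = true := by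
      rw [← hardCoreRel_eq_true_iff hh, Circuit.Accepts, hDeval]
      simp only [Fin.append_left, Fin.append_right, hsel x i hi]
      rfl
    rcases hsol with ⟨⟨α, hα⟩, y, hy⟩ | ⟨h1, h2⟩
    · have := htaut.1 ((hacc y).1 hy).2 α
      rw [hα] at this
      exact Bool.false_ne_true this
    -- The true witness, padded with `false` to `k ^ c` bits, makes `D` accept a tautology.
    · refine h2 ⟨fun j => (Function.invFun h (deinterleave u).2).getD j false,
        (hacc _).2 ⟨?_, htaut.2 h1⟩⟩
      have hlen : (Function.invFun h (deinterleave u).2).length = seedLen n / 2 := by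
        rw [← hh.length_eq, Function.rightInverse_invFun hh.bijective.surjective,
          length_deinterleave_snd, hu]
      refine List.ext_getElem (by simp [hlen]) fun j h1 h2 => ?_
      simp [List.getD_eq_getElem?_getD, h2]

end HardTaut

/-! ### The corollary -/

theorem mainTheorem4
    (hConj : HardTaut.NWConjecture)
    (hOWP : ∃ h : List Bool → List Bool, HardTaut.IsExpHardOWP h) :
    ∃ c : ℕ, 1 ≤ c ∧
      {k : ℕ | 1 ≤ k ∧ ∃ D : HardTaut.Circuit (k + k ^ c) 1,
        HardTaut.IsCertInput c k D ∧
          ¬ ∃ x : Fin k → Bool, HardTaut.IsCertSolution c k D x}.Infinite := by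
  obtain ⟨h, hh⟩ := hOWP
  obtain ⟨δ, hδ, hδ1, A, hA, hR⟩ := hConj (HardTaut.hardCoreBit h)
    (HardTaut.isNPcoNPUnique_hardCoreBit hh.1) (HardTaut.hasExpHardness_hardCoreBit hh)
  obtain ⟨c, hc, hcert⟩ := HardTaut.exists_certInput hh.1 hδ hδ1 hA
  refine ⟨c, hc, Set.infinite_of_not_bddAbove ?_⟩
  rintro ⟨M, hM⟩
  -- Tables of length at least `2 ^ (M + 2)` have `k ≥ M + 2`, which exceeds the supposed bound `M`
  -- and also meets the requirement `2 ≤ k`.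
  obtain ⟨_, ⟨n, hn, w, rfl⟩, ⟨k, hk⟩, hlen⟩ := hR _
    (HardTaut.inNP_tautTable (2 ^ (M + 2))) (HardTaut.infinite_tautTable hδ _)
  have h1 : 2 ^ HardTaut.logM δ n = 2 ^ k := by
    rw [← HardTaut.length_tautTable k, ← hk, HardTaut.NW, List.length_ofFn]
  obtain rfl := Nat.pow_right_injective le_rfl h1
  have h2 : M + 2 ≤ HardTaut.logM δ n := by
    rw [hk, HardTaut.length_tautTable] at hlen
    exact (Nat.pow_le_pow_iff_right one_lt_two).1 hlen
  have := hM ⟨by omega, hcert n w hn (by omega) hk⟩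
  omega
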